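/- **Setting.** Fix countable sets $\mathsf{IRIs}$, $\mathsf{Literals}$, $\mathsf{Blanks}$, a countably infinite set $\mathsf{Names}$ of shape names, and a set of value types $t$, each interpreted as a set $[\![t]\!]\subseteq \mathsf{IRIs}\cup\mathsf{Literals}\cup\mathsf{Blanks}$. An RDF graph $\mathcal G$ is a finite subset of $(\mathsf{IRIs}\cup\mathsf{Blanks})\times\mathsf{IRIs}\times(\mathsf{IRIs}\cup\mathsf{Blanks}\cup\mathsf{Literals})$; $\mathsf{Nodes}(\mathcal G)$ is the set of terms in subject or object position. Below $c\in\mathsf{IRIs}\cup\mathsf{Literals}$, $p\in\mathsf{IRIs}$, $q$ is $p$ or $p^-$, $Q,R$ are finite sets of IRIs, $s\in\mathsf{Names}$, $n\in\mathbb N$. **Restricted SHACL** has the shapes $$\varphi ::= \top \mid \bot \mid \mathsf{test}(c)\mid \mathsf{test}(t)\mid s\mid \mathsf{closed}(Q)\mid \neg\varphi\mid\varphi\wedge\varphi\mid\varphi\vee\varphi\mid\ \ge_n q.\varphi\ \mid\ \le_n q.\varphi\ \mid \exists\pi.\varphi,$$ with paths $\pi ::= \mathsf{id}\mid p\mid\pi^-\mid\pi\cdot\pi\mid\pi\cup\pi\mid\pi^*$.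 **Restricted ShEx** has the shapes $$\varphi ::= \mathsf{test}(c)\mid \mathsf{test}(t)\mid s\mid\{f;(\neg R^-)^*\}\mid\{f;(\neg R^-)^*;(\neg Q)^*\}\mid\varphi\wedge\varphi\mid\varphi\vee\varphi\mid\neg\varphi,$$ with $f ::= f'\mid f'^*\mid f;f\mid f\,|\,f$ and $f' ::= \varepsilon\mid p.\varphi\mid p^-.\varphi\mid f'\,|\,f'$. **Semantics of shapes.** A catalogue $\mathcal C$ is a finite partial function from names to shapes in which every used name is declared. Its domain of evaluation on $\mathcal G$ is $D=\mathsf{Nodes}(\mathcal G)\cup\mathsf{Const}(\mathcal C)$, where $\mathsf{Const}(\mathcal C)$ is the set of the constants $c$ with $\mathsf{test}(c)$ in $\mathcal C$. For an assignment $\alpha\subseteq\mathrm{dom}(\mathcal C)\times D$, the set $[\![\varphi]\!]\subseteq D$ is defined recursively: $[\![\mathsf{test}(c)]\!]=\{c\}$, $[\![\mathsf{test}(t)]\!]=D\cap[\![t]\!]$, $[\![s]\!]=\alpha(s)$; $\top,\bot$ and the Boolean operators are interpreted in $D$; $v\in D$ satisfies $\mathsf{closed}(Q)$ if it has no outgoing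 edge with predicate outside $Q$, it satisfies $\ge_n q.\varphi$ (resp. $\le_n q.\varphi$) if at least (at most) $n$ nodes in $[\![\varphi]\!]$ are reached from $v$ along one $q$-edge, and $\exists\pi.\varphi$ if some node in $[\![\varphi]\!]$ is reached by a path matching $\pi$ ($\mathsf{id}$ is equality on all terms, $\pi^*$ the reflexive-transitive closure); $v\in D$ satisfies $\{e\}$ if the set of all edges $(v,p,w)$ leaving $v$ and all inverses $(v,p^-,w)$ of edges $(w,p,v)$ matches $e$. Here $\varepsilon$ matches $\emptyset$; $q.\varphi$ matches the singletons $\{(u,q,w)\}$ with $w\in[\![\varphi]\!]$; "$|$" is union of families; $f_1;f_2$ matches the unions of two disjoint sets matching $f_1$ and $f_2$; $f'^*$ matches the unions of arbitrarily many pairwise disjoint sets matching $f'$; $(\neg Q)^*$ (resp. $(\neg R^-)^*$) matches all sets of edges (resp. inverse edges) with predicates outside $Q$ (resp. $R$). **Stratification.** For $r:\mathrm{dom}(\mathcal C)\to\mathbb N$, "$\varphi$ is positively (negatively) admissible at $i$" is defined as follows. A name $s$ is positively admissible iff $r(s)\le i$ and negatively iff $r(s)<i$; name-free atoms are always admissible;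 $\wedge,\vee,\ge_n q.$ preserve the sign, $\neg$ and $\le_n q.$ exchange it; $\exists\pi.\varphi$ and $\{e\}$ are positively admissible iff $\varphi$, resp. all shapes in $e$ occurring directly as $q.\psi$, are, and negatively iff all names occurring in them have $r<i$. The function $r$ is a stratification if $\mathcal C(s)$ is positively admissible at $r(s)$ for each declared $s$; $\mathcal C$ is stratified if it has a stratification. The LFP (GFP) assignment of a stratified catalogue is obtained by going through the strata $r^{-1}(0),r^{-1}(1),\dots$ in order, at each stratum taking the least (greatest) assignment to its names that satisfies $\alpha(s)=[\![\mathcal C(s)]\!]$ for its names $s$, with the lower strata already fixed. **Schemas.** A schema $\mathcal S=(\mathcal C,\mathit{sel})$ consists of a catalogue and a finite set $\mathit{sel}$ of selectors $s:\tau$ with $s\in\mathrm{dom}(\mathcal C)$ and $\tau$ a shape of the language without names; it is stratified if $\mathcal C$ is. Let $\mathcal C_{\mathit{sel}}$ be $\mathcal C$ with the additional declarations $t_{s,\tau}:\tau\wedge\neg s$, with fresh names $t_{s,\tau}$, for all $(s:\tau)\in\mathit{sel}$. The graph $\mathcal G$ LFP-conforms (GFP-conforms) to $\mathcal S$ if the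 LFP (GFP) assignment $\alpha$ of $\mathcal C_{\mathit{sel}}$ on $\mathcal G$ has $\alpha(t_{s,\tau})=\emptyset$ for all selectors. **Theorem.** Restricted ShEx with GFP and Restricted SHACL with LFP have the same expressive power, and there are effective translations in both directions: 1. there is a computable map $T$ from Restricted ShEx schemas to Restricted SHACL schemas such that for every stratified $\mathcal S$ the schema $T(\mathcal S)$ is stratified, and every RDF graph $\mathcal G$ GFP-conforms to $\mathcal S$ if and only if it LFP-conforms to $T(\mathcal S)$; 2. there is a computable map $T'$ from Restricted SHACL schemas to Restricted ShEx schemas such that for every stratified $\mathcal S$ the schema $T'(\mathcal S)$ is stratified, and every RDF graph $\mathcal G$ LFP-conforms to $\mathcal S$ if and only if it GFP-conforms to $T'(\mathcal S)$. (Computable: on codes of schemas, relative to fixed numberings of the constants, value types and names; the numbering of $\mathsf{Names}$ is a bijection with $\mathbb N$.) -/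

import Mathlib

namespace RDFShapes

/-! ## RDF graphs -/

/-- RDF terms: IRIs, literals and blank nodes. -/
inductive Node (I L B : Type) : Type
  | iri (i : I)
  | lit (l : L)
  | blank (b : B)

/-- The constants that may be tested for: IRIs and literals. -/
inductive Const (I L : Type) : Type
  | iri (i : I)
  | lit (l : L)

def Const.toNode {I L : Type} (B : Type) : Const I L → Node I L B
  | .iri i => .iri i
  | .lit l => .lit l

/-- An RDF graph: a finite set of triples (subject, predicate, object); predicates are IRIs, and a
literal is never a subject. -/
structure Graph (I L B : Type) : Type where
  triples : Set (Node I L B × I × Node I L B)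
  finite : triples.Finite
  subject_ne_lit : ∀ u p v, (u, p, v) ∈ triples → ∀ l, u ≠ Node.lit l

/-- The terms in subject or object position. -/
def Graph.nodes {I L B : Type} (G : Graph I L B) : Set (Node I L B) :=
  {u | ∃ p v, (u, p, v) ∈ G.triples ∨ (v, p, u) ∈ G.triples}

/-- A predicate `p` (`fwd p`) or an inverse predicate `p⁻` (`bwd p`). -/
inductive Step (I : Type) : Type
  | fwd (p : I)
  | bwd (p : I)

/-- `q.rel G v w`: following `q` one gets from `v` to `w` along one edge of `G`. -/
def Step.rel {I L B : Type} (G : Graph I L B) : Step I → Node I L B → Node I L B → Prop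
  | .fwd p, v, w => (v, p, w) ∈ G.triples
  | .bwd p, v, w => (w, p, v) ∈ G.triples

/-! ## Gödel numbers of syntax trees -/

/-- The code of a syntax tree whose root has the given tag. -/
def codeNode (tag payload : ℕ) : ℕ := Nat.pair tag payload + 1

def Const.code {I L : Type} [Encodable I] [Encodable L] : Const I L → ℕ
  | .iri i => codeNode 0 (Encodable.encode i)
  | .lit l => codeNode 1 (Encodable.encode l)

def Step.code {I : Type} [Encodable I] : Step I → ℕ
  | .fwd p => codeNode 0 (Encodable.encode p)
  | .bwd p => codeNode 1 (Encodable.encode p)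

/-- A function `T` is effective, relative to numberings of its domain and codomain, if a computable
function on numbers turns the code of every argument into the code of the value. -/
def Effective {X Y : Type} (codeX : X → ℕ) (codeY : Y → ℕ) (T : X → Y) : Prop :=
  ∃ F : ℕ → ℕ, Computable F ∧ ∀ x, F (codeX x) = codeY (T x)

/-! ## Restricted SHACL -/

/-- Path expressions. -/
inductive Path (I : Type) : Type
  | id
  | pred (p : I)
  | inv (π : Path I)
  | comp (π₁ π₂ : Path I)
  | union (π₁ π₂ : Path I)
  | star (π : Path I)

/-- The binary relation defined by a path expression on a graph. -/
def Path.rel {I L B : Type} (G : Graph I L B) : Path I → Node I L B → Node I L B → Prop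
  | .id => fun v w => v = w
  | .pred p => fun v w => (v, p, w) ∈ G.triples
  | .inv π => fun v w => π.rel G w v
  | .comp π₁ π₂ => fun v w => ∃ u, π₁.rel G v u ∧ π₂.rel G u w
  | .union π₁ π₂ => fun v w => π₁.rel G v w ∨ π₂.rel G v w
  | .star π => Relation.ReflTransGen (π.rel G)

def Path.code {I : Type} [Encodable I] : Path I → ℕ
  | .id => codeNode 0 0
  | .pred p => codeNode 1 (Encodable.encode p)
  | .inv π => codeNode 2 π.code
  | .comp π₁ π₂ => codeNode 3 (Nat.pair π₁.code π₂.code)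
  | .union π₁ π₂ => codeNode 4 (Nat.pair π₁.code π₂.code)
  | .star π => codeNode 5 π.code

/-- Restricted SHACL shapes with value types `V` and shape names `M`. The finite set in `closed` is
given by a list. Counting (`ge n q φ` is `≥ n q.φ`, `le n q φ` is `≤ n q.φ`) is over single
predicates or inverse predicates only; `ex π φ` is `∃ π.φ`. -/
inductive SHACL (I L V M : Type) : Type
  | top
  | bot
  | test (c : Const I L)
  | testType (t : V)
  | name (s : M)
  | closed (Q : List I)
  | not (φ : SHACL I L V M)
  | and (φ ψ : SHACL I L V M)
  | or (φ ψ : SHACL I L V M)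
  | ge (n : ℕ) (q : Step I) (φ : SHACL I L V M)
  | le (n : ℕ) (q : Step I) (φ : SHACL I L V M)
  | ex (π : Path I) (φ : SHACL I L V M)

namespace SHACL

variable {I L B V M M' : Type}

/-- The shape names used in a shape. -/
def names : SHACL I L V M → Set M
  | top | bot | test _ | testType _ | closed _ => ∅
  | name s => {s}
  | not φ => φ.names
  | and φ ψ | or φ ψ => φ.names ∪ ψ.names
  | ge _ _ φ | le _ _ φ | ex _ φ => φ.names

/-- The constants tested for in a shape. -/
def consts : SHACL I L V M → Set (Const I L)
  | top | bot | name _ | testType _ | closed _ => ∅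
  | test c => {c}
  | not φ => φ.consts
  | and φ ψ | or φ ψ => φ.consts ∪ ψ.consts
  | ge _ _ φ | le _ _ φ | ex _ φ => φ.consts

/-- Renaming of shape names. -/
def rename (g : M → M') : SHACL I L V M → SHACL I L V M'
  | top => top
  | bot => bot
  | test c => test c
  | testType t => testType t
  | name s => name (g s)
  | closed Q => closed Q
  | not φ => not (φ.rename g)
  | and φ ψ => and (φ.rename g) (ψ.rename g)
  | or φ ψ => or (φ.rename g) (ψ.rename g)
  | ge n q φ => ge n q (φ.rename g)
  | le n q φ => le n q (φ.rename g)
  | ex π φ => ex π (φ.rename g)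

/-- The nodes of the domain `D` that satisfy a shape in `G` under the assignment `α`. -/
def sem (val : V → Set (Node I L B)) (D : Set (Node I L B)) (G : Graph I L B)
    (α : M → Set (Node I L B)) : SHACL I L V M → Set (Node I L B)
  | top => D
  | bot => ∅
  | test c => {c.toNode B}
  | testType t => D ∩ val t
  | name s => α s
  | closed Q => {v ∈ D | ∀ p, p ∉ Q → ∀ u, (v, p, u) ∉ G.triples}
  | not φ => D \ φ.sem val D G α
  | and φ ψ => φ.sem val D G α ∩ ψ.sem val D G α
  | or φ ψ => φ.sem val D G α ∪ ψ.sem val D G α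
  | ge n q φ => {v ∈ D | n ≤ {u | q.rel G v u ∧ u ∈ φ.sem val D G α}.ncard}
  | le n q φ => {v ∈ D | {u | q.rel G v u ∧ u ∈ φ.sem val D G α}.ncard ≤ n}
  | ex π φ => {v ∈ D | ∃ u, π.rel G v u ∧ u ∈ φ.sem val D G α}

/-- `φ.Admissible r i true`: the shape `φ` may be used in a declaration of stratum `i`, for the
stratification that puts the name `s` in stratum `r s`. `φ.Admissible r i false`: the same for `¬ φ`.
A name is allowed unnegated in its own stratum and above, and negated strictly above. Negations are
pushed towards names with the Boolean laws and with `¬ (≥ n+1 q.φ) = (≤ n q.φ)`; since the negation of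
`∃ π.φ` cannot be pushed further, it needs all names of `φ` in lower strata. -/
def Admissible (r : M → ℕ) (i : ℕ) : SHACL I L V M → Bool → Prop
  | top, _ | bot, _ | test _, _ | testType _, _ | closed _, _ => True
  | name s, true => r s ≤ i
  | name s, false => r s < i
  | not φ, b => φ.Admissible r i (!b)
  | and φ ψ, b | or φ ψ, b => φ.Admissible r i b ∧ ψ.Admissible r i b
  | ge _ _ φ, b => φ.Admissible r i b
  | le _ _ φ, b => φ.Admissible r i (!b)
  | ex _ φ, true => φ.Admissible r i true
  | ex _ φ, false => ∀ s ∈ φ.names, r s < i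

def code [Encodable I] [Encodable L] [Encodable V] [Encodable M] : SHACL I L V M → ℕ
  | top => codeNode 0 0
  | bot => codeNode 1 0
  | test c => codeNode 2 c.code
  | testType t => codeNode 3 (Encodable.encode t)
  | name s => codeNode 4 (Encodable.encode s)
  | closed Q => codeNode 5 (Encodable.encode Q)
  | not φ => codeNode 6 φ.code
  | and φ ψ => codeNode 7 (Nat.pair φ.code ψ.code)
  | or φ ψ => codeNode 8 (Nat.pair φ.code ψ.code)
  | ge n q φ => codeNode 9 (Nat.pair n (Nat.pair q.code φ.code))
  | le n q φ => codeNode 10 (Nat.pair n (Nat.pair q.code φ.code))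
  | ex π φ => codeNode 11 (Nat.pair π.code φ.code)

end SHACL

/-! ## Restricted ShEx -/

mutual

/-- Restricted ShEx shapes with value types `V` and shape names `M`. The shape
`neigh f R none` is `{ f ; (¬R⁻)* }` and `neigh f R (some Q)` is `{ f ; (¬R⁻)* ; (¬Q)* }`; the finite
sets `R` and `Q` are given by lists. -/
inductive ShEx (I L V M : Type) : Type
  | test (c : Const I L)
  | testType (t : V)
  | name (s : M)
  | neigh (f : ShExTriple I L V M) (R : List I) (Q : Option (List I))
  | and (φ ψ : ShEx I L V M)
  | or (φ ψ : ShEx I L V M)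
  | not (φ : ShEx I L V M)

/-- Closed triple expressions of Restricted ShEx: `f ::= f' | f'* | f ; f | f "|" f`. -/
inductive ShExTriple (I L V M : Type) : Type
  | basic (a : ShExBasic I L V M)
  | star (a : ShExBasic I L V M)
  | each (f g : ShExTriple I L V M)
  | alt (f g : ShExTriple I L V M)

/-- The expressions that may be starred: `f' ::= ε | p.φ | p⁻.φ | f' "|" f'`. -/
inductive ShExBasic (I L V M : Type) : Type
  | eps
  | edge (q : Step I) (φ : ShEx I L V M)
  | alt (a b : ShExBasic I L V M)

end

section ShExDefs

variable {I L B V M M' : Type}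

mutual

/-- The shape names used in a shape. -/
def ShEx.names : ShEx I L V M → Set M
  | .test _ | .testType _ => ∅
  | .name s => {s}
  | .neigh f _ _ => f.names
  | .and φ ψ | .or φ ψ => φ.names ∪ ψ.names
  | .not φ => φ.names

def ShExTriple.names : ShExTriple I L V M → Set M
  | .basic a | .star a => a.names
  | .each f g | .alt f g => f.names ∪ g.names

def ShExBasic.names : ShExBasic I L V M → Set M
  | .eps => ∅
  | .edge _ φ => φ.names
  | .alt a b => a.names ∪ b.names

end

mutual

/-- The constants tested for in a shape. -/
def ShEx.consts : ShEx I L V M → Set (Const I L)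
  | .name _ | .testType _ => ∅
  | .test c => {c}
  | .neigh f _ _ => f.consts
  | .and φ ψ | .or φ ψ => φ.consts ∪ ψ.consts
  | .not φ => φ.consts

def ShExTriple.consts : ShExTriple I L V M → Set (Const I L)
  | .basic a | .star a => a.consts
  | .each f g | .alt f g => f.consts ∪ g.consts

def ShExBasic.consts : ShExBasic I L V M → Set (Const I L)
  | .eps => ∅
  | .edge _ φ => φ.consts
  | .alt a b => a.consts ∪ b.consts

end

mutual

/-- Renaming of shape names. -/
def ShEx.rename (g : M → M') : ShEx I L V M → ShEx I L V M'
  | .test c => .test c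
  | .testType t => .testType t
  | .name s => .name (g s)
  | .neigh f R Q => .neigh (f.rename g) R Q
  | .and φ ψ => .and (φ.rename g) (ψ.rename g)
  | .or φ ψ => .or (φ.rename g) (ψ.rename g)
  | .not φ => .not (φ.rename g)

def ShExTriple.rename (g : M → M') : ShExTriple I L V M → ShExTriple I L V M'
  | .basic a => .basic (a.rename g)
  | .star a => .star (a.rename g)
  | .each f f' => .each (f.rename g) (f'.rename g)
  | .alt f f' => .alt (f.rename g) (f'.rename g)

def ShExBasic.rename (g : M → M') : ShExBasic I L V M → ShExBasic I L V M'
  | .eps => .eps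
  | .edge q φ => .edge q (φ.rename g)
  | .alt a b => .alt (a.rename g) (b.rename g)

end

/-- The edges `(v, p, w)` leaving `v` and the inverses `(v, p⁻, w)` of the edges entering `v`. -/
def Graph.neigh (G : Graph I L B) (v : Node I L B) : Set (Node I L B × Step I × Node I L B) :=
  {t | t.1 = v ∧ t.2.1.rel G v t.2.2}

/-- Unions of a member of `A` and a disjoint member of `A'`. -/
def disjointUnions {X : Type} (A A' : Set (Set X)) : Set (Set X) :=
  {F | ∃ F₁ ∈ A, ∃ F₂ ∈ A', Disjoint F₁ F₂ ∧ F = F₁ ∪ F₂}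

/-- Unions of arbitrarily many pairwise disjoint members of `A`. -/
def iteratedUnions {X : Type} (A : Set (Set X)) : Set (Set X) :=
  {F | ∃ P : Set (Set X), P ⊆ A ∧ P.PairwiseDisjoint id ∧ F = ⋃₀ P}

/-- The sets matched by `(¬Q)*`. -/
def openOut (L B : Type) (Q : List I) : Set (Set (Node I L B × Step I × Node I L B)) :=
  {F | ∀ t ∈ F, ∃ p, p ∉ Q ∧ t.2.1 = Step.fwd p}

/-- The sets matched by `(¬R⁻)*`. -/
def openInv (L B : Type) (R : List I) : Set (Set (Node I L B × Step I × Node I L B)) :=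
  {F | ∀ t ∈ F, ∃ p, p ∉ R ∧ t.2.1 = Step.bwd p}

mutual

/-- The nodes of the domain `D` that satisfy a shape in `G` under the assignment `α`. -/
def ShEx.sem (val : V → Set (Node I L B)) (D : Set (Node I L B)) (G : Graph I L B)
    (α : M → Set (Node I L B)) : ShEx I L V M → Set (Node I L B)
  | .test c => {c.toNode B}
  | .testType t => D ∩ val t
  | .name s => α s
  | .neigh f R none =>
      {v ∈ D | G.neigh v ∈ disjointUnions (f.sem val D G α) (openInv L B R)}
  | .neigh f R (some Q) =>
      {v ∈ D | G.neigh v ∈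
        disjointUnions (disjointUnions (f.sem val D G α) (openInv L B R)) (openOut L B Q)}
  | .and φ ψ => φ.sem val D G α ∩ ψ.sem val D G α
  | .or φ ψ => φ.sem val D G α ∪ ψ.sem val D G α
  | .not φ => D \ φ.sem val D G α

/-- The sets of edges and inverse edges matched by a triple expression. -/
def ShExTriple.sem (val : V → Set (Node I L B)) (D : Set (Node I L B)) (G : Graph I L B)
    (α : M → Set (Node I L B)) :
    ShExTriple I L V M → Set (Set (Node I L B × Step I × Node I L B))
  | .basic a => a.sem val D G α
  | .star a => iteratedUnions (a.sem val D G α)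
  | .each f g => disjointUnions (f.sem val D G α) (g.sem val D G α)
  | .alt f g => f.sem val D G α ∪ g.sem val D G α

def ShExBasic.sem (val : V → Set (Node I L B)) (D : Set (Node I L B)) (G : Graph I L B)
    (α : M → Set (Node I L B)) :
    ShExBasic I L V M → Set (Set (Node I L B × Step I × Node I L B))
  | .eps => {∅}
  | .edge q φ => {F | ∃ u w, w ∈ φ.sem val D G α ∧ q.rel G u w ∧ F = {(u, q, w)}}
  | .alt a b => a.sem val D G α ∪ b.sem val D G α

end

mutual

/-- `φ.Admissible r i true`: the shape `φ` may be used in a declaration of stratum `i`, for the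
stratification that puts the name `s` in stratum `r s`. `φ.Admissible r i false`: the same for `¬ φ`.
A name is allowed unnegated in its own stratum and above, and negated strictly above. Negations are
pushed towards names with the Boolean laws; since the negation of `{ e }` cannot be pushed further, it
needs all names of `e` in lower strata. -/
def ShEx.Admissible (r : M → ℕ) (i : ℕ) : ShEx I L V M → Bool → Prop
  | .test _, _ | .testType _, _ => True
  | .name s, true => r s ≤ i
  | .name s, false => r s < i
  | .neigh f _ _, true => f.Admissible r i
  | .neigh f _ _, false => ∀ s ∈ f.names, r s < i
  | .and φ ψ, b | .or φ ψ, b => φ.Admissible r i b ∧ ψ.Admissible r i b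
  | .not φ, b => φ.Admissible r i (!b)

def ShExTriple.Admissible (r : M → ℕ) (i : ℕ) : ShExTriple I L V M → Prop
  | .basic a | .star a => a.Admissible r i
  | .each f g | .alt f g => f.Admissible r i ∧ g.Admissible r i

def ShExBasic.Admissible (r : M → ℕ) (i : ℕ) : ShExBasic I L V M → Prop
  | .eps => True
  | .edge _ φ => φ.Admissible r i true
  | .alt a b => a.Admissible r i ∧ b.Admissible r i

end

mutual

def ShEx.code [Encodable I] [Encodable L] [Encodable V] [Encodable M] : ShEx I L V M → ℕ
  | .test c => codeNode 0 c.code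
  | .testType t => codeNode 1 (Encodable.encode t)
  | .name s => codeNode 2 (Encodable.encode s)
  | .neigh f R Q =>
      codeNode 3 (Nat.pair f.code (Nat.pair (Encodable.encode R) (Encodable.encode Q)))
  | .and φ ψ => codeNode 4 (Nat.pair φ.code ψ.code)
  | .or φ ψ => codeNode 5 (Nat.pair φ.code ψ.code)
  | .not φ => codeNode 6 φ.code

def ShExTriple.code [Encodable I] [Encodable L] [Encodable V] [Encodable M] :
    ShExTriple I L V M → ℕ
  | .basic a => codeNode 0 a.code
  | .star a => codeNode 1 a.code
  | .each f g => codeNode 2 (Nat.pair f.code g.code)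
  | .alt f g => codeNode 3 (Nat.pair f.code g.code)

def ShExBasic.code [Encodable I] [Encodable L] [Encodable V] [Encodable M] :
    ShExBasic I L V M → ℕ
  | .eps => codeNode 0 0
  | .edge q φ => codeNode 1 (Nat.pair q.code φ.code)
  | .alt a b => codeNode 2 (Nat.pair a.code b.code)

end

end ShExDefs

/-! ## Catalogues, schemas and their fixpoint semantics

The notions below are common to the two languages. -/

/-- What catalogues and schemas need of a language of shapes. It is used only for the two languages
`restrictedShEx` and `restrictedSHACL` defined next. -/
structure ShapeLanguage (I L B : Type) : Type 1 where
  Shape : Type → Type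
  name : {M : Type} → M → Shape M
  not : {M : Type} → Shape M → Shape M
  and : {M : Type} → Shape M → Shape M → Shape M
  names : {M : Type} → Shape M → Set M
  consts : {M : Type} → Shape M → Set (Const I L)
  rename : {M M' : Type} → (M → M') → Shape M → Shape M'
  sem : {M : Type} → Set (Node I L B) → Graph I L B → (M → Set (Node I L B)) → Shape M →
    Set (Node I L B)
  Admissible : {M : Type} → (M → ℕ) → ℕ → Shape M → Prop
  code : {M : Type} → [Encodable M] → Shape M → ℕ

section Languages

variable {I L B V : Type} [Encodable I] [Encodable L] [Encodable V]

/-- Restricted ShEx, for value types `V` interpreted by `val`. -/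
abbrev restrictedShEx (val : V → Set (Node I L B)) : ShapeLanguage I L B where
  Shape := ShEx I L V
  name := ShEx.name
  not := ShEx.not
  and := ShEx.and
  names := ShEx.names
  consts := ShEx.consts
  rename := ShEx.rename
  sem := ShEx.sem val
  Admissible r i φ := φ.Admissible r i true
  code := ShEx.code

/-- Restricted SHACL, for value types `V` interpreted by `val`. -/
abbrev restrictedSHACL (val : V → Set (Node I L B)) : ShapeLanguage I L B where
  Shape := SHACL I L V
  name := SHACL.name
  not := SHACL.not
  and := SHACL.and
  names := SHACL.names
  consts := SHACL.consts
  rename := SHACL.rename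
  sem := SHACL.sem val
  Admissible r i φ := φ.Admissible r i true
  code := SHACL.code

end Languages

/-- A list of declarations `s : φ`. -/
abbrev Catalogue {I L B : Type} (𝓛 : ShapeLanguage I L B) (M : Type) : Type :=
  List (M × 𝓛.Shape M)

namespace Catalogue

variable {I L B : Type} {𝓛 : ShapeLanguage I L B} {M : Type}

/-- The declared names. -/
def dom (C : Catalogue 𝓛 M) : Set M := {s | ∃ φ, (s, φ) ∈ C}

/-- The domain of evaluation: the nodes of the graph and the constants of the catalogue. -/
def domain (C : Catalogue 𝓛 M) (G : Graph I L B) : Set (Node I L B) :=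
  G.nodes ∪ {u | ∃ d ∈ C, ∃ c ∈ 𝓛.consts d.2, u = c.toNode B}

/-- `α` is (as the relation `u ∈ α s`) a shape assignment for `C` and `G`. -/
def IsAssignment (C : Catalogue 𝓛 M) (G : Graph I L B) (α : M → Set (Node I L B)) : Prop :=
  ∀ s u, u ∈ α s → s ∈ dom C ∧ u ∈ domain C G

/-- The function `r`, sending a name to the index of its stratum, is a stratification of `C`. -/
def IsStratification (C : Catalogue 𝓛 M) (r : M → ℕ) : Prop :=
  ∀ d ∈ C, 𝓛.Admissible r (r d.1) d.2

/-- The part of an assignment that concerns the strata up to `i`. -/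
def upTo (r : M → ℕ) (i : ℕ) (α : M → Set (Node I L B)) : M → Set (Node I L B) :=
  fun s => {u | u ∈ α s ∧ r s ≤ i}

/-- The assignments to the names of the strata up to `i` that coincide with `α` on the strata below
`i` and are correct for the declarations of the strata up to `i`. -/
def correctExtensions (C : Catalogue 𝓛 M) (G : Graph I L B) (r : M → ℕ) (i : ℕ)
    (α : M → Set (Node I L B)) : Set (M → Set (Node I L B)) :=
  {β | IsAssignment C G β ∧ (∀ s, i < r s → β s = ∅) ∧ (∀ s, r s < i → β s = α s) ∧
    ∀ d ∈ C, r d.1 ≤ i → β d.1 = 𝓛.sem (domain C G) G β d.2}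

/-- `α` is the assignment that results from taking least correct assignments, stratum by stratum. -/
def IsLFP (C : Catalogue 𝓛 M) (G : Graph I L B) (r : M → ℕ) (α : M → Set (Node I L B)) : Prop :=
  IsAssignment C G α ∧ ∀ i, IsLeast (correctExtensions C G r i α) (upTo r i α)

/-- `α` is the assignment that results from taking greatest correct assignments, stratum by
stratum. -/
def IsGFP (C : Catalogue 𝓛 M) (G : Graph I L B) (r : M → ℕ) (α : M → Set (Node I L B)) : Prop :=
  IsAssignment C G α ∧ ∀ i, IsGreatest (correctExtensions C G r i α) (upTo r i α)

end Catalogue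

/-- A schema: a catalogue, which declares every name at most once and every name that it uses, and a
finite set (given by a list) of selectors `s : τ`, where `s` is declared and `τ` uses no names. -/
structure Schema {I L B : Type} (𝓛 : ShapeLanguage I L B) (N : Type) : Type where
  cat : Catalogue 𝓛 N
  nodup : (cat.map Prod.fst).Nodup
  declared : ∀ d ∈ cat, ∀ s ∈ 𝓛.names d.2, s ∈ cat.dom
  sel : List (N × 𝓛.Shape Empty)
  sel_declared : ∀ d ∈ sel, d.1 ∈ cat.dom

namespace Schema

variable {I L B : Type} {𝓛 : ShapeLanguage I L B} {N : Type}

/-- The catalogue extended with the declarations `t_{s,τ} : τ ∧ ¬ s` for the selectors `s : τ`; the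
fresh name `t_{s,τ}` is `Sum.inr (s, τ)`. -/
def extended (S : Schema 𝓛 N) : Catalogue 𝓛 (N ⊕ N × 𝓛.Shape Empty) :=
  S.cat.map (fun d => (Sum.inl d.1, 𝓛.rename Sum.inl d.2)) ++
  S.sel.map (fun d => (Sum.inr d,
    𝓛.and (𝓛.rename Empty.elim d.2) (𝓛.not (𝓛.name (Sum.inl d.1)))))

def Stratified (S : Schema 𝓛 N) : Prop := ∃ r, S.cat.IsStratification r

/-- `G` conforms to `S` under the least fixpoint semantics. -/
def LFPConforms (S : Schema 𝓛 N) (G : Graph I L B) : Prop :=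
  ∃ r α, S.extended.IsStratification r ∧ S.extended.IsLFP G r α ∧
    ∀ d ∈ S.sel, α (Sum.inr d) = ∅

/-- `G` conforms to `S` under the greatest fixpoint semantics. -/
def GFPConforms (S : Schema 𝓛 N) (G : Graph I L B) : Prop :=
  ∃ r α, S.extended.IsStratification r ∧ S.extended.IsGFP G r α ∧
    ∀ d ∈ S.sel, α (Sum.inr d) = ∅

/-- The Gödel number of a schema. -/
def code [Encodable N] (S : Schema 𝓛 N) : ℕ :=
  Nat.pair
    (Encodable.encode (S.cat.map fun d => Nat.pair (Encodable.encode d.1) (𝓛.code d.2)))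
    (Encodable.encode (S.sel.map fun d => Nat.pair (Encodable.encode d.1) (𝓛.code d.2)))

end Schema

end RDFShapes

/-!
The two languages differ in two respects: the fixed points taken, and the operators for
neighbourhoods of nodes (triple expressions on one side, counting and path expressions on the other).

*Fixed points.* A catalogue is an operator on assignments which, along the strata, depends
monotonically on the names of the current stratum. By the Knaster–Tarski theorem it has an iterated
least and an iterated greatest fixed point, and these do not depend on the stratification
(`StratifiedOp.exists_iteratedLFP`, `IteratedLFP.unique`), so that conformance can be tested with one
stratification (`Schema.lfpConforms_iff`, `Schema.gfpConforms_iff`). Least and greatest fixed points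
are exchanged by complementation: if a name `s` is represented by a name `dbl s` for its complement,
declared by the negation of the translated declaration, then the positive occurrences of names of the
same stratum stay under an even number of negations, and the greatest fixed point for `s` is the
complement of the least one for `dbl s`.

*From ShEx to SHACL.* A triple expression is put into a disjunctive normal form with alternatives
`q₁.φ₁; …; qₖ.φₖ; (q'₁.ψ₁ | … | q'ₘ.ψₘ)*`. A neighbourhood matches an alternative if distinct edges
can be chosen for the requirements `qᵢ.φᵢ` such that each remaining edge satisfies one of the
`q'ⱼ.ψⱼ` or is left open. By Hall's marriage theorem this is a system of conditions on cardinalities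
(`matching_iff_hallConditions`): for each direction and each way to split the requirements, enough
edges satisfy one of the requirements of the first part, and not too many edges satisfy neither one
of the requirements of the second part nor one of the `ψⱼ`. These conditions are expressed by `≥ n q.φ`
and `≤ n q.¬φ` (`mem_sem_hallShape`, `mem_sem_neighShape`). All shapes of the triple expression occur
positively in them, so that admissibility is preserved.

*From SHACL to ShEx.* Counting is expressed by `{a; …; a; b}` with the rest of the neighbourhood left
open (`ShEx.mem_sem_atLeast`, `ShEx.mem_sem_atMost`). A shape `∃ π.φ` is unfolded: for each list `l` of
path expressions that may remain to be followed on the way along `π`, a name `pathName l φ` states that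
no node reachable along `l` satisfies `φ`. Its declaration resolves the outermost operator of the first
member of `l` (`pathDecl`), with `(π)*` giving rise to a recursion, for which the greatest fixed point
is the right one. Since the lists `l` that arise are finitely many (`DirPath.states`), so are the names.
The names for the subshapes `∃ π.φ` need strata of their own between those of the given
stratification; multiplying the given strata by a sufficiently large number makes room for them
(`Schema.exists_level_le`).

The constants of a schema determine its domain of evaluation. Both translations therefore retain them
all, by adding parts without influence on the meaning where necessary.

*Effectivity.* The translations are composed of list operations and structural recursions. On codes,
structural recursion is course-of-values recursion (`primrec_treeRec`), since the code of a tree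
exceeds those of its subtrees, so that the translations are even primitive recursive.
-/

namespace RDFShapes

/-! ### Stratified operators on a complete lattice -/

section Stratified

variable {M P : Type*} [CompleteLattice P]

/-- The semantic content of a stratification `r`: the value of `F` at `s` depends only on the names
of the strata up to that of `s`, and depends monotonically on those of the same stratum. -/
def StratifiedOp (F : (M → P) → M → P) (r : M → ℕ) : Prop :=
  ∀ α β s, (∀ t, r t < r s → α t = β t) → (∀ t, r t = r s → α t ≤ β t) → F α s ≤ F β s

/-- `α` is the iterated least fixed point of `F` along the strata of `r`. Minimality is asked for
among the pre-fixed points of a stratum. Iterated greatest fixed points are the instances at the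
order dual of `P`. -/
def IteratedLFP (F : (M → P) → M → P) (r : M → ℕ) (α : M → P) : Prop :=
  F α = α ∧ ∀ i β, (∀ t, r t < i → β t = α t) → (∀ t, r t = i → F β t ≤ β t) →
    ∀ t, r t = i → α t ≤ β t

variable {F : (M → P) → M → P} {r : M → ℕ}

theorem StratifiedOp.congr (hF : StratifiedOp F r) {α β : M → P} {s : M}
    (h : ∀ t, r t ≤ r s → α t = β t) : F α s = F β s :=
  le_antisymm (hF α β s (fun t ht => h t ht.le) fun t ht => (h t ht.le).le)
    (hF β α s (fun t ht => (h t ht.le).symm) fun t ht => (h t ht.le).ge)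

/-- The Knaster–Tarski theorem, stratum by stratum: each stratum is assigned the infimum of its
pre-fixed points, the lower strata being fixed. -/
theorem StratifiedOp.exists_iteratedLFP (hF : StratifiedOp F r) : ∃ α, IteratedLFP F r α := by
  classical
  let good (i : ℕ) (α β : M → P) : Prop :=
    (∀ t, r t < i → β t = α t) ∧ ∀ t, r t = i → F β t ≤ β t
  let step (s : M) (rec : ∀ t, r t < r s → P) : P :=
    sInf {x | ∃ β : M → P, (∀ t (h : r t < r s), β t = rec t h) ∧
      (∀ t, r t = r s → F β t ≤ β t) ∧ x = β s}
  let α : M → P := (InvImage.wf r wellFounded_lt).fix step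
  have hα : ∀ s, α s = sInf {x | ∃ β, good (r s) α β ∧ x = β s} := by
    intro s
    refine ((InvImage.wf r wellFounded_lt).fix_eq step s).trans ?_
    simp only [step, good, and_assoc]
    rfl
  have hmin : ∀ i β, good i α β → ∀ t, r t = i → α t ≤ β t := by
    rintro _ β hβ t rfl
    rw [hα]
    exact sInf_le ⟨β, hβ, rfl⟩
  have hpre : ∀ s, F α s ≤ α s := by
    intro s
    conv_rhs => rw [hα]
    refine le_sInf ?_
    rintro _ ⟨β, hβ, rfl⟩
    exact (hF α β s (fun t ht => (hβ.1 t ht).symm) (hmin _ β hβ)).trans (hβ.2 s rfl)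
  refine ⟨α, funext fun s => le_antisymm (hpre s) ?_, fun i β h₁ h₂ => hmin i β ⟨h₁, h₂⟩⟩
  -- Replacing `α` by `F α` on the stratum of `s` gives another pre-fixed point.
  let β : M → P := fun t => if r t = r s then F α t else α t
  have hβ : good (r s) α β := by
    refine ⟨fun t ht => if_neg ht.ne, fun t ht => ?_⟩
    have : β t = F α t := if_pos ht
    rw [this]
    refine hF β α t (fun u hu => if_neg (by omega)) fun u _ => ?_
    by_cases hu : r u = r s
    · simpa [β, hu] using hpre u
    · simp [β, hu]
  simpa [β] using hmin _ β hβ s rfl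

/-- If two stratifications are at hand, then `F α s` depends only on the names that are not above
`s` in either of them, and depends monotonically on those that share both strata with `s`. -/
theorem StratifiedOp.mono₂ {r' : M → ℕ} (hF : StratifiedOp F r) (hF' : StratifiedOp F r')
    {α β : M → P} {s : M}
    (h₁ : ∀ t, r t ≤ r s → r' t ≤ r' s → (r t ≠ r s ∨ r' t ≠ r' s) → α t = β t)
    (h₂ : ∀ t, r t = r s → r' t = r' s → α t ≤ β t) : F α s ≤ F β s := by
  classical
  let γ : M → P := fun t => if r t ≤ r s then α t else β t
  let δ : M → P := fun t => if r' t ≤ r' s then γ t else β t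
  have e₁ : F α s = F γ s := hF.congr fun t ht => by simp [γ, ht]
  have e₂ : F γ s = F δ s := hF'.congr fun t ht => by simp [δ, ht]
  rw [e₁, e₂]
  refine hF δ β s (fun t ht => ?_) fun t ht => ?_
  · by_cases h : r' t ≤ r' s
    · simpa [δ, γ, h, ht.le] using h₁ t ht.le h (Or.inl ht.ne)
    · simp [δ, h]
  · by_cases h : r' t ≤ r' s
    · rcases eq_or_ne (r' t) (r' s) with h' | h'
      · simpa [δ, γ, h, ht] using h₂ t ht h'
      · simpa [δ, γ, h, ht] using (h₁ t ht.le h (Or.inr h')).le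
    · simp [δ, h]

/-- An iterated least fixed point lies below any other fixed point on a block, if the two coincide on
the blocks below. -/
theorem IteratedLFP.le {r' : M → ℕ} (hF : StratifiedOp F r) (hF' : StratifiedOp F r')
    {α β : M → P} (hα : IteratedLFP F r α) (hβ : F β = β) (i j : ℕ)
    (h : ∀ t, r t ≤ i → r' t ≤ j → (r t ≠ i ∨ r' t ≠ j) → α t = β t) :
    ∀ t, r t = i → r' t = j → α t ≤ β t := by
  classical
  let γ : M → P := fun t => if r t = i ∧ r' t = j then α t ⊓ β t else α t
  have hγ : ∀ t, γ t ≤ α t := by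
    intro t
    by_cases ht : r t = i ∧ r' t = j <;> simp [γ, ht]
  have key : ∀ t, r t = i → α t ≤ γ t := by
    refine hα.2 i γ (fun t ht => if_neg fun h => ht.ne h.1) fun t ht => ?_
    have h₁ : F γ t ≤ α t := by
      conv_rhs => rw [← hα.1]
      exact hF γ α t (fun u hu => if_neg fun h => (hu.trans_eq ht).ne h.1) fun u _ => hγ u
    by_cases ht' : r' t = j
    · have : γ t = α t ⊓ β t := if_pos ⟨ht, ht'⟩
      rw [this]
      refine le_inf h₁ ?_
      conv_rhs => rw [← hβ]
      subst ht ht'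
      refine hF.mono₂ hF' (fun u hu hu' hne => ?_) fun u hu hu' => ?_
      · rw [← h u hu hu' hne]
        exact if_neg fun h => by tauto
      · simp [γ, hu, hu']
    · have : γ t = α t := if_neg fun h => ht' h.2
      rwa [this]
  intro t ht ht'
  refine (key t ht).trans ?_
  simp [γ, ht, ht']

/-- Iterated least fixed points do not depend on the stratification: compare them along the blocks
of names that share their strata in both stratifications. -/
theorem IteratedLFP.unique {r' : M → ℕ} (hF : StratifiedOp F r) (hF' : StratifiedOp F r')
    {α β : M → P} (hα : IteratedLFP F r α) (hβ : IteratedLFP F r' β) : α = β := by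
  have key : ∀ n t, r t + r' t = n → α t = β t := by
    intro n
    induction n using Nat.strong_induction_on with
    | _ n ih =>
      intro t ht
      have hlow : ∀ u, r u ≤ r t → r' u ≤ r' t → (r u ≠ r t ∨ r' u ≠ r' t) → α u = β u :=
        fun u h₁ h₂ h₃ => ih (r u + r' u) (by omega) u rfl
      refine le_antisymm (hα.le hF hF' hβ.1 _ _ hlow t rfl rfl) ?_
      exact hβ.le hF' hF hα.1 _ _ (fun u h₁ h₂ h₃ => (hlow u h₂ h₁ h₃.symm).symm) t rfl rfl
  exact funext fun t => key _ t rfl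

end Stratified

variable {I L B V M M' N : Type}

/-! ### Basic properties of the two languages -/

theorem Graph.finite_rel (G : Graph I L B) (q : Step I) (v : Node I L B) :
    {u | q.rel G v u}.Finite := by
  cases q with
  | fwd p =>
    exact (G.finite.image fun t => t.2.2).subset fun u hu => ⟨(v, p, u), hu, rfl⟩
  | bwd p =>
    exact (G.finite.image fun t => t.1).subset fun u hu => ⟨(u, p, v), hu, rfl⟩

theorem Step.rel_mem_nodes {G : Graph I L B} {q : Step I} {v u : Node I L B} (h : q.rel G v u) :
    u ∈ G.nodes := by
  cases q with
  | fwd p => exact ⟨p, v, Or.inr h⟩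
  | bwd p => exact ⟨p, v, Or.inl h⟩

namespace SHACL

theorem names_rename (g : M → M') (φ : SHACL I L V M) : (φ.rename g).names = g '' φ.names := by
  induction φ <;> simp_all [rename, names, Set.image_union]

theorem consts_rename (g : M → M') (φ : SHACL I L V M) : (φ.rename g).consts = φ.consts := by
  induction φ <;> simp_all [rename, consts]

theorem sem_rename (val : V → Set (Node I L B)) (D : Set (Node I L B)) (G : Graph I L B)
    (α : M' → Set (Node I L B)) (g : M → M') (φ : SHACL I L V M) :
    (φ.rename g).sem val D G α = φ.sem val D G (α ∘ g) := by
  induction φ <;> simp_all [rename, sem]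

theorem admissible_rename (r : M' → ℕ) (i : ℕ) (g : M → M') (φ : SHACL I L V M) (b : Bool) :
    (φ.rename g).Admissible r i b ↔ φ.Admissible (r ∘ g) i b := by
  induction φ generalizing b with
  | ex π φ ih => cases b <;> simp_all [rename, Admissible, names_rename]
  | _ => cases b <;> simp_all [rename, Admissible]

theorem admissible_of_names_lt {r : M → ℕ} {i : ℕ} (φ : SHACL I L V M) (b : Bool)
    (h : ∀ s ∈ φ.names, r s < i) : φ.Admissible r i b := by
  induction φ generalizing b with
  | name s => cases b <;> simp_all [names, Admissible, le_of_lt]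
  | and φ ψ h₁ h₂ | or φ ψ h₁ h₂ =>
    exact ⟨h₁ _ fun s hs => h s (Or.inl hs), h₂ _ fun s hs => h s (Or.inr hs)⟩
  | not φ ih | ge n q φ ih | le n q φ ih => exact ih _ h
  | ex π φ ih => cases b <;> [exact h; exact ih _ h]
  | _ => trivial

theorem sem_subset {val : V → Set (Node I L B)} {D : Set (Node I L B)} {G : Graph I L B}
    {α : M → Set (Node I L B)} {φ : SHACL I L V M} (hc : ∀ c ∈ φ.consts, c.toNode B ∈ D)
    (hα : ∀ s, α s ⊆ D) : φ.sem val D G α ⊆ D := by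
  induction φ with
  | test c => simpa [sem, consts] using hc
  | name s => exact hα s
  | and φ ψ h₁ h₂ => exact Set.inter_subset_left.trans (h₁ fun c h => hc c (Or.inl h))
  | or φ ψ h₁ h₂ =>
    exact Set.union_subset (h₁ fun c h => hc c (Or.inl h)) (h₂ fun c h => hc c (Or.inr h))
  | top => exact subset_rfl
  | bot => exact Set.empty_subset _
  | testType t => exact Set.inter_subset_left
  | not φ => exact Set.sdiff_subset
  | _ => exact Set.sep_subset _ _

/-- Admissible shapes are monotone (with sign `true`) or antitone (with sign `false`) in the names of
the current stratum. -/
theorem sem_mono_aux {val : V → Set (Node I L B)} {D : Set (Node I L B)} {G : Graph I L B}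
    {α β : M → Set (Node I L B)} {r : M → ℕ} {i : ℕ} (φ : SHACL I L V M) (b : Bool)
    (hφ : φ.Admissible r i b) (h₁ : ∀ t ∈ φ.names, r t < i → α t = β t)
    (h₂ : ∀ t ∈ φ.names, r t = i → α t ⊆ β t) :
    if b then φ.sem val D G α ⊆ φ.sem val D G β else φ.sem val D G β ⊆ φ.sem val D G α := by
  have card {φ : SHACL I L V M} {α β : M → Set (Node I L B)} (q : Step I) (v : Node I L B)
      (h : φ.sem val D G α ⊆ φ.sem val D G β) :
      {u | q.rel G v u ∧ u ∈ φ.sem val D G α}.ncard ≤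
        {u | q.rel G v u ∧ u ∈ φ.sem val D G β}.ncard :=
    Set.ncard_le_ncard (fun u hu => ⟨hu.1, h hu.2⟩)
      ((G.finite_rel q v).subset fun u hu => hu.1)
  induction φ generalizing b with
  | name s =>
    cases b with
    | true =>
      rcases lt_or_eq_of_le (show r s ≤ i from hφ) with h | h
      · exact (h₁ s rfl h).le
      · exact h₂ s rfl h
    | false => exact (h₁ s rfl hφ).ge
  | not φ ih =>
    have := ih (!b) hφ h₁ h₂
    cases b <;> exact Set.sdiff_subset_sdiff_right this
  | and φ ψ ih₁ ih₂ =>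
    have e₁ := ih₁ b hφ.1 (fun t ht => h₁ t (Or.inl ht)) (fun t ht => h₂ t (Or.inl ht))
    have e₂ := ih₂ b hφ.2 (fun t ht => h₁ t (Or.inr ht)) (fun t ht => h₂ t (Or.inr ht))
    cases b <;> exact Set.inter_subset_inter e₁ e₂
  | or φ ψ ih₁ ih₂ =>
    have e₁ := ih₁ b hφ.1 (fun t ht => h₁ t (Or.inl ht)) (fun t ht => h₂ t (Or.inl ht))
    have e₂ := ih₂ b hφ.2 (fun t ht => h₁ t (Or.inr ht)) (fun t ht => h₂ t (Or.inr ht))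
    cases b <;> exact Set.union_subset_union e₁ e₂
  | ge n q φ ih =>
    have := ih b hφ h₁ h₂
    cases b <;> exact fun v hv => ⟨hv.1, hv.2.trans (card q v this)⟩
  | le n q φ ih =>
    have := ih (!b) hφ h₁ h₂
    cases b <;> exact fun v hv => ⟨hv.1, (card q v this).trans hv.2⟩
  | ex π φ ih =>
    cases b with
    | true => exact fun v ⟨hv, u, hu, hu'⟩ => ⟨hv, u, hu, ih true hφ h₁ h₂ hu'⟩
    | false =>
      have := ih false (admissible_of_names_lt φ false hφ) h₁ h₂
      exact fun v ⟨hv, u, hu, hu'⟩ => ⟨hv, u, hu, this hu'⟩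
  | _ => cases b <;> exact subset_rfl

theorem sem_mono {val : V → Set (Node I L B)} {D : Set (Node I L B)} {G : Graph I L B}
    {α β : M → Set (Node I L B)} {r : M → ℕ} {i : ℕ} {φ : SHACL I L V M}
    (hφ : φ.Admissible r i true) (h₁ : ∀ t ∈ φ.names, r t < i → α t = β t)
    (h₂ : ∀ t ∈ φ.names, r t = i → α t ⊆ β t) : φ.sem val D G α ⊆ φ.sem val D G β :=
  sem_mono_aux φ true hφ h₁ h₂

end SHACL

theorem disjointUnions_mono {X : Type} {A A' E E' : Set (Set X)} (h : A ⊆ A') (h' : E ⊆ E') :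
    disjointUnions A E ⊆ disjointUnions A' E' :=
  fun _ ⟨F₁, m₁, F₂, m₂, e⟩ => ⟨F₁, h m₁, F₂, h' m₂, e⟩

theorem iteratedUnions_mono {X : Type} {A A' : Set (Set X)} (h : A ⊆ A') :
    iteratedUnions A ⊆ iteratedUnions A' :=
  fun _ ⟨P, m, e⟩ => ⟨P, m.trans h, e⟩

mutual

theorem ShEx.names_rename (g : M → M') : ∀ φ : ShEx I L V M, (φ.rename g).names = g '' φ.names
  | .test _ | .testType _ => by simp [ShEx.rename, ShEx.names]
  | .name s => by simp [ShEx.rename, ShEx.names]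
  | .neigh f _ _ => ShExTriple.names_rename g f
  | .and φ ψ | .or φ ψ => by
    simp [ShEx.rename, ShEx.names, Set.image_union, ShEx.names_rename g φ, ShEx.names_rename g ψ]
  | .not φ => ShEx.names_rename g φ

theorem ShExTriple.names_rename (g : M → M') :
    ∀ f : ShExTriple I L V M, (f.rename g).names = g '' f.names
  | .basic a | .star a => ShExBasic.names_rename g a
  | .each f f' | .alt f f' => by
    simp [ShExTriple.rename, ShExTriple.names, Set.image_union, ShExTriple.names_rename g f,
      ShExTriple.names_rename g f']

theorem ShExBasic.names_rename (g : M → M') :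
    ∀ a : ShExBasic I L V M, (a.rename g).names = g '' a.names
  | .eps => by simp [ShExBasic.rename, ShExBasic.names]
  | .edge _ φ => ShEx.names_rename g φ
  | .alt a b => by
    simp [ShExBasic.rename, ShExBasic.names, Set.image_union, ShExBasic.names_rename g a,
      ShExBasic.names_rename g b]

end

mutual

theorem ShEx.consts_rename (g : M → M') : ∀ φ : ShEx I L V M, (φ.rename g).consts = φ.consts
  | .test _ | .testType _ | .name _ => rfl
  | .neigh f _ _ => ShExTriple.consts_rename g f
  | .and φ ψ | .or φ ψ => congrArg₂ _ (ShEx.consts_rename g φ) (ShEx.consts_rename g ψ)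
  | .not φ => ShEx.consts_rename g φ

theorem ShExTriple.consts_rename (g : M → M') :
    ∀ f : ShExTriple I L V M, (f.rename g).consts = f.consts
  | .basic a | .star a => ShExBasic.consts_rename g a
  | .each f f' | .alt f f' =>
    congrArg₂ _ (ShExTriple.consts_rename g f) (ShExTriple.consts_rename g f')

theorem ShExBasic.consts_rename (g : M → M') :
    ∀ a : ShExBasic I L V M, (a.rename g).consts = a.consts
  | .eps => rfl
  | .edge _ φ => ShEx.consts_rename g φ
  | .alt a b => congrArg₂ _ (ShExBasic.consts_rename g a) (ShExBasic.consts_rename g b)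

end

section

variable (val : V → Set (Node I L B)) (D : Set (Node I L B)) (G : Graph I L B)
  (α : M' → Set (Node I L B)) (g : M → M')

mutual

theorem ShEx.sem_rename : ∀ φ : ShEx I L V M, (φ.rename g).sem val D G α = φ.sem val D G (α ∘ g)
  | .test _ | .testType _ | .name _ => by simp [ShEx.rename, ShEx.sem]
  | .neigh f R none => by simp [ShEx.rename, ShEx.sem, ShExTriple.sem_rename f]
  | .neigh f R (some Q) => by simp [ShEx.rename, ShEx.sem, ShExTriple.sem_rename f]
  | .and φ ψ | .or φ ψ => by
    simp [ShEx.rename, ShEx.sem, ShEx.sem_rename φ, ShEx.sem_rename ψ]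
  | .not φ => by simp [ShEx.rename, ShEx.sem, ShEx.sem_rename φ]

theorem ShExTriple.sem_rename :
    ∀ f : ShExTriple I L V M, (f.rename g).sem val D G α = f.sem val D G (α ∘ g)
  | .basic a | .star a => by
    simp [ShExTriple.rename, ShExTriple.sem, ShExBasic.sem_rename a]
  | .each f f' | .alt f f' => by
    simp [ShExTriple.rename, ShExTriple.sem, ShExTriple.sem_rename f, ShExTriple.sem_rename f']

theorem ShExBasic.sem_rename :
    ∀ a : ShExBasic I L V M, (a.rename g).sem val D G α = a.sem val D G (α ∘ g)
  | .eps => by simp [ShExBasic.rename, ShExBasic.sem]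
  | .edge q φ => by simp [ShExBasic.rename, ShExBasic.sem, ShEx.sem_rename φ]
  | .alt a b => by
    simp [ShExBasic.rename, ShExBasic.sem, ShExBasic.sem_rename a, ShExBasic.sem_rename b]

end

end

section

variable (r : M' → ℕ) (i : ℕ) (g : M → M')

mutual

theorem ShEx.admissible_rename : ∀ (φ : ShEx I L V M) (b : Bool),
    (φ.rename g).Admissible r i b ↔ φ.Admissible (r ∘ g) i b
  | .test _, b | .testType _, b => by simp [ShEx.rename, ShEx.Admissible]
  | .name _, b => by cases b <;> simp [ShEx.rename, ShEx.Admissible]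
  | .neigh f R Q, true => by
    simp [ShEx.rename, ShEx.Admissible, ShExTriple.admissible_rename f]
  | .neigh f R Q, false => by
    simp [ShEx.rename, ShEx.Admissible, ShExTriple.names_rename g f]
  | .and φ ψ, b | .or φ ψ, b => by
    simp [ShEx.rename, ShEx.Admissible, ShEx.admissible_rename φ, ShEx.admissible_rename ψ]
  | .not φ, b => by simp [ShEx.rename, ShEx.Admissible, ShEx.admissible_rename φ]

theorem ShExTriple.admissible_rename : ∀ f : ShExTriple I L V M,
    (f.rename g).Admissible r i ↔ f.Admissible (r ∘ g) i
  | .basic a | .star a => by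
    simp [ShExTriple.rename, ShExTriple.Admissible, ShExBasic.admissible_rename a]
  | .each f f' | .alt f f' => by
    simp [ShExTriple.rename, ShExTriple.Admissible, ShExTriple.admissible_rename f,
      ShExTriple.admissible_rename f']

theorem ShExBasic.admissible_rename : ∀ a : ShExBasic I L V M,
    (a.rename g).Admissible r i ↔ a.Admissible (r ∘ g) i
  | .eps => by simp [ShExBasic.rename, ShExBasic.Admissible]
  | .edge q φ => by simp [ShExBasic.rename, ShExBasic.Admissible, ShEx.admissible_rename φ]
  | .alt a b => by
    simp [ShExBasic.rename, ShExBasic.Admissible, ShExBasic.admissible_rename a,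
      ShExBasic.admissible_rename b]

end

end

section

variable {r : M → ℕ} {i : ℕ}

mutual

theorem ShEx.admissible_of_names_lt : ∀ (φ : ShEx I L V M) (b : Bool),
    (∀ s ∈ φ.names, r s < i) → φ.Admissible r i b
  | .test _, b, h | .testType _, b, h => by simp [ShEx.Admissible]
  | .name s, true, h => (h s rfl).le
  | .name s, false, h => h s rfl
  | .neigh f R Q, true, h => ShExTriple.admissible_of_names_lt f h
  | .neigh f R Q, false, h => h
  | .and φ ψ, b, h | .or φ ψ, b, h =>
    ⟨ShEx.admissible_of_names_lt φ b fun s hs => h s (Or.inl hs),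
      ShEx.admissible_of_names_lt ψ b fun s hs => h s (Or.inr hs)⟩
  | .not φ, b, h => ShEx.admissible_of_names_lt φ (!b) h

theorem ShExTriple.admissible_of_names_lt : ∀ f : ShExTriple I L V M,
    (∀ s ∈ f.names, r s < i) → f.Admissible r i
  | .basic a, h | .star a, h => ShExBasic.admissible_of_names_lt a h
  | .each f g, h | .alt f g, h =>
    ⟨ShExTriple.admissible_of_names_lt f fun s hs => h s (Or.inl hs),
      ShExTriple.admissible_of_names_lt g fun s hs => h s (Or.inr hs)⟩

theorem ShExBasic.admissible_of_names_lt : ∀ a : ShExBasic I L V M,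
    (∀ s ∈ a.names, r s < i) → a.Admissible r i
  | .eps, _ => trivial
  | .edge _ φ, h => ShEx.admissible_of_names_lt φ true h
  | .alt a b, h =>
    ⟨ShExBasic.admissible_of_names_lt a fun s hs => h s (Or.inl hs),
      ShExBasic.admissible_of_names_lt b fun s hs => h s (Or.inr hs)⟩

end

end

theorem ShEx.sem_subset {val : V → Set (Node I L B)} {D : Set (Node I L B)} {G : Graph I L B}
    {α : M → Set (Node I L B)} (hα : ∀ s, α s ⊆ D) :
    ∀ φ : ShEx I L V M, (∀ c ∈ φ.consts, c.toNode B ∈ D) → φ.sem val D G α ⊆ D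
  | .test c, hc => by simpa [ShEx.sem, ShEx.consts] using hc
  | .testType t, hc => by simp [ShEx.sem]
  | .name s, hc => by simpa [ShEx.sem] using hα s
  | .neigh f R none, hc => by simp [ShEx.sem, Set.sep_subset]
  | .neigh f R (some Q), hc => by simp [ShEx.sem, Set.sep_subset]
  | .and φ ψ, hc => by
    rw [ShEx.sem]
    exact Set.inter_subset_left.trans (ShEx.sem_subset hα φ fun c h => hc c (Or.inl h))
  | .or φ ψ, hc => by
    rw [ShEx.sem]
    exact Set.union_subset (ShEx.sem_subset hα φ fun c h => hc c (Or.inl h))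
      (ShEx.sem_subset hα ψ fun c h => hc c (Or.inr h))
  | .not φ, hc => by simp [ShEx.sem]

section

variable {val : V → Set (Node I L B)} {D : Set (Node I L B)} {G : Graph I L B} {r : M → ℕ} {i : ℕ}

mutual

theorem ShEx.sem_mono_aux (α β : M → Set (Node I L B)) : ∀ (φ : ShEx I L V M) (b : Bool),
    φ.Admissible r i b → (∀ t ∈ φ.names, r t < i → α t = β t) →
    (∀ t ∈ φ.names, r t = i → α t ⊆ β t) →
    if b then φ.sem val D G α ⊆ φ.sem val D G β else φ.sem val D G β ⊆ φ.sem val D G α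
  | .test _, b, _, _, _ | .testType _, b, _, _, _ => by cases b <;> simp [ShEx.sem]
  | .name s, true, hφ, h₁, h₂ => by
    simp only [ShEx.sem]
    rcases lt_or_eq_of_le (show r s ≤ i from hφ) with h | h
    · exact (h₁ s rfl h).le
    · exact h₂ s rfl h
  | .name s, false, hφ, h₁, h₂ => by
    simp only [ShEx.sem]
    exact (h₁ s rfl hφ).ge
  | .neigh f R none, true, hφ, h₁, h₂ => by
    simp only [ShEx.sem]
    exact fun v hv => ⟨hv.1, disjointUnions_mono (ShExTriple.sem_mono α β f hφ h₁ h₂) subset_rfl hv.2⟩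
  | .neigh f R (some Q), true, hφ, h₁, h₂ => by
    simp only [ShEx.sem]
    exact fun v hv => ⟨hv.1, disjointUnions_mono (disjointUnions_mono
      (ShExTriple.sem_mono α β f hφ h₁ h₂) subset_rfl) subset_rfl hv.2⟩
  | .neigh f R none, false, hφ, h₁, h₂ => by
    simp only [ShEx.sem]
    exact fun v hv => ⟨hv.1, disjointUnions_mono (ShExTriple.sem_mono β α f
      (ShExTriple.admissible_of_names_lt f hφ) (fun t ht h => (h₁ t ht h).symm)
      fun t ht h => absurd h (hφ t ht).ne) subset_rfl hv.2⟩
  | .neigh f R (some Q), false, hφ, h₁, h₂ => by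
    simp only [ShEx.sem]
    exact fun v hv => ⟨hv.1, disjointUnions_mono (disjointUnions_mono (ShExTriple.sem_mono β α f
      (ShExTriple.admissible_of_names_lt f hφ) (fun t ht h => (h₁ t ht h).symm)
      fun t ht h => absurd h (hφ t ht).ne) subset_rfl) subset_rfl hv.2⟩
  | .and φ ψ, b, hφ, h₁, h₂ => by
    have e₁ := ShEx.sem_mono_aux α β φ b hφ.1 (fun t ht => h₁ t (Or.inl ht))
      (fun t ht => h₂ t (Or.inl ht))
    have e₂ := ShEx.sem_mono_aux α β ψ b hφ.2 (fun t ht => h₁ t (Or.inr ht))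
      (fun t ht => h₂ t (Or.inr ht))
    simp only [ShEx.sem]
    cases b <;> exact Set.inter_subset_inter e₁ e₂
  | .or φ ψ, b, hφ, h₁, h₂ => by
    have e₁ := ShEx.sem_mono_aux α β φ b hφ.1 (fun t ht => h₁ t (Or.inl ht))
      (fun t ht => h₂ t (Or.inl ht))
    have e₂ := ShEx.sem_mono_aux α β ψ b hφ.2 (fun t ht => h₁ t (Or.inr ht))
      (fun t ht => h₂ t (Or.inr ht))
    simp only [ShEx.sem]
    cases b <;> exact Set.union_subset_union e₁ e₂
  | .not φ, b, hφ, h₁, h₂ => by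
    have := ShEx.sem_mono_aux α β φ (!b) hφ h₁ h₂
    simp only [ShEx.sem]
    cases b <;> exact Set.sdiff_subset_sdiff_right this

theorem ShExTriple.sem_mono (α β : M → Set (Node I L B)) : ∀ f : ShExTriple I L V M,
    f.Admissible r i → (∀ t ∈ f.names, r t < i → α t = β t) →
    (∀ t ∈ f.names, r t = i → α t ⊆ β t) → f.sem val D G α ⊆ f.sem val D G β
  | .basic a, hf, h₁, h₂ => by
    simp only [ShExTriple.sem]
    exact ShExBasic.sem_mono α β a hf h₁ h₂
  | .star a, hf, h₁, h₂ => by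
    simp only [ShExTriple.sem]
    exact iteratedUnions_mono (ShExBasic.sem_mono α β a hf h₁ h₂)
  | .each f g, hf, h₁, h₂ => by
    simp only [ShExTriple.sem]
    exact disjointUnions_mono (ShExTriple.sem_mono α β f hf.1 (fun t ht => h₁ t (Or.inl ht))
      (fun t ht => h₂ t (Or.inl ht))) (ShExTriple.sem_mono α β g hf.2
      (fun t ht => h₁ t (Or.inr ht)) (fun t ht => h₂ t (Or.inr ht)))
  | .alt f g, hf, h₁, h₂ => by
    simp only [ShExTriple.sem]
    exact Set.union_subset_union (ShExTriple.sem_mono α β f hf.1 (fun t ht => h₁ t (Or.inl ht))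
      (fun t ht => h₂ t (Or.inl ht))) (ShExTriple.sem_mono α β g hf.2
      (fun t ht => h₁ t (Or.inr ht)) (fun t ht => h₂ t (Or.inr ht)))

theorem ShExBasic.sem_mono (α β : M → Set (Node I L B)) : ∀ a : ShExBasic I L V M,
    a.Admissible r i → (∀ t ∈ a.names, r t < i → α t = β t) →
    (∀ t ∈ a.names, r t = i → α t ⊆ β t) → a.sem val D G α ⊆ a.sem val D G β
  | .eps, hf, h₁, h₂ => by simp only [ShExBasic.sem]; exact subset_rfl
  | .edge q φ, hf, h₁, h₂ => by
    simp only [ShExBasic.sem]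
    have := ShEx.sem_mono_aux α β φ true hf h₁ h₂
    exact fun F ⟨u, w, hw, h⟩ => ⟨u, w, this hw, h⟩
  | .alt a b, hf, h₁, h₂ => by
    simp only [ShExBasic.sem]
    exact Set.union_subset_union (ShExBasic.sem_mono α β a hf.1 (fun t ht => h₁ t (Or.inl ht))
      (fun t ht => h₂ t (Or.inl ht))) (ShExBasic.sem_mono α β b hf.2
      (fun t ht => h₁ t (Or.inr ht)) (fun t ht => h₂ t (Or.inr ht)))

end

end

/-! ### Catalogues as stratified operators -/

/-- The laws of a language of shapes that the fixpoint semantics depends on. -/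
structure ShapeLanguage.Lawful (𝓛 : ShapeLanguage I L B) : Prop where
  sem_name : ∀ {M : Type} (D G) (α : M → Set (Node I L B)) (s : M), 𝓛.sem D G α (𝓛.name s) = α s
  sem_not : ∀ {M : Type} (D G) (α : M → Set (Node I L B)) (φ : 𝓛.Shape M),
    𝓛.sem D G α (𝓛.not φ) = D \ 𝓛.sem D G α φ
  sem_and : ∀ {M : Type} (D G) (α : M → Set (Node I L B)) (φ ψ : 𝓛.Shape M),
    𝓛.sem D G α (𝓛.and φ ψ) = 𝓛.sem D G α φ ∩ 𝓛.sem D G α ψ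
  sem_rename : ∀ {M M' : Type} (D G) (α : M' → Set (Node I L B)) (g : M → M') (φ : 𝓛.Shape M),
    𝓛.sem D G α (𝓛.rename g φ) = 𝓛.sem D G (α ∘ g) φ
  sem_subset : ∀ {M : Type} {D G} {α : M → Set (Node I L B)} (φ : 𝓛.Shape M),
    (∀ c ∈ 𝓛.consts φ, c.toNode B ∈ D) → (∀ s, α s ⊆ D) → 𝓛.sem D G α φ ⊆ D
  sem_mono : ∀ {M : Type} {D G} {α β : M → Set (Node I L B)} {r : M → ℕ} {i : ℕ} (φ : 𝓛.Shape M),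
    𝓛.Admissible r i φ → (∀ t ∈ 𝓛.names φ, r t < i → α t = β t) →
    (∀ t ∈ 𝓛.names φ, r t = i → α t ⊆ β t) → 𝓛.sem D G α φ ⊆ 𝓛.sem D G β φ
  names_rename : ∀ {M M' : Type} (g : M → M') (φ : 𝓛.Shape M),
    𝓛.names (𝓛.rename g φ) = g '' 𝓛.names φ
  consts_name : ∀ {M : Type} (s : M), 𝓛.consts (𝓛.name s) = ∅
  consts_not : ∀ {M : Type} (φ : 𝓛.Shape M), 𝓛.consts (𝓛.not φ) = 𝓛.consts φ
  consts_and : ∀ {M : Type} (φ ψ : 𝓛.Shape M), 𝓛.consts (𝓛.and φ ψ) = 𝓛.consts φ ∪ 𝓛.consts ψ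
  consts_rename : ∀ {M M' : Type} (g : M → M') (φ : 𝓛.Shape M),
    𝓛.consts (𝓛.rename g φ) = 𝓛.consts φ
  admissible_rename : ∀ {M M' : Type} (r : M' → ℕ) (i : ℕ) (g : M → M') (φ : 𝓛.Shape M),
    𝓛.Admissible r i (𝓛.rename g φ) ↔ 𝓛.Admissible (r ∘ g) i φ
  admissible_of_names_lt : ∀ {M : Type} {r : M → ℕ} {i : ℕ} (φ : 𝓛.Shape M),
    (∀ s ∈ 𝓛.names φ, r s < i) → 𝓛.Admissible r i φ
  admissible_and_not : ∀ {M : Type} {r : M → ℕ} {i : ℕ} {φ : 𝓛.Shape M} {s : M},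
    𝓛.Admissible r i φ → r s < i → 𝓛.Admissible r i (𝓛.and φ (𝓛.not (𝓛.name s)))

section

variable [Encodable I] [Encodable L] [Encodable V]

theorem restrictedShEx_lawful (val : V → Set (Node I L B)) : (restrictedShEx val).Lawful where
  sem_name _ _ _ _ := by simp only [ShEx.sem]
  sem_not _ _ _ _ := by simp only [ShEx.sem]
  sem_and _ _ _ _ _ := by simp only [ShEx.sem]
  sem_rename D G α g φ := ShEx.sem_rename val D G α g φ
  sem_subset φ hc hα := ShEx.sem_subset hα φ hc
  sem_mono φ hφ h₁ h₂ := ShEx.sem_mono_aux _ _ φ true hφ h₁ h₂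
  names_rename g φ := ShEx.names_rename g φ
  consts_name _ := rfl
  consts_not _ := rfl
  consts_and _ _ := rfl
  consts_rename g φ := ShEx.consts_rename g φ
  admissible_rename r i g φ := ShEx.admissible_rename r i g φ true
  admissible_of_names_lt φ h := ShEx.admissible_of_names_lt φ true h
  admissible_and_not h h' := ⟨h, h'⟩

theorem restrictedSHACL_lawful (val : V → Set (Node I L B)) : (restrictedSHACL val).Lawful where
  sem_name _ _ _ _ := rfl
  sem_not _ _ _ _ := rfl
  sem_and _ _ _ _ _ := rfl
  sem_rename D G α g φ := SHACL.sem_rename val D G α g φ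
  sem_subset _ hc hα := SHACL.sem_subset hc hα
  sem_mono _ hφ h₁ h₂ := SHACL.sem_mono hφ h₁ h₂
  names_rename g φ := SHACL.names_rename g φ
  consts_name _ := rfl
  consts_not _ := rfl
  consts_and _ _ := rfl
  consts_rename g φ := SHACL.consts_rename g φ
  admissible_rename r i g φ := SHACL.admissible_rename r i g φ true
  admissible_of_names_lt φ h := SHACL.admissible_of_names_lt φ true h
  admissible_and_not h h' := ⟨h, h'⟩

end

namespace Catalogue

variable {𝓛 : ShapeLanguage I L B}

/-- The operator on assignments given by a catalogue, for an arbitrary domain of evaluation. It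
truncates its argument to the domain, so that all its fixed points are assignments. -/
def op (C : Catalogue 𝓛 M) (D : Set (Node I L B)) (G : Graph I L B)
    (α : M → Set (Node I L B)) : M → Set (Node I L B) :=
  fun s => {u | ∃ φ, (s, φ) ∈ C ∧ u ∈ 𝓛.sem D G (fun t => α t ∩ D) φ}

/-- No name has two different declarations (one declaration may be listed repeatedly). -/
def Functional (C : Catalogue 𝓛 M) : Prop :=
  ∀ s φ ψ, (s, φ) ∈ C → (s, ψ) ∈ C → φ = ψ

theorem functional_of_nodup {C : Catalogue 𝓛 M} (h : (C.map Prod.fst).Nodup) : C.Functional := by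
  intro s φ ψ h₁ h₂
  exact congrArg Prod.snd (List.inj_on_of_nodup_map h h₁ h₂ rfl)

variable {C : Catalogue 𝓛 M} {D : Set (Node I L B)} {G : Graph I L B} {r : M → ℕ}
  {α β : M → Set (Node I L B)}

theorem op_eq (hC : C.Functional) {s : M} {φ : 𝓛.Shape M} (h : (s, φ) ∈ C) :
    C.op D G α s = 𝓛.sem D G (fun t => α t ∩ D) φ := by
  ext u
  exact ⟨fun ⟨ψ, hψ, hu⟩ => hC s φ ψ h hψ ▸ hu, fun hu => ⟨φ, h, hu⟩⟩

theorem op_eq_of_subset (hC : C.Functional) {s : M} {φ : 𝓛.Shape M} (h : (s, φ) ∈ C)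
    (hα : ∀ t, α t ⊆ D) : C.op D G α s = 𝓛.sem D G α φ := by
  rw [op_eq hC h]
  congr 1
  exact funext fun t => Set.inter_eq_left.2 (hα t)

theorem op_eq_empty {s : M} (h : s ∉ C.dom) : C.op D G α s = ∅ :=
  Set.eq_empty_of_forall_notMem fun _ ⟨φ, hφ, _⟩ => h ⟨φ, hφ⟩

theorem op_subset (h𝓛 : 𝓛.Lawful) (hD : ∀ d ∈ C, ∀ c ∈ 𝓛.consts d.2, c.toNode B ∈ D) (s : M) :
    C.op D G α s ⊆ D := by
  rintro u ⟨φ, hφ, hu⟩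
  exact h𝓛.sem_subset φ (hD _ hφ) (fun t => Set.inter_subset_right) hu

theorem stratifiedOp_op (h𝓛 : 𝓛.Lawful) (hr : C.IsStratification r) :
    StratifiedOp (C.op D G) r := by
  rintro α β s h₁ h₂ u ⟨φ, hφ, hu⟩
  refine ⟨φ, hφ, h𝓛.sem_mono φ (hr _ hφ) (fun t _ ht => ?_) (fun t _ ht => ?_) hu⟩
  · simp only [h₁ t ht]
  · exact Set.inter_subset_inter_left _ (h₂ t ht)

theorem mem_domain_of_const {d : M × 𝓛.Shape M} (hd : d ∈ C) {c : Const I L}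
    (hc : c ∈ 𝓛.consts d.2) : c.toNode B ∈ C.domain G :=
  Or.inr ⟨d, hd, c, hc, rfl⟩

theorem isAssignment_of_fixed (h𝓛 : 𝓛.Lawful) (hα : C.op (C.domain G) G α = α) :
    C.IsAssignment G α := by
  intro s u hu
  rw [← hα] at hu
  refine ⟨?_, op_subset h𝓛 (fun d hd c hc => mem_domain_of_const hd hc) s hu⟩
  obtain ⟨φ, hφ, _⟩ := hu
  exact ⟨φ, hφ⟩

theorem op_eq_of_correct (hC : C.Functional) (hβ : C.IsAssignment G β) {i : ℕ}
    (h : ∀ d ∈ C, r d.1 ≤ i → β d.1 = 𝓛.sem (domain C G) G β d.2) {t : M} (ht : r t ≤ i) :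
    C.op (C.domain G) G β t = β t := by
  by_cases hd : t ∈ C.dom
  · obtain ⟨φ, hφ⟩ := hd
    rw [op_eq_of_subset hC hφ fun t u hu => (hβ t u hu).2]
    exact (h _ hφ ht).symm
  · rw [op_eq_empty hd]
    exact (Set.eq_empty_of_forall_notMem fun u hu => hd (hβ t u hu).1).symm

theorem upTo_of_le {i : ℕ} {t : M} (h : r t ≤ i) : upTo r i α t = α t := by
  simp [upTo, h]

theorem upTo_of_lt {i : ℕ} {t : M} (h : i < r t) : upTo r i α t = ∅ := by
  simp [upTo, not_le.2 h]

theorem upTo_mem_correctExtensions (h𝓛 : 𝓛.Lawful) (hC : C.Functional) (hr : C.IsStratification r)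
    (hα : C.op (C.domain G) G α = α) (i : ℕ) : upTo r i α ∈ correctExtensions C G r i α := by
  have ha := isAssignment_of_fixed h𝓛 hα
  refine ⟨fun s u hu => ha s u hu.1, fun s hs => upTo_of_lt hs, fun s hs => upTo_of_le hs.le,
    fun d hd hi => ?_⟩
  rw [upTo_of_le hi, ← op_eq_of_subset (α := upTo r i α) hC hd fun t u hu => (ha t u hu.1).2]
  conv_lhs => rw [← hα]
  exact (stratifiedOp_op h𝓛 hr).congr fun t ht => (upTo_of_le (ht.trans hi)).symm

/-- Iterated least fixed points of the operator of a catalogue are its LFP assignments: least among the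
pre-fixed points of a stratum implies least among the correct extensions. -/
theorem isLFP_of_iteratedLFP (h𝓛 : 𝓛.Lawful) (hC : C.Functional) (hr : C.IsStratification r)
    (hα : IteratedLFP (C.op (C.domain G) G) r α) : C.IsLFP G r α := by
  refine ⟨isAssignment_of_fixed h𝓛 hα.1, fun i =>
    ⟨upTo_mem_correctExtensions h𝓛 hC hr hα.1 i, ?_⟩⟩
  rintro β ⟨hβ, _, hlow, hcorr⟩ t
  rcases lt_trichotomy (r t) i with h | h | h
  · rw [upTo_of_le h.le, hlow t h]
  · rw [upTo_of_le h.le]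
    exact hα.2 i β hlow (fun t ht => (op_eq_of_correct hC hβ hcorr ht.le).le) t h
  · rw [upTo_of_lt h]
    exact Set.empty_subset _

theorem isGFP_of_iteratedLFP (h𝓛 : 𝓛.Lawful) (hC : C.Functional) (hr : C.IsStratification r)
    (hα : IteratedLFP (P := (Set (Node I L B))ᵒᵈ) (C.op (C.domain G) G) r α) :
    C.IsGFP G r α := by
  refine ⟨isAssignment_of_fixed h𝓛 hα.1, fun i =>
    ⟨upTo_mem_correctExtensions h𝓛 hC hr hα.1 i, ?_⟩⟩
  rintro β ⟨hβ, hhigh, hlow, hcorr⟩ t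
  rcases lt_trichotomy (r t) i with h | h | h
  · rw [upTo_of_le h.le, hlow t h]
  · rw [upTo_of_le h.le]
    exact hα.2 i β hlow (fun t ht => (op_eq_of_correct hC hβ hcorr ht.le).ge) t h
  · rw [upTo_of_lt h, hhigh t h]

theorem correctExtensions_congr {i : ℕ} (h : ∀ s, r s < i → α s = β s) :
    correctExtensions C G r i α = correctExtensions C G r i β := by
  ext γ
  refine and_congr_right fun _ => and_congr_right fun _ => and_congr_left fun _ =>
    forall₂_congr fun s hs => ?_
  rw [h s hs]

theorem eq_of_upTo_eq (h : ∀ i, (∀ s, r s < i → α s = β s) → upTo r i α = upTo r i β) :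
    α = β := by
  have key : ∀ i s, r s < i → α s = β s := by
    intro i
    induction i with
    | zero => intro s hs; omega
    | succ i ih =>
      intro s hs
      have := congrFun (h i ih) s
      rwa [upTo_of_le (by omega), upTo_of_le (by omega)] at this
  exact funext fun s => key (r s + 1) s (by omega)

theorem IsLFP.unique (hα : C.IsLFP G r α) (hβ : C.IsLFP G r β) : α = β :=
  eq_of_upTo_eq fun i h => by
    have := hα.2 i
    rw [correctExtensions_congr h] at this
    exact this.unique (hβ.2 i)

theorem IsGFP.unique (hα : C.IsGFP G r α) (hβ : C.IsGFP G r β) : α = β :=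
  eq_of_upTo_eq fun i h => by
    have := hα.2 i
    rw [correctExtensions_congr h] at this
    exact this.unique (hβ.2 i)

end Catalogue

theorem StratifiedOp.dual {P : Type*} [CompleteLattice P] {F : (M → P) → M → P} {r : M → ℕ}
    (h : StratifiedOp F r) : StratifiedOp (P := Pᵒᵈ) F r :=
  fun α β s h₁ h₂ => h β α s (fun t ht => (h₁ t ht).symm) h₂

/-! ### Conformance in terms of the catalogue -/

namespace Schema

variable {𝓛 : ShapeLanguage I L B} {S : Schema 𝓛 N} {G : Graph I L B} {r : N → ℕ}
  {α : N → Set (Node I L B)}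

theorem mem_extended_inl {s : N} {ψ : 𝓛.Shape (N ⊕ N × 𝓛.Shape Empty)} :
    (Sum.inl s, ψ) ∈ S.extended ↔ ∃ φ, (s, φ) ∈ S.cat ∧ ψ = 𝓛.rename Sum.inl φ := by
  simp [extended, eq_comm]

theorem mem_extended_inr {d : N × 𝓛.Shape Empty} {ψ : 𝓛.Shape (N ⊕ N × 𝓛.Shape Empty)} :
    (Sum.inr d, ψ) ∈ S.extended ↔ d ∈ S.sel ∧
      ψ = 𝓛.and (𝓛.rename Empty.elim d.2) (𝓛.not (𝓛.name (Sum.inl d.1))) := by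
  simp only [extended, List.mem_append, List.mem_map, Prod.mk.injEq]
  constructor
  · rintro (⟨_, _, h, _⟩ | ⟨d', h, h', rfl⟩)
    · cases h
    · cases h'
      exact ⟨h, rfl⟩
  · rintro ⟨h, rfl⟩
    exact Or.inr ⟨d, h, rfl, rfl⟩

theorem extended_functional : S.extended.Functional := by
  rintro (s | d) φ ψ h₁ h₂
  · obtain ⟨φ', h, rfl⟩ := mem_extended_inl.1 h₁
    obtain ⟨ψ', h', rfl⟩ := mem_extended_inl.1 h₂
    rw [Catalogue.functional_of_nodup S.nodup _ _ _ h h']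
  · rw [(mem_extended_inr.1 h₁).2, (mem_extended_inr.1 h₂).2]

/-- The constants of the catalogue and of the selectors of a schema. -/
def consts (S : Schema 𝓛 N) : Set (Const I L) :=
  {c | (∃ d ∈ S.cat, c ∈ 𝓛.consts d.2) ∨ ∃ d ∈ S.sel, c ∈ 𝓛.consts d.2}

/-- The domain of evaluation of a schema: the nodes of the graph and the constants of the schema. -/
def domain (S : Schema 𝓛 N) (G : Graph I L B) : Set (Node I L B) :=
  G.nodes ∪ {u | ∃ c ∈ S.consts, u = c.toNode B}

theorem extended_domain (h𝓛 : 𝓛.Lawful) : S.extended.domain G = S.domain G := by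
  refine congrArg (G.nodes ∪ ·) (Set.ext fun u => ⟨?_, ?_⟩)
  · rintro ⟨⟨s | d, ψ⟩, hd, c, hc, rfl⟩
    · obtain ⟨φ, h, rfl⟩ := mem_extended_inl.1 hd
      exact ⟨c, Or.inl ⟨_, h, by simpa [h𝓛.consts_rename] using hc⟩, rfl⟩
    · obtain ⟨h, rfl⟩ := mem_extended_inr.1 hd
      refine ⟨c, Or.inr ⟨_, h, ?_⟩, rfl⟩
      simpa [h𝓛.consts_rename, h𝓛.consts_and, h𝓛.consts_not, h𝓛.consts_name] using hc
  · rintro ⟨c, ⟨⟨s, φ⟩, h, hc⟩ | ⟨d, h, hc⟩, rfl⟩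
    · exact ⟨_, mem_extended_inl.2 ⟨φ, h, rfl⟩, c, by simpa [h𝓛.consts_rename] using hc, rfl⟩
    · refine ⟨_, mem_extended_inr.2 ⟨h, rfl⟩, c, ?_, rfl⟩
      simp [h𝓛.consts_rename, h𝓛.consts_and, hc]

theorem mem_domain_of_cat {d : N × 𝓛.Shape N} (hd : d ∈ S.cat) {c : Const I L}
    (hc : c ∈ 𝓛.consts d.2) : c.toNode B ∈ S.domain G :=
  Or.inr ⟨c, Or.inl ⟨d, hd, hc⟩, rfl⟩

theorem mem_domain_of_sel {d : N × 𝓛.Shape Empty} (hd : d ∈ S.sel) {c : Const I L}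
    (hc : c ∈ 𝓛.consts d.2) : c.toNode B ∈ S.domain G :=
  Or.inr ⟨c, Or.inr ⟨d, hd, hc⟩, rfl⟩

/-- The extension of a stratification to the names added for selectors: each is put above the name
that its declaration negates. -/
def extendStrat (r : N → ℕ) : N ⊕ N × 𝓛.Shape Empty → ℕ :=
  Sum.elim r fun d => r d.1 + 1

theorem extended_isStratification (h𝓛 : 𝓛.Lawful) (hr : S.cat.IsStratification r) :
    S.extended.IsStratification (extendStrat r) := by
  rintro ⟨s | d, ψ⟩ h
  · obtain ⟨φ, hφ, rfl⟩ := mem_extended_inl.1 h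
    exact (h𝓛.admissible_rename _ _ _ _).2 (hr _ hφ)
  · obtain ⟨hd, rfl⟩ := mem_extended_inr.1 h
    refine h𝓛.admissible_and_not (h𝓛.admissible_of_names_lt _ ?_) (Nat.lt_succ_self _)
    rw [h𝓛.names_rename]
    rintro s ⟨x, _⟩
    exact x.elim

/-- The nodes that satisfy the shape of a selector; there are no names to assign. -/
def selSem (D : Set (Node I L B)) (G : Graph I L B) (τ : 𝓛.Shape Empty) : Set (Node I L B) :=
  𝓛.sem D G (fun x : Empty => x.elim) τ

/-- The extension of an assignment to the names added for selectors. -/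
def extendAssign (S : Schema 𝓛 N) (G : Graph I L B) (α : N → Set (Node I L B)) :
    N ⊕ N × 𝓛.Shape Empty → Set (Node I L B) :=
  Sum.elim α fun d => {u | d ∈ S.sel ∧ u ∈ selSem (S.domain G) G d.2 \ α d.1}

theorem op_extended_inl (h𝓛 : 𝓛.Lawful) (D : Set (Node I L B))
    (β : N ⊕ N × 𝓛.Shape Empty → Set (Node I L B)) (s : N) :
    S.extended.op D G β (Sum.inl s) = S.cat.op D G (β ∘ Sum.inl) s := by
  ext u
  constructor
  · rintro ⟨ψ, hψ, hu⟩
    obtain ⟨φ, hφ, rfl⟩ := mem_extended_inl.1 hψ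
    rw [h𝓛.sem_rename] at hu
    exact ⟨φ, hφ, hu⟩
  · rintro ⟨φ, hφ, hu⟩
    refine ⟨_, mem_extended_inl.2 ⟨φ, hφ, rfl⟩, ?_⟩
    rw [h𝓛.sem_rename]
    exact hu

theorem op_extended_inr (h𝓛 : 𝓛.Lawful)
    (β : N ⊕ N × 𝓛.Shape Empty → Set (Node I L B)) (d : N × 𝓛.Shape Empty) :
    S.extended.op (S.domain G) G β (Sum.inr d) =
      {u | d ∈ S.sel ∧ u ∈ selSem (S.domain G) G d.2 \ β (Sum.inl d.1)} := by
  have hsem : ∀ γ : N ⊕ N × 𝓛.Shape Empty → Set (Node I L B),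
      𝓛.sem (S.domain G) G γ (𝓛.rename Empty.elim d.2) = selSem (S.domain G) G d.2 := by
    intro γ
    rw [h𝓛.sem_rename]
    exact congrArg (fun γ => 𝓛.sem (S.domain G) G γ d.2) (funext fun x : Empty => x.elim)
  ext u
  constructor
  · rintro ⟨ψ, hψ, hu⟩
    obtain ⟨hd, rfl⟩ := mem_extended_inr.1 hψ
    rw [h𝓛.sem_and, hsem, h𝓛.sem_not, h𝓛.sem_name] at hu
    exact ⟨hd, hu.1, fun h => hu.2.2 ⟨h, hu.2.1⟩⟩
  · rintro ⟨hd, hu, hu'⟩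
    refine ⟨_, mem_extended_inr.2 ⟨hd, rfl⟩, ?_⟩
    rw [h𝓛.sem_and, hsem, h𝓛.sem_not, h𝓛.sem_name]
    exact ⟨hu, h𝓛.sem_subset _ (fun c hc => mem_domain_of_sel hd hc) (fun x => x.elim) hu,
      fun h => hu' h.1⟩

theorem op_extendAssign (h𝓛 : 𝓛.Lawful) (hα : S.cat.op (S.domain G) G α = α) :
    S.extended.op (S.domain G) G (S.extendAssign G α) = S.extendAssign G α := by
  funext s
  rcases s with s | d
  · rw [op_extended_inl h𝓛]
    exact congrFun hα s
  · rw [op_extended_inr h𝓛]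
    rfl

/-- The names added for selectors are not used in any declaration, so that their values are
determined by those of the other names. -/
theorem extendAssign_iteratedLFP (h𝓛 : 𝓛.Lawful)
    (hα : IteratedLFP (S.cat.op (S.domain G) G) r α) :
    IteratedLFP (S.extended.op (S.domain G) G) (extendStrat r) (S.extendAssign G α) := by
  refine ⟨op_extendAssign h𝓛 hα.1, fun i β h₁ h₂ => ?_⟩
  rintro (s | d) hi
  · refine hα.2 i (β ∘ Sum.inl) (fun t ht => h₁ (Sum.inl t) ht) (fun t ht => ?_) s hi
    have := h₂ (Sum.inl t) ht
    rwa [op_extended_inl h𝓛] at this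
  · have := h₂ (Sum.inr d) hi
    rw [op_extended_inr h𝓛, h₁ (Sum.inl d.1) (by simp [extendStrat] at hi ⊢; omega)] at this
    exact this

theorem extendAssign_iteratedGFP (h𝓛 : 𝓛.Lawful)
    (hα : IteratedLFP (P := (Set (Node I L B))ᵒᵈ) (S.cat.op (S.domain G) G) r α) :
    IteratedLFP (P := (Set (Node I L B))ᵒᵈ) (S.extended.op (S.domain G) G) (extendStrat r)
      (S.extendAssign G α) := by
  refine ⟨op_extendAssign h𝓛 hα.1, fun i (β : N ⊕ N × 𝓛.Shape Empty → Set (Node I L B)) h₁ h₂ => ?_⟩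
  rintro (s | d) hi
  · refine hα.2 i (β ∘ Sum.inl) (fun t ht => h₁ (Sum.inl t) ht) (fun t ht => ?_) s hi
    have : β (Sum.inl t) ⊆ S.extended.op (S.domain G) G β (Sum.inl t) := h₂ (Sum.inl t) ht
    rwa [op_extended_inl h𝓛] at this
  · have : β (Sum.inr d) ⊆ S.extended.op (S.domain G) G β (Sum.inr d) := h₂ (Sum.inr d) hi
    rw [op_extended_inr h𝓛, h₁ (Sum.inl d.1) (by simp [extendStrat] at hi ⊢; omega)] at this
    exact this

theorem extendAssign_empty_iff :
    (∀ d ∈ S.sel, S.extendAssign G α (Sum.inr d) = ∅) ↔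
      ∀ d ∈ S.sel, selSem (S.domain G) G d.2 ⊆ α d.1 := by
  refine forall₂_congr fun d hd => ?_
  rw [← Set.sdiff_eq_empty, show S.extendAssign G α (Sum.inr d) =
    selSem (S.domain G) G d.2 \ α d.1 from Set.ext fun u => and_iff_right hd]

/-- Conformance can be tested with any stratification of the catalogue and the assignment that it
determines. -/
theorem lfpConforms_iff (h𝓛 : 𝓛.Lawful) (hr : S.cat.IsStratification r)
    (hα : IteratedLFP (S.cat.op (S.domain G) G) r α) :
    S.LFPConforms G ↔ ∀ d ∈ S.sel, selSem (S.domain G) G d.2 ⊆ α d.1 := by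
  have hα' := extendAssign_iteratedLFP h𝓛 hα
  have hr' := extended_isStratification h𝓛 hr
  rw [← extendAssign_empty_iff]
  rw [← extended_domain h𝓛] at hα'
  constructor
  · rintro ⟨r₂, β, hr₂, hβ, h⟩
    obtain ⟨γ, hγ⟩ := (Catalogue.stratifiedOp_op (D := S.extended.domain G) (G := G) h𝓛
      hr₂).exists_iteratedLFP
    obtain rfl := hβ.unique (Catalogue.isLFP_of_iteratedLFP h𝓛 extended_functional hr₂ hγ)
    obtain rfl := hα'.unique (Catalogue.stratifiedOp_op h𝓛 hr') (Catalogue.stratifiedOp_op h𝓛 hr₂)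
      hγ
    exact h
  · exact fun h => ⟨_, _, hr', Catalogue.isLFP_of_iteratedLFP h𝓛 extended_functional hr' hα', h⟩

theorem gfpConforms_iff (h𝓛 : 𝓛.Lawful) (hr : S.cat.IsStratification r)
    (hα : IteratedLFP (P := (Set (Node I L B))ᵒᵈ) (S.cat.op (S.domain G) G) r α) :
    S.GFPConforms G ↔ ∀ d ∈ S.sel, selSem (S.domain G) G d.2 ⊆ α d.1 := by
  have hα' := extendAssign_iteratedGFP h𝓛 hα
  have hr' := extended_isStratification h𝓛 hr
  rw [← extendAssign_empty_iff]
  rw [← extended_domain h𝓛] at hα'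
  constructor
  · rintro ⟨r₂, β, hr₂, hβ, h⟩
    obtain ⟨γ, hγ⟩ := (Catalogue.stratifiedOp_op (D := S.extended.domain G) (G := G) h𝓛
      hr₂).dual.exists_iteratedLFP
    obtain rfl := hβ.unique (Catalogue.isGFP_of_iteratedLFP h𝓛 extended_functional hr₂ hγ)
    obtain rfl := hα'.unique (Catalogue.stratifiedOp_op h𝓛 hr').dual
      (Catalogue.stratifiedOp_op h𝓛 hr₂).dual hγ
    exact h
  · exact fun h => ⟨_, _, hr', Catalogue.isGFP_of_iteratedLFP h𝓛 extended_functional hr' hα', h⟩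

end Schema

/-! ### Matching a set against a list of requirements -/

section Matching

variable {X T T' : Type}

/-- The set `F` can be matched against the list `A` of requirements: distinct elements of `F` can be
chosen, one for each member of `A`, which satisfy these requirements, and all the other elements of
`F` satisfy `P`. -/
def Matching (sat : T → X → Prop) (P : X → Prop) : List T → Set X → Prop
  | [], F => ∀ x ∈ F, P x
  | a :: A, F => ∃ x ∈ F, sat a x ∧ Matching sat P A (F \ {x})

variable {sat : T → X → Prop} {P P' : X → Prop}

theorem matching_nil_or {A : List T} {F : Set X} :
    Matching sat (fun x => P x ∨ P' x) A F ↔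
      ∃ F₁ F₂, Disjoint F₁ F₂ ∧ F = F₁ ∪ F₂ ∧ (∀ x ∈ F₁, P x) ∧ Matching sat P' A F₂ := by
  induction A generalizing F with
  | nil =>
    constructor
    · intro h
      refine ⟨{x ∈ F | P x}, {x ∈ F | ¬ P x}, ?_, ?_, fun x hx => hx.2, fun x hx =>
        (h x hx.1).resolve_left hx.2⟩
      · exact Set.disjoint_left.2 fun x hx hx' => hx'.2 hx.2
      · ext x
        by_cases hx : P x <;> simp [hx]
    · rintro ⟨F₁, F₂, _, rfl, h₁, h₂⟩ x (hx | hx)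
      · exact Or.inl (h₁ x hx)
      · exact Or.inr (h₂ x hx)
  | cons a A ih =>
    constructor
    · rintro ⟨x, hx, ha, h⟩
      obtain ⟨F₁, F₂, hd, e, h₁, h₂⟩ := ih.1 h
      have hx₁ : x ∉ F₁ := fun h => (e.ge (Or.inl h)).2 rfl
      have hx₂ : x ∉ F₂ := fun h => (e.ge (Or.inr h)).2 rfl
      refine ⟨F₁, insert x F₂, Set.disjoint_insert_right.2 ⟨hx₁, hd⟩, ?_, h₁, x,
        Set.mem_insert x F₂, ha, ?_⟩
      · rw [Set.union_insert, ← e, Set.insert_sdiff_singleton, Set.insert_eq_of_mem hx]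
      · rwa [Set.insert_sdiff_self_of_notMem hx₂]
    · rintro ⟨F₁, F₂, hd, rfl, h₁, x, hx, ha, h⟩
      refine ⟨x, Or.inr hx, ha, ih.2 ⟨F₁, F₂ \ {x}, hd.mono_right Set.sdiff_subset, ?_, h₁, h⟩⟩
      rw [Set.union_sdiff_distrib, Set.sdiff_singleton_eq_self (Set.disjoint_right.1 hd hx)]

theorem matching_append {A A' : List T} {F : Set X} :
    Matching sat (fun x => P x ∨ P' x) (A ++ A') F ↔
      ∃ F₁ F₂, Disjoint F₁ F₂ ∧ F = F₁ ∪ F₂ ∧ Matching sat P A F₁ ∧ Matching sat P' A' F₂ := by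
  induction A generalizing F with
  | nil => exact matching_nil_or
  | cons a A ih =>
    constructor
    · rintro ⟨x, hx, ha, h⟩
      obtain ⟨F₁, F₂, hd, e, h₁, h₂⟩ := ih.1 h
      have hx₁ : x ∉ F₁ := fun h => (e.ge (Or.inl h)).2 rfl
      have hx₂ : x ∉ F₂ := fun h => (e.ge (Or.inr h)).2 rfl
      refine ⟨insert x F₁, F₂, Set.disjoint_insert_left.2 ⟨hx₂, hd⟩, ?_, ⟨x,
        Set.mem_insert x F₁, ha, ?_⟩, h₂⟩
      · rw [Set.insert_union, ← e, Set.insert_sdiff_singleton, Set.insert_eq_of_mem hx]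
      · rwa [Set.insert_sdiff_self_of_notMem hx₁]
    · rintro ⟨F₁, F₂, hd, rfl, ⟨x, hx, ha, h⟩, h₂⟩
      refine ⟨x, Or.inl hx, ha, ih.2 ⟨F₁ \ {x}, F₂, hd.mono_left Set.sdiff_subset, ?_, h, h₂⟩⟩
      rw [Set.union_sdiff_distrib, Set.sdiff_singleton_eq_self (Set.disjoint_left.1 hd hx)]

/-- The ways to split a list into two complementary sublists. -/
def splits : List T → List (List T × List T)
  | [] => [([], [])]
  | a :: A => (splits A).flatMap fun s => [(a :: s.1, s.2), (s.1, a :: s.2)]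

theorem mem_of_mem_splits {A : List T} {s : List T × List T} (hs : s ∈ splits A) {a : T}
    (ha : a ∈ s.1 ∨ a ∈ s.2) : a ∈ A := by
  induction A generalizing s with
  | nil => simp_all [splits]
  | cons b A ih =>
    simp only [splits, List.mem_flatMap, List.mem_cons, List.not_mem_nil, or_false] at hs
    obtain ⟨s', hs', rfl | rfl⟩ := hs <;> have := @ih s' hs' <;> simp at ha <;>
      rw [List.mem_cons] <;> tauto

/-- Every set of positions of a list gives rise to a split of it. -/
theorem exists_split (A : List T) (p : Fin A.length → Prop) [DecidablePred p] :
    ∃ s ∈ splits A, s.1.length = (Finset.univ.filter p).card ∧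
      (∀ a, a ∈ s.1 ↔ ∃ i, p i ∧ A.get i = a) ∧ ∀ a, a ∈ s.2 ↔ ∃ i, ¬ p i ∧ A.get i = a := by
  induction A with
  | nil => exact ⟨([], []), by simp [splits], by simp, fun a => by simp, fun a => by simp⟩
  | cons b A ih =>
    obtain ⟨s, hs, hl, h₁, h₂⟩ := ih fun i => p i.succ
    by_cases h0 : p (0 : Fin (A.length + 1))
    · refine ⟨(b :: s.1, s.2), ?_, ?_, fun a => ?_, fun a => ?_⟩
      · simp only [splits, List.mem_flatMap]
        exact ⟨s, hs, by simp⟩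
      · have := Fin.card_filter_univ_succ (n := A.length) p
        simp only [h0, if_true] at this
        simp only [List.length_cons, hl]
        exact this.symm
      · have := Fin.exists_fin_succ (P := fun i => p i ∧ (b :: A).get i = a)
        refine Iff.trans ?_ this.symm
        simp [h0, h₁, eq_comm]
      · have := Fin.exists_fin_succ (P := fun i => ¬ p i ∧ (b :: A).get i = a)
        refine Iff.trans ?_ this.symm
        simp [h0, h₂]
    · refine ⟨(s.1, b :: s.2), ?_, ?_, fun a => ?_, fun a => ?_⟩
      · simp only [splits, List.mem_flatMap]
        exact ⟨s, hs, by simp⟩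
      · have := Fin.card_filter_univ_succ (n := A.length) p
        simp only [h0, if_false] at this
        simp only [hl]
        exact this.symm
      · have := Fin.exists_fin_succ (P := fun i => p i ∧ (b :: A).get i = a)
        refine Iff.trans ?_ this.symm
        simp [h0, h₁]
      · have := Fin.exists_fin_succ (P := fun i => ¬ p i ∧ (b :: A).get i = a)
        refine Iff.trans ?_ this.symm
        simp [h0, h₂, eq_comm]

theorem matching_of_injective {A : List T} {F : Set X} (f : Fin A.length → X)
    (hf : Function.Injective f) (hF : ∀ i, f i ∈ F) (hs : ∀ i, sat (A.get i) (f i))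
    (hP : ∀ x ∈ F, x ∉ Set.range f → P x) : Matching sat P A F := by
  induction A generalizing F with
  | nil => exact fun x hx => hP x hx fun ⟨i, _⟩ => i.elim0
  | cons a A ih =>
    refine ⟨f (0 : Fin (A.length + 1)), hF _, hs (0 : Fin (A.length + 1)), ?_⟩
    refine ih (fun i => f i.succ) (fun i j h => Fin.succ_injective _ (hf h))
      (fun i => ⟨hF _, fun h => (Fin.succ_ne_zero i) (hf h)⟩) (fun i => hs i.succ) ?_
    rintro x ⟨hx, hx0⟩ hne
    refine hP x hx ?_
    rintro ⟨i, rfl⟩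
    revert hx0 hne
    refine Fin.cases (motive := fun i : Fin (A.length + 1) => f i ∉ ({f 0} : Set X) →
      (f i ∉ Set.range fun j : Fin A.length => f j.succ) → False) ?_ ?_ i
    · exact fun h _ => h rfl
    · exact fun j _ h => h ⟨j, rfl⟩

/-- The conditions on cardinalities that are equivalent to the existence of a matching. -/
def HallConditions (sat : T → X → Prop) (P : X → Prop) (A : List T) (W : Set X) : Prop :=
  ∀ s ∈ splits A, s.1.length ≤ {w ∈ W | ∃ a ∈ s.1, sat a w}.ncard ∧
    {w ∈ W | ¬ (P w ∨ ∃ a ∈ s.2, sat a w)}.ncard ≤ s.1.length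

theorem Matching.hallConditions {A : List T} {W : Set X} (hW : W.Finite)
    (h : Matching sat P A W) : HallConditions sat P A W := by
  induction A generalizing W with
  | nil =>
    intro s hs
    obtain rfl : s = ([], []) := by simpa [splits] using hs
    have : {w ∈ W | ¬ (P w ∨ ∃ a ∈ ([] : List T), sat a w)} = ∅ :=
      Set.eq_empty_of_forall_notMem fun w hw => hw.2 (Or.inl (h w hw.1))
    exact ⟨Nat.zero_le _, by rw [this]; simp⟩
  | cons a A ih =>
    obtain ⟨x, hx, ha, h⟩ := h
    intro s hs
    simp only [splits, List.mem_flatMap, List.mem_cons, List.not_mem_nil, or_false] at hs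
    obtain ⟨s, hs, rfl | rfl⟩ := hs <;> obtain ⟨h₁, h₂⟩ := ih (hW.sdiff (t := {x})) h s hs
    · constructor
      · have hsub : insert x {w ∈ W \ {x} | ∃ a ∈ s.1, sat a w} ⊆
            {w ∈ W | ∃ b ∈ a :: s.1, sat b w} := by
          rintro w (rfl | ⟨⟨hw, _⟩, b, hb, hbw⟩)
          · exact ⟨hx, a, List.mem_cons_self, ha⟩
          · exact ⟨hw, b, List.mem_cons_of_mem _ hb, hbw⟩
        have := Set.ncard_le_ncard hsub (hW.subset fun w hw => hw.1)
        rw [Set.ncard_insert_of_notMem (fun h => h.1.2 rfl)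
          (hW.subset fun w hw => hw.1.1)] at this
        simp only [List.length_cons]
        omega
      · have hsub : {w ∈ W | ¬ (P w ∨ ∃ a ∈ s.2, sat a w)} ⊆
            insert x {w ∈ W \ {x} | ¬ (P w ∨ ∃ a ∈ s.2, sat a w)} := by
          rintro w ⟨hw, hn⟩
          rcases eq_or_ne w x with rfl | hne
          · exact Set.mem_insert _ _
          · exact Set.mem_insert_of_mem _ ⟨⟨hw, hne⟩, hn⟩
        have := Set.ncard_le_ncard hsub ((hW.subset fun w hw => hw.1.1).insert x)
        have := Set.ncard_insert_le x {w ∈ W \ {x} | ¬ (P w ∨ ∃ a ∈ s.2, sat a w)}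
        simp only [List.length_cons]
        omega
    · constructor
      · exact h₁.trans (Set.ncard_le_ncard (fun w hw => ⟨hw.1.1, hw.2⟩)
          (hW.subset fun w hw => hw.1))
      · refine le_trans (Set.ncard_le_ncard ?_ (hW.subset fun w hw => hw.1.1)) h₂
        rintro w ⟨hw, hn⟩
        refine ⟨⟨hw, ?_⟩, fun h => hn (h.imp_right fun ⟨b, hb, hbw⟩ =>
          ⟨b, List.mem_cons_of_mem _ hb, hbw⟩)⟩
        rintro rfl
        exact hn (Or.inr ⟨a, List.mem_cons_self, ha⟩)

/-- Hall's marriage theorem, applied after adding dummy requirements that can be met by any element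
satisfying `P`, as many as are needed to use up all of `W`. -/
theorem HallConditions.matching {A : List T} {W : Set X} (hW : W.Finite)
    (h : HallConditions sat P A W) : Matching sat P A W := by
  classical
  have ncard_eq (p : X → Prop) [DecidablePred p] : {w ∈ W | p w}.ncard = (hW.toFinset.filter p).card := by
    rw [← Set.ncard_coe_finset]
    congr 1
    ext w
    simp
  set k := A.length with hk
  set m := hW.toFinset.card with hm
  have hkm : k ≤ m := by
    obtain ⟨s, hs, hl, _, _⟩ := exists_split A fun _ => True
    have := (h s hs).1
    rw [ncard_eq] at this
    simp only [Finset.filter_true, Finset.card_univ, Fintype.card_fin] at hl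
    have h' := Finset.card_filter_le hW.toFinset fun w => ∃ a ∈ s.1, sat a w
    omega
  let t : Fin k ⊕ Fin (m - k) → Finset X :=
    Sum.elim (fun i => hW.toFinset.filter (sat (A.get i))) fun _ => hW.toFinset.filter P
  have hall : ∀ s : Finset (Fin k ⊕ Fin (m - k)), s.card ≤ (s.biUnion t).card := by
    intro s
    rw [← Finset.card_toLeft_add_card_toRight]
    have hE : s.toRight.card ≤ m - k := by
      simpa using Finset.card_le_univ s.toRight
    rcases s.toRight.eq_empty_or_nonempty with he | ⟨e, he⟩
    · obtain ⟨u, hu, hl, h₁, _⟩ := exists_split A fun i => Sum.inl i ∈ s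
      have hl' : u.1.length = s.toLeft.card := by
        rw [hl]
        congr 1
        ext i
        simp
      have := (h u hu).1
      rw [ncard_eq] at this
      rw [he, Finset.card_empty, add_zero, ← hl']
      refine this.trans (Finset.card_le_card fun w hw => ?_)
      rw [Finset.mem_filter] at hw
      obtain ⟨hw, a, ha, haw⟩ := hw
      obtain ⟨i, hi, rfl⟩ := (h₁ a).1 ha
      exact Finset.mem_biUnion.2 ⟨_, hi, Finset.mem_filter.2 ⟨hw, haw⟩⟩
    · obtain ⟨u, hu, hl, _, h₂⟩ := exists_split A fun i => Sum.inl i ∉ s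
      have hl' : u.1.length + s.toLeft.card = k := by
        have : s.toLeft = Finset.univ.filter fun i => Sum.inl i ∈ s := by
          ext i
          simp
        rw [hl, this, add_comm, Finset.card_filter_add_card_filter_not]
        simp
      have := (h u hu).2
      rw [ncard_eq] at this
      have hsum := Finset.card_filter_add_card_filter_not (s := hW.toFinset)
        (fun w => P w ∨ ∃ a ∈ u.2, sat a w)
      have hsub : (hW.toFinset.filter fun w => P w ∨ ∃ a ∈ u.2, sat a w) ⊆ s.biUnion t := by
        intro w hw
        rw [Finset.mem_filter] at hw
        obtain ⟨hw, hPw | ⟨a, ha, haw⟩⟩ := hw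
        · exact Finset.mem_biUnion.2 ⟨_, Finset.mem_toRight.1 he, Finset.mem_filter.2 ⟨hw, hPw⟩⟩
        · obtain ⟨i, hi, rfl⟩ := (h₂ a).1 ha
          exact Finset.mem_biUnion.2 ⟨_, not_not.1 hi, Finset.mem_filter.2 ⟨hw, haw⟩⟩
      have := Finset.card_le_card hsub
      omega
  obtain ⟨f, hf, hft⟩ := (Finset.all_card_le_biUnion_card_iff_exists_injective t).1 hall
  have hfW : ∀ x, f x ∈ hW.toFinset := by
    rintro (i | i) <;> exact (Finset.mem_filter.1 (hft _)).1
  refine matching_of_injective (fun i => f (Sum.inl i)) (fun i j e => Sum.inl_injective (hf e))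
    (fun i => hW.mem_toFinset.1 (hfW _)) (fun i => (Finset.mem_filter.1 (hft (Sum.inl i))).2) ?_
  intro x hx hne
  have himg : Finset.univ.image f = hW.toFinset := by
    refine Finset.eq_of_subset_of_card_le (fun y hy => ?_) ?_
    · obtain ⟨z, _, rfl⟩ := Finset.mem_image.1 hy
      exact hfW z
    · rw [Finset.card_image_of_injective _ hf]
      simp
      omega
  have hx' : x ∈ Finset.univ.image f := himg ▸ hW.mem_toFinset.2 hx
  obtain ⟨i | i, _, rfl⟩ := Finset.mem_image.1 hx'
  · exact absurd ⟨i, rfl⟩ hne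
  · exact (Finset.mem_filter.1 (hft (Sum.inr i))).2

theorem matching_iff_hallConditions {A : List T} {W : Set X} (hW : W.Finite) :
    Matching sat P A W ↔ HallConditions sat P A W :=
  ⟨fun h => h.hallConditions hW, fun h => h.matching hW⟩

end Matching

/-! ### From Restricted ShEx to Restricted SHACL: shapes -/

namespace SHACL

/-- The disjunction of a list of shapes. -/
def bigOr (l : List (SHACL I L V M)) : SHACL I L V M := l.foldr or bot

/-- The conjunction of a list of shapes. -/
def bigAnd (l : List (SHACL I L V M)) : SHACL I L V M := l.foldr and top

theorem mem_names_bigOr {l : List (SHACL I L V M)} {s : M} :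
    s ∈ (bigOr l).names ↔ ∃ φ ∈ l, s ∈ φ.names := by
  induction l with
  | nil => simp [bigOr, names]
  | cons a l ih =>
    simp only [List.mem_cons, exists_eq_or_imp, ← ih]
    exact Iff.rfl

theorem mem_names_bigAnd {l : List (SHACL I L V M)} {s : M} :
    s ∈ (bigAnd l).names ↔ ∃ φ ∈ l, s ∈ φ.names := by
  induction l with
  | nil => simp [bigAnd, names]
  | cons a l ih =>
    simp only [List.mem_cons, exists_eq_or_imp, ← ih]
    exact Iff.rfl

theorem mem_consts_bigOr {l : List (SHACL I L V M)} {c : Const I L} :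
    c ∈ (bigOr l).consts ↔ ∃ φ ∈ l, c ∈ φ.consts := by
  induction l with
  | nil => simp [bigOr, consts]
  | cons a l ih =>
    simp only [List.mem_cons, exists_eq_or_imp, ← ih]
    exact Iff.rfl

theorem mem_consts_bigAnd {l : List (SHACL I L V M)} {c : Const I L} :
    c ∈ (bigAnd l).consts ↔ ∃ φ ∈ l, c ∈ φ.consts := by
  induction l with
  | nil => simp [bigAnd, consts]
  | cons a l ih =>
    simp only [List.mem_cons, exists_eq_or_imp, ← ih]
    exact Iff.rfl

theorem admissible_bigOr {r : M → ℕ} {i : ℕ} {b : Bool} {l : List (SHACL I L V M)}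
    (h : ∀ φ ∈ l, φ.Admissible r i b) : (bigOr l).Admissible r i b := by
  induction l with
  | nil => trivial
  | cons a l ih =>
    rw [List.forall_mem_cons] at h
    exact ⟨h.1, ih h.2⟩

theorem admissible_bigAnd {r : M → ℕ} {i : ℕ} {b : Bool} {l : List (SHACL I L V M)}
    (h : ∀ φ ∈ l, φ.Admissible r i b) : (bigAnd l).Admissible r i b := by
  induction l with
  | nil => trivial
  | cons a l ih =>
    rw [List.forall_mem_cons] at h
    exact ⟨h.1, ih h.2⟩

variable {val : V → Set (Node I L B)} {D : Set (Node I L B)} {G : Graph I L B}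
  {α : M → Set (Node I L B)} {v : Node I L B}

theorem mem_sem_bigOr {l : List (SHACL I L V M)} :
    v ∈ (bigOr l).sem val D G α ↔ ∃ φ ∈ l, v ∈ φ.sem val D G α := by
  induction l with
  | nil => simp [bigOr, sem]
  | cons a l ih =>
    simp only [List.mem_cons, exists_eq_or_imp, ← ih]
    exact Iff.rfl

theorem mem_sem_bigAnd (hv : v ∈ D) {l : List (SHACL I L V M)} :
    v ∈ (bigAnd l).sem val D G α ↔ ∀ φ ∈ l, v ∈ φ.sem val D G α := by
  induction l with
  | nil => simpa [bigAnd, sem] using hv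
  | cons a l ih =>
    rw [List.forall_mem_cons, ← ih]
    exact Iff.rfl

/-- The Hall conditions for a matching of the `q`-successors of a node with the requirements `A`,
where all other successors satisfy a member of `B`. -/
def hallShape (q : Step I) (A B : List (SHACL I L V M)) : SHACL I L V M :=
  bigAnd ((splits A).map fun s =>
    and (ge s.1.length q (bigOr s.1)) (le s.1.length q (not (bigOr (B ++ s.2)))))

theorem names_hallShape {q : Step I} {A C : List (SHACL I L V M)} {s : M}
    (h : s ∈ (hallShape q A C).names) : ∃ φ ∈ A ++ C, s ∈ φ.names := by
  obtain ⟨φ, hφ, hs⟩ := mem_names_bigAnd.1 h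
  obtain ⟨u, hu, rfl⟩ := List.mem_map.1 hφ
  rcases hs with hs | hs
  · obtain ⟨φ, hφ, hs⟩ := mem_names_bigOr.1 hs
    exact ⟨φ, List.mem_append_left _ (mem_of_mem_splits hu (Or.inl hφ)), hs⟩
  · obtain ⟨φ, hφ, hs⟩ := mem_names_bigOr.1 hs
    rcases List.mem_append.1 hφ with hφ | hφ
    · exact ⟨φ, List.mem_append_right _ hφ, hs⟩
    · exact ⟨φ, List.mem_append_left _ (mem_of_mem_splits hu (Or.inr hφ)), hs⟩

theorem consts_hallShape {q : Step I} {A C : List (SHACL I L V M)} {c : Const I L}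
    (h : c ∈ (hallShape q A C).consts) : ∃ φ ∈ A ++ C, c ∈ φ.consts := by
  obtain ⟨φ, hφ, hs⟩ := mem_consts_bigAnd.1 h
  obtain ⟨u, hu, rfl⟩ := List.mem_map.1 hφ
  rcases hs with hs | hs
  · obtain ⟨φ, hφ, hs⟩ := mem_consts_bigOr.1 hs
    exact ⟨φ, List.mem_append_left _ (mem_of_mem_splits hu (Or.inl hφ)), hs⟩
  · obtain ⟨φ, hφ, hs⟩ := mem_consts_bigOr.1 hs
    rcases List.mem_append.1 hφ with hφ | hφ
    · exact ⟨φ, List.mem_append_right _ hφ, hs⟩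
    · exact ⟨φ, List.mem_append_left _ (mem_of_mem_splits hu (Or.inr hφ)), hs⟩

theorem admissible_hallShape {r : M → ℕ} {i : ℕ} {b : Bool} {q : Step I}
    {A C : List (SHACL I L V M)} (h : ∀ φ ∈ A ++ C, φ.Admissible r i b) :
    (hallShape q A C).Admissible r i b := by
  refine admissible_bigAnd fun φ hφ => ?_
  obtain ⟨u, hu, rfl⟩ := List.mem_map.1 hφ
  refine ⟨admissible_bigOr fun φ hφ =>
    h φ (List.mem_append_left _ (mem_of_mem_splits hu (Or.inl hφ))), ?_⟩
  change (bigOr (C ++ u.2)).Admissible r i (!!b)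
  rw [Bool.not_not]
  refine admissible_bigOr fun φ hφ => h φ ?_
  rcases List.mem_append.1 hφ with hφ | hφ
  · exact List.mem_append_right _ hφ
  · exact List.mem_append_left _ (mem_of_mem_splits hu (Or.inr hφ))

theorem mem_sem_hallShape (hD : G.nodes ⊆ D) (hv : v ∈ D) {q : Step I}
    {A C : List (SHACL I L V M)} :
    v ∈ (hallShape q A C).sem val D G α ↔
      Matching (fun φ w => w ∈ φ.sem val D G α) (fun w => ∃ φ ∈ C, w ∈ φ.sem val D G α) A
        {w | q.rel G v w} := by
  rw [matching_iff_hallConditions (G.finite_rel q v), hallShape, mem_sem_bigAnd hv,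
    List.forall_mem_map]
  refine forall₂_congr fun s _ => ?_
  refine and_congr ((and_iff_right hv).trans ?_) ((and_iff_right hv).trans ?_)
  · simp only [mem_sem_bigOr]
    rfl
  · have : {u | q.rel G v u ∧ u ∈ (not (bigOr (C ++ s.2))).sem val D G α} =
        {w ∈ {w | q.rel G v w} | ¬ ((∃ φ ∈ C, w ∈ φ.sem val D G α) ∨
          ∃ φ ∈ s.2, w ∈ φ.sem val D G α)} := by
      ext w
      refine and_congr_right fun hw => ?_
      refine (and_iff_right (hD (Step.rel_mem_nodes hw))).trans (not_congr ?_)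
      rw [mem_sem_bigOr]
      simp only [List.mem_append, or_and_right, exists_or]
    rw [this]

end SHACL

theorem Step.code_injective [Encodable I] {q q' : Step I} : q.code = q'.code ↔ q = q' := by
  refine ⟨fun h => ?_, congrArg _⟩
  cases q <;> cases q' <;> simp_all [Step.code, codeNode, Nat.pair_eq_pair]

/-- The predicates of the forward steps in a list. -/
def fwdPreds (l : List (Step I)) : List I :=
  l.filterMap fun | .fwd p => some p | .bwd _ => none

theorem mem_fwdPreds {l : List (Step I)} {p : I} : p ∈ fwdPreds l ↔ Step.fwd p ∈ l := by
  simp only [fwdPreds, List.mem_filterMap]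
  constructor
  · rintro ⟨_ | _, h, h'⟩ <;> simp_all
  · exact fun h => ⟨_, h, rfl⟩

/-- All pairs of a step and a shape in a list of alternatives. -/
def altEdges {T : Type} (alts : List (List T × List T)) : List T :=
  alts.flatMap fun x => x.1 ++ x.2

/-- The steps all of whose edges must be matched by a triple expression with the given edges,
if the rest is matched by `(¬R⁻)*` and, unless `Q` is `none`, by `(¬Q)*`. -/
def closedSteps {T : Type} (edges : List (Step I × T)) (R : List I) (Q : Option (List I)) :
    List (Step I) :=
  R.map Step.bwd ++ (Q.getD (fwdPreds (edges.map Prod.fst))).map Step.fwd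

theorem mem_altEdges {T : Type} {alts : List (List T × List T)} {e : T} :
    e ∈ altEdges alts ↔ ∃ x ∈ alts, e ∈ x.1 ++ x.2 := by
  simp [altEdges]

/-- The steps whose edges are admitted by `(¬R⁻)*` or, unless `Q` is `none`, by `(¬Q)*`. -/
def OpenStep (R : List I) (Q : Option (List I)) : Step I → Prop
  | .fwd p => ∃ Q' ∈ Q, p ∉ Q'
  | .bwd p => p ∉ R

theorem openStep_iff_of_mem {R : List I} {Q : Option (List I)} {edges : List (Step I × SHACL I L V M)} {q : Step I}
    (hq : q ∈ edges.map Prod.fst ++ closedSteps edges R Q) :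
    OpenStep R Q q ↔ q ∉ closedSteps edges R Q := by
  cases q with
  | bwd p => simp [OpenStep, closedSteps]
  | fwd p =>
    cases Q with
    | none =>
      have hp : p ∈ fwdPreds (edges.map Prod.fst) := by
        rcases List.mem_append.1 hq with hq | hq
        · exact mem_fwdPreds.2 hq
        · simpa [closedSteps] using hq
      simp [OpenStep, closedSteps, hp]
    | some Q => simp [OpenStep, closedSteps]

section

variable [Encodable I]

/-- The right-hand sides of the pairs with left-hand side `q`. -/
def atStep {T : Type} (q : Step I) (A : List (Step I × T)) : List T :=
  A.filterMap fun e => if e.1.code = q.code then some e.2 else none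

theorem mem_atStep {T : Type} {q : Step I} {A : List (Step I × T)} {φ : T} :
    φ ∈ atStep q A ↔ (q, φ) ∈ A := by
  simp only [atStep, List.mem_filterMap]
  constructor
  · rintro ⟨⟨q', φ'⟩, h, h'⟩
    split_ifs at h' with hq
    · obtain rfl : q' = q := Step.code_injective.1 hq
      cases h'
      exact h
  · exact fun h => ⟨_, h, by simp⟩

/-- Edges with different predicates can be matched separately. -/
theorem matching_iff_forall_step {T X : Type} {sat : T → X → Prop} {v : X}
    {P : X × Step I × X → Prop} {A : List (Step I × T)} {F : Set (X × Step I × X)}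
    (hF : ∀ t ∈ F, t.1 = v) :
    Matching (fun e t => t.2.1 = e.1 ∧ sat e.2 t.2.2) P A F ↔
      ∀ q, Matching sat (fun w => P (v, q, w)) (atStep q A) {w | (v, q, w) ∈ F} := by
  classical
  induction A generalizing F with
  | nil =>
    constructor
    · exact fun h q w hw => h _ hw
    · rintro h ⟨u, q, w⟩ ht
      obtain rfl : u = v := hF _ ht
      exact h q w ht
  | cons e A ih =>
    have hat : ∀ q, atStep q (e :: A) = if e.1 = q then e.2 :: atStep q A else atStep q A := by
      intro q
      by_cases h : e.1 = q
      · simp [atStep, h]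
      · have := mt Step.code_injective.1 h
        simp [atStep, h, this]
    have hsdiff : ∀ q w, {w' | (v, q, w') ∈ F \ {(v, e.1, w)}} =
        if e.1 = q then {w' | (v, q, w') ∈ F} \ {w} else {w' | (v, q, w') ∈ F} := by
      intro q w
      split_ifs with h
      · subst h
        ext w'
        simp
      · ext w'
        simp [Ne.symm h]
    constructor
    · rintro ⟨⟨u, q₀, w⟩, ht, ⟨rfl, hsat⟩, h⟩ q
      obtain rfl : u = v := hF _ ht
      have := (ih fun t ht => hF t ht.1).1 h q
      rw [hsdiff] at this
      rw [hat]
      split_ifs at this ⊢ with hq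
      · exact ⟨w, hq ▸ ht, hsat, this⟩
      · exact this
    · intro h
      have h₀ := h e.1
      rw [hat, if_pos rfl] at h₀
      obtain ⟨w, hw, hsat, h₀⟩ := h₀
      refine ⟨(v, e.1, w), hw, ⟨rfl, hsat⟩, (ih fun t ht => hF t ht.1).2 fun q => ?_⟩
      rw [hsdiff]
      split_ifs with hq
      · exact hq ▸ h₀
      · have := h q
        rwa [hat, if_neg hq] at this

/-- The shape that says that the neighbourhood of a node matches one of the given alternatives: the
first list of an alternative has to be matched by distinct edges, each other edge matches a member
of the second list or is admitted by `(¬R⁻)*` or `(¬Q)*`. The disjunction with `top` does not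
contribute to the meaning; it makes all constants of the alternatives occur in the shape. -/
def neighShape (alts : List (List (Step I × SHACL I L V M) × List (Step I × SHACL I L V M)))
    (R : List I) (Q : Option (List I)) : SHACL I L V M :=
  let edges := altEdges alts
  let closedList := closedSteps edges R Q
  .and (.and (if Q.isSome then .top else .closed (fwdPreds (edges.map Prod.fst)))
      (.or .top (SHACL.bigOr (edges.map Prod.snd))))
    (SHACL.bigOr (alts.map fun x => SHACL.bigAnd ((edges.map Prod.fst ++ closedList).map fun q =>
      SHACL.hallShape q (atStep q x.1)
        (if q.code ∈ closedList.map Step.code then atStep q x.2 else [.top]))))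

section

variable {alts : List (List (Step I × SHACL I L V M) × List (Step I × SHACL I L V M))}
  {R : List I} {Q : Option (List I)}

/-- The two lists for which `neighShape` states the Hall conditions consist of shapes of the
alternatives, and possibly `top`. -/
theorem mem_hall_lists {x : List (Step I × SHACL I L V M) × List (Step I × SHACL I L V M)}
    (hx : x ∈ alts) {q : Step I} {p : Prop} [Decidable p] {φ : SHACL I L V M}
    (h : φ ∈ atStep q x.1 ++ if p then atStep q x.2 else [.top]) :
    φ = .top ∨ ∃ e ∈ altEdges alts, e.2 = φ := by
  rcases List.mem_append.1 h with h | h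
  · exact Or.inr ⟨_, mem_altEdges.2 ⟨x, hx, List.mem_append_left _ (mem_atStep.1 h)⟩, rfl⟩
  · split_ifs at h
    · exact Or.inr ⟨_, mem_altEdges.2 ⟨x, hx, List.mem_append_right _ (mem_atStep.1 h)⟩, rfl⟩
    · exact Or.inl (List.mem_singleton.1 h)

theorem names_neighShape {s : M} (h : s ∈ (neighShape alts R Q).names) :
    ∃ e ∈ altEdges alts, s ∈ e.2.names := by
  rcases h with (h | h | h) | h
  · split_ifs at h <;> cases h
  · cases h
  · obtain ⟨_, h₁, h⟩ := SHACL.mem_names_bigOr.1 h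
    obtain ⟨e, he, rfl⟩ := List.mem_map.1 h₁
    exact ⟨e, he, h⟩
  · obtain ⟨_, h₁, h⟩ := SHACL.mem_names_bigOr.1 h
    obtain ⟨x, hx, rfl⟩ := List.mem_map.1 h₁
    obtain ⟨_, h₁, h⟩ := SHACL.mem_names_bigAnd.1 h
    obtain ⟨q, hq, rfl⟩ := List.mem_map.1 h₁
    obtain ⟨φ, hφ, h⟩ := SHACL.names_hallShape h
    rcases mem_hall_lists hx hφ with rfl | ⟨e, he, rfl⟩
    · cases h
    · exact ⟨e, he, h⟩

theorem mem_consts_neighShape {c : Const I L} :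
    c ∈ (neighShape alts R Q).consts ↔ ∃ e ∈ altEdges alts, c ∈ e.2.consts := by
  constructor
  · rintro ((h | h | h) | h)
    · split_ifs at h <;> cases h
    · cases h
    · obtain ⟨_, h₁, h⟩ := SHACL.mem_consts_bigOr.1 h
      obtain ⟨e, he, rfl⟩ := List.mem_map.1 h₁
      exact ⟨e, he, h⟩
    · obtain ⟨_, h₁, h⟩ := SHACL.mem_consts_bigOr.1 h
      obtain ⟨x, hx, rfl⟩ := List.mem_map.1 h₁
      obtain ⟨_, h₁, h⟩ := SHACL.mem_consts_bigAnd.1 h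
      obtain ⟨q, hq, rfl⟩ := List.mem_map.1 h₁
      obtain ⟨φ, hφ, h⟩ := SHACL.consts_hallShape h
      rcases mem_hall_lists hx hφ with rfl | ⟨e, he, rfl⟩
      · cases h
      · exact ⟨e, he, h⟩
  · rintro ⟨e, he, h⟩
    exact Or.inl (Or.inr (Or.inr (SHACL.mem_consts_bigOr.2 ⟨e.2, List.mem_map_of_mem he, h⟩)))

theorem admissible_neighShape {r : M → ℕ} {i : ℕ} {b : Bool}
    (h : ∀ e ∈ altEdges alts, e.2.Admissible r i b) : (neighShape alts R Q).Admissible r i b := by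
  refine ⟨⟨?_, trivial, SHACL.admissible_bigOr ?_⟩, SHACL.admissible_bigOr ?_⟩
  · split_ifs <;> trivial
  · exact List.forall_mem_map.2 h
  · simp only [List.forall_mem_map]
    intro x hx
    refine SHACL.admissible_bigAnd ?_
    simp only [List.forall_mem_map]
    refine fun q _ => SHACL.admissible_hallShape fun φ hφ => ?_
    rcases mem_hall_lists hx hφ with rfl | ⟨e, he, rfl⟩
    · trivial
    · exact h e he

variable {val : V → Set (Node I L B)} {D : Set (Node I L B)} {G : Graph I L B}
  {α : M → Set (Node I L B)} {v : Node I L B}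

/-- An edge `t` with a suitable step whose target satisfies the shape of `e`. -/
def EdgeSat (val : V → Set (Node I L B)) (D : Set (Node I L B)) (G : Graph I L B)
    (α : M → Set (Node I L B)) (e : Step I × SHACL I L V M) (t : Node I L B × Step I × Node I L B) :
    Prop :=
  t.2.1 = e.1 ∧ t.2.2 ∈ e.2.sem val D G α

theorem mem_sem_neighShape (hD : G.nodes ⊆ D) :
    v ∈ (neighShape alts R Q).sem val D G α ↔ v ∈ D ∧ ∃ x ∈ alts,
      Matching (EdgeSat val D G α)
        (fun t => (∃ e ∈ x.2, EdgeSat val D G α e t) ∨ OpenStep R Q t.2.1) x.1 (G.neigh v) := by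
  by_cases hv : v ∈ D
  swap
  · refine iff_of_false ?_ fun h => hv h.1
    rintro ⟨⟨h, _⟩, _⟩
    split_ifs at h
    · exact hv h
    · exact hv h.1
  set edges := altEdges alts with hedges
  -- The guard in front of the disjunction takes care of the forward steps that do not occur at all.
  have hguard : v ∈ (if Q.isSome then SHACL.top else
      SHACL.closed (fwdPreds (edges.map Prod.fst)) : SHACL I L V M).sem val D G α ↔
      ∀ q, q ∉ edges.map Prod.fst → ¬ OpenStep R Q q → q ∉ closedSteps edges R Q →
        ∀ w, ¬ q.rel G v w := by
    cases Q with
    | none =>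
      constructor
      · rintro ⟨_, h⟩ (p | p) hp ho hc w hw
        · exact h p (mt mem_fwdPreds.1 hp) w hw
        · simp only [OpenStep, not_not] at ho
          exact hc (by simp [closedSteps, ho])
      · intro h
        refine ⟨hv, fun p hp w => h (Step.fwd p) (mt mem_fwdPreds.2 hp) (by simp [OpenStep]) ?_ w⟩
        simpa [closedSteps] using hp
    | some Q =>
      refine iff_of_true hv fun q hq ho hc => absurd ?_ hc
      cases q with
      | fwd p => simpa [OpenStep, closedSteps] using ho
      | bwd p => simpa [OpenStep, closedSteps] using ho
  have hmatch : ∀ x ∈ alts, (Matching (EdgeSat val D G α)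
        (fun t => (∃ e ∈ x.2, EdgeSat val D G α e t) ∨ OpenStep R Q t.2.1) x.1 (G.neigh v) ↔
      ∀ q, Matching (fun φ w => w ∈ φ.sem val D G α)
        (fun w => (∃ φ ∈ atStep q x.2, w ∈ φ.sem val D G α) ∨ OpenStep R Q q) (atStep q x.1)
          {w | q.rel G v w}) := by
    intro x _
    refine (matching_iff_forall_step (v := v) fun t ht => ht.1).trans (forall_congr' fun q => ?_)
    have e₁ : {w | (v, q, w) ∈ G.neigh v} = {w | q.rel G v w} :=
      Set.ext fun w => and_iff_right rfl
    have e₂ : ∀ w, (∃ e ∈ x.2, EdgeSat val D G α e (v, q, w)) ↔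
        ∃ φ ∈ atStep q x.2, w ∈ φ.sem val D G α := by
      intro w
      constructor
      · rintro ⟨⟨q', φ⟩, he, h, h'⟩
        obtain rfl : q = q' := h
        exact ⟨φ, mem_atStep.2 he, h'⟩
      · rintro ⟨φ, hφ, h⟩
        exact ⟨_, mem_atStep.1 hφ, rfl, h⟩
    rw [e₁]
    simp only [e₂]
    exact Iff.rfl
  have hstep : ∀ x ∈ alts, ∀ q ∈ edges.map Prod.fst ++ closedSteps edges R Q,
      (v ∈ (SHACL.hallShape q (atStep q x.1)
        (if q.code ∈ (closedSteps edges R Q).map Step.code then atStep q x.2 else [.top])).sem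
          val D G α ↔ Matching (fun φ w => w ∈ φ.sem val D G α)
        (fun w => (∃ φ ∈ atStep q x.2, w ∈ φ.sem val D G α) ∨ OpenStep R Q q) (atStep q x.1)
          {w | q.rel G v w}) := by
    intro x _ q hq
    rw [SHACL.mem_sem_hallShape hD hv]
    have hcode : q.code ∈ (closedSteps edges R Q).map Step.code ↔ q ∈ closedSteps edges R Q := by
      simp [Step.code_injective]
    by_cases h : q ∈ closedSteps edges R Q
    · have := mt (openStep_iff_of_mem hq).1 (not_not.2 h)
      simp only [if_pos (hcode.2 h), this, or_false]
    · have := (openStep_iff_of_mem hq).2 h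
      rw [if_neg (mt hcode.1 h)]
      rw [matching_iff_hallConditions (G.finite_rel q v),
        matching_iff_hallConditions (G.finite_rel q v)]
      refine forall₂_congr fun s _ => and_congr_right fun _ => ?_
      have e : {w ∈ {w | q.rel G v w} | ¬ ((∃ φ ∈ [SHACL.top], w ∈ φ.sem val D G α) ∨
          ∃ a ∈ s.2, w ∈ a.sem val D G α)} = {w ∈ {w | q.rel G v w} |
          ¬ (((∃ φ ∈ atStep q x.2, w ∈ φ.sem val D G α) ∨ OpenStep R Q q) ∨
            ∃ a ∈ s.2, w ∈ a.sem val D G α)} := by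
        ext w
        refine and_congr_right fun hw => not_congr (iff_of_true (Or.inl ?_) (Or.inl (Or.inr this)))
        exact ⟨_, List.mem_singleton_self _, hD (Step.rel_mem_nodes hw)⟩
      rw [e]
  have hdummy : v ∈ (SHACL.or .top (SHACL.bigOr (edges.map Prod.snd))).sem val D G α := Or.inl hv
  constructor
  · rintro ⟨⟨hg, _⟩, h⟩
    obtain ⟨_, h₁, h⟩ := SHACL.mem_sem_bigOr.1 h
    obtain ⟨x, hx, rfl⟩ := List.mem_map.1 h₁
    rw [SHACL.mem_sem_bigAnd hv, List.forall_mem_map] at h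
    refine ⟨hv, x, hx, (hmatch x hx).2 fun q => ?_⟩
    by_cases hq : q ∈ edges.map Prod.fst ++ closedSteps edges R Q
    · exact (hstep x hx q hq).1 (h q hq)
    · rw [List.mem_append, not_or] at hq
      have hempty : atStep q x.1 = [] := List.eq_nil_iff_forall_not_mem.2 fun φ hφ =>
        hq.1 (List.mem_map.2 ⟨_, mem_altEdges.2
          ⟨x, hx, List.mem_append_left _ (mem_atStep.1 hφ)⟩, rfl⟩)
      rw [hempty]
      intro w hw
      by_cases ho : OpenStep R Q q
      · exact Or.inr ho
      · exact absurd hw (hguard.1 hg q hq.1 ho hq.2 w)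
  · rintro ⟨_, x, hx, h⟩
    rw [hmatch x hx] at h
    refine ⟨⟨hguard.2 fun q hq ho _ w hw => ?_, hdummy⟩, SHACL.mem_sem_bigOr.2
      ⟨_, List.mem_map_of_mem hx, (SHACL.mem_sem_bigAnd hv).2 (List.forall_mem_map.2 fun q hq =>
        (hstep x hx q hq).2 (h q))⟩⟩
    have hnot : ∀ {A : List (Step I × SHACL I L V M)}, (∀ e ∈ A, e ∈ edges) → atStep q A = [] :=
      fun hA => List.eq_nil_iff_forall_not_mem.2 fun φ hφ =>
        hq (List.mem_map.2 ⟨_, hA _ (mem_atStep.1 hφ), rfl⟩)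
    have h₁ := h q
    rw [hnot fun e he => mem_altEdges.2 ⟨x, hx, List.mem_append_left _ he⟩,
      hnot fun e he => mem_altEdges.2 ⟨x, hx, List.mem_append_right _ he⟩] at h₁
    simpa [ho] using h₁ w hw

end

end

/-- A neighbourhood shape holds if a part of the neighbourhood is matched by the triple expression,
while all other edges are left open. -/
theorem ShEx.mem_sem_neigh {val : V → Set (Node I L B)} {D : Set (Node I L B)} {G : Graph I L B}
    {α : M → Set (Node I L B)} {f : ShExTriple I L V M} {R : List I} {Q : Option (List I)}
    {v : Node I L B} : v ∈ (ShEx.neigh f R Q).sem val D G α ↔ v ∈ D ∧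
      ∃ F ∈ f.sem val D G α, F ⊆ G.neigh v ∧ ∀ t ∈ G.neigh v \ F, OpenStep R Q t.2.1 := by
  cases Q with
  | none =>
    simp only [ShEx.sem, Set.mem_ofPred_eq]
    refine and_congr_right fun _ => ?_
    constructor
    · rintro ⟨F₁, h₁, F₂, h₂, -, e⟩
      refine ⟨F₁, h₁, Set.subset_union_left.trans e.ge, fun t ht => ?_⟩
      obtain ⟨p, hp, hq⟩ := h₂ t ((e.le ht.1).resolve_left ht.2)
      rw [hq]
      exact hp
    · rintro ⟨F, h₁, hF, h₂⟩
      refine ⟨F, h₁, _, ?_, Set.disjoint_sdiff_right, (Set.union_sdiff_cancel hF).symm⟩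
      rintro ⟨u, p | p, w⟩ ht
      · simpa [OpenStep] using h₂ _ ht
      · exact ⟨p, h₂ _ ht, rfl⟩
  | some Q =>
    simp only [ShEx.sem, Set.mem_ofPred_eq]
    refine and_congr_right fun _ => ?_
    constructor
    · rintro ⟨_, ⟨F₁, h₁, F₂, h₂, -, rfl⟩, F₃, h₃, -, e⟩
      refine ⟨F₁, h₁, fun t ht => e.ge (Or.inl (Or.inl ht)), fun t ht => ?_⟩
      rcases e.le ht.1 with (h | h) | h
      · exact absurd h ht.2
      · obtain ⟨p, hp, hq⟩ := h₂ t h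
        rw [hq]
        exact hp
      · obtain ⟨p, hp, hq⟩ := h₃ t h
        rw [hq]
        exact ⟨Q, rfl, hp⟩
    · rintro ⟨F, h₁, hF, h₂⟩
      refine ⟨F ∪ {t ∈ G.neigh v \ F | ∃ p, p ∉ R ∧ t.2.1 = Step.bwd p}, ⟨F, h₁, _,
        fun t ht => ht.2, Set.disjoint_sdiff_right.mono_right (Set.sep_subset _ _), rfl⟩,
        {t ∈ G.neigh v \ F | ∃ p, p ∉ Q ∧ t.2.1 = Step.fwd p}, fun t ht => ht.2, ?_, ?_⟩
      · refine Set.disjoint_union_left.2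
          ⟨Set.disjoint_sdiff_right.mono_right (Set.sep_subset _ _), Set.disjoint_left.2 ?_⟩
        rintro t ⟨_, p, _, hp⟩ ⟨_, p', _, hp'⟩
        rw [hp] at hp'
        cases hp'
      · rw [Set.union_assoc, ← Set.sep_or]
        refine (Set.union_sdiff_cancel hF).symm.trans (congrArg (F ∪ ·) ?_)
        refine (Set.sep_eq_self_iff_mem_true.2 fun t ht => ?_).symm
        have h := h₂ t ht
        obtain ⟨u, p | p, w⟩ := t
        · exact Or.inr ⟨p, by simpa [OpenStep] using h, rfl⟩
        · exact Or.inl ⟨p, h, rfl⟩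

/-- The edges of a graph and their inverses. -/
def Graph.allEdges (G : Graph I L B) : Set (Node I L B × Step I × Node I L B) :=
  {t | t.2.1.rel G t.1 t.2.2}

theorem Graph.neigh_subset (G : Graph I L B) (v : Node I L B) : G.neigh v ⊆ G.allEdges := by
  rintro ⟨u, q, w⟩ ⟨rfl, h⟩
  exact h

section

variable [Encodable I]

mutual

/-- The translation of Restricted ShEx shapes to Restricted SHACL, which replaces a name `s` by the
shape `σ s`. -/
def ShEx.toSHACL (σ : M → SHACL I L V M') : ShEx I L V M → SHACL I L V M'
  | .test c => .test c
  | .testType t => .testType t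
  | .name s => σ s
  | .neigh f R Q => neighShape (f.alternatives σ) R Q
  | .and φ ψ => .and (φ.toSHACL σ) (ψ.toSHACL σ)
  | .or φ ψ => .or (φ.toSHACL σ) (ψ.toSHACL σ)
  | .not φ => .not (φ.toSHACL σ)

/-- The disjunctive normal form of a triple expression. An alternative `(A, b)` stands for
`a₁; …; aₖ; (b₁ | … | bₘ)*`. -/
def ShExTriple.alternatives (σ : M → SHACL I L V M') : ShExTriple I L V M →
    List (List (Step I × SHACL I L V M') × List (Step I × SHACL I L V M'))
  | .basic a => (a.choices σ).map fun A => (A, [])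
  | .star a => [([], (a.choices σ).flatten)]
  | .each f g => (f.alternatives σ).flatMap fun x =>
      (g.alternatives σ).map fun y => (x.1 ++ y.1, x.2 ++ y.2)
  | .alt f g => f.alternatives σ ++ g.alternatives σ

/-- The members of the disjunction, as lists of length zero (for `ε`) or one. -/
def ShExBasic.choices (σ : M → SHACL I L V M') : ShExBasic I L V M →
    List (List (Step I × SHACL I L V M'))
  | .eps => [[]]
  | .edge q φ => [[(q, φ.toSHACL σ)]]
  | .alt a b => a.choices σ ++ b.choices σ

end

theorem mem_altEdges_basic {T : Type} {l : List (List T)} {e : T} :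
    e ∈ altEdges (l.map fun A => (A, [])) ↔ ∃ A ∈ l, e ∈ A := by
  simp [altEdges]

theorem mem_altEdges_star {T : Type} {l : List (List T)} {e : T} :
    e ∈ altEdges [([], l.flatten)] ↔ ∃ A ∈ l, e ∈ A := by
  simp [altEdges]

theorem mem_altEdges_append {T : Type} {l l' : List (List T × List T)} {e : T} :
    e ∈ altEdges (l ++ l') ↔ e ∈ altEdges l ∨ e ∈ altEdges l' := by
  simp [altEdges]

theorem mem_altEdges_prod {T : Type} {l l' : List (List T × List T)} {e : T} (hl : l ≠ [])
    (hl' : l' ≠ []) :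
    e ∈ altEdges (l.flatMap fun x => l'.map fun y => (x.1 ++ y.1, x.2 ++ y.2)) ↔
      e ∈ altEdges l ∨ e ∈ altEdges l' := by
  obtain ⟨x₀, hx₀⟩ := List.exists_mem_of_ne_nil l hl
  obtain ⟨y₀, hy₀⟩ := List.exists_mem_of_ne_nil l' hl'
  simp only [mem_altEdges, List.mem_flatMap, List.mem_map]
  constructor
  · rintro ⟨_, ⟨x, hx, y, hy, rfl⟩, h⟩
    have : e ∈ x.1 ++ x.2 ∨ e ∈ y.1 ++ y.2 := by
      simp only [List.mem_append] at h ⊢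
      tauto
    exact this.imp (fun h => ⟨x, hx, h⟩) fun h => ⟨y, hy, h⟩
  · rintro (⟨x, hx, h⟩ | ⟨y, hy, h⟩)
    · refine ⟨_, ⟨x, hx, y₀, hy₀, rfl⟩, ?_⟩
      simp only [List.mem_append] at h ⊢
      tauto
    · refine ⟨_, ⟨x₀, hx₀, y, hy, rfl⟩, ?_⟩
      simp only [List.mem_append] at h ⊢
      tauto

theorem ShExBasic.choices_ne_nil (σ : M → SHACL I L V M') :
    ∀ a : ShExBasic I L V M, a.choices σ ≠ []
  | .eps => by simp [choices]
  | .edge _ _ => by simp [choices]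
  | .alt a b => by simp [choices, choices_ne_nil σ a]

/-- Without an alternative for one of two operands, the normal form of `f; g` would lose the constants
of the other one. -/
theorem ShExTriple.alternatives_ne_nil (σ : M → SHACL I L V M') :
    ∀ f : ShExTriple I L V M, f.alternatives σ ≠ []
  | .basic a => by simp [alternatives, ShExBasic.choices_ne_nil]
  | .star a => by simp [alternatives]
  | .each f g => by
    obtain ⟨x₀, hx₀⟩ := List.exists_mem_of_ne_nil _ (alternatives_ne_nil σ f)
    have := alternatives_ne_nil σ g
    simp only [alternatives, ne_eq, List.flatMap_eq_nil_iff, List.map_eq_nil_iff, not_forall]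
    exact ⟨x₀, hx₀, this⟩
  | .alt f g => by simp [alternatives, alternatives_ne_nil σ f]

theorem ShExBasic.choices_length (σ : M → SHACL I L V M') :
    ∀ (a : ShExBasic I L V M), ∀ A ∈ a.choices σ, A = [] ∨ ∃ e, A = [e]
  | .eps, A, h => Or.inl (by simpa [choices] using h)
  | .edge q φ, A, h => Or.inr ⟨_, by simpa [choices] using h⟩
  | .alt a b, A, h => by
    simp only [choices, List.mem_append] at h
    exact h.elim (choices_length σ a A) (choices_length σ b A)

mutual

theorem ShEx.names_toSHACL (σ : M → SHACL I L V M') : ∀ φ : ShEx I L V M,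
    ∀ t ∈ (φ.toSHACL σ).names, ∃ s ∈ φ.names, t ∈ (σ s).names
  | .test _, t, h | .testType _, t, h => by cases h
  | .name s, t, h => ⟨s, rfl, h⟩
  | .neigh f R Q, t, h => by
    obtain ⟨e, he, h⟩ := names_neighShape h
    exact ShExTriple.names_alternatives σ f e he t h
  | .and φ ψ, t, h | .or φ ψ, t, h => by
    rcases h with h | h
    · obtain ⟨s, hs, h⟩ := ShEx.names_toSHACL σ φ t h
      exact ⟨s, Or.inl hs, h⟩
    · obtain ⟨s, hs, h⟩ := ShEx.names_toSHACL σ ψ t h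
      exact ⟨s, Or.inr hs, h⟩
  | .not φ, t, h => ShEx.names_toSHACL σ φ t h

theorem ShExTriple.names_alternatives (σ : M → SHACL I L V M') : ∀ f : ShExTriple I L V M,
    ∀ e ∈ altEdges (f.alternatives σ), ∀ t ∈ e.2.names, ∃ s ∈ f.names, t ∈ (σ s).names
  | .basic a, e, he, t, h => by
    obtain ⟨A, hA, he⟩ := mem_altEdges_basic.1 he
    exact ShExBasic.names_choices σ a A hA e he t h
  | .star a, e, he, t, h => by
    obtain ⟨A, hA, he⟩ := mem_altEdges_star.1 he
    exact ShExBasic.names_choices σ a A hA e he t h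
  | .each f g, e, he, t, h => by
    rcases (mem_altEdges_prod (ShExTriple.alternatives_ne_nil σ f) (ShExTriple.alternatives_ne_nil σ g)).1 he with he | he
    · obtain ⟨s, hs, h⟩ := ShExTriple.names_alternatives σ f e he t h
      exact ⟨s, Or.inl hs, h⟩
    · obtain ⟨s, hs, h⟩ := ShExTriple.names_alternatives σ g e he t h
      exact ⟨s, Or.inr hs, h⟩
  | .alt f g, e, he, t, h => by
    rcases mem_altEdges_append.1 he with he | he
    · obtain ⟨s, hs, h⟩ := ShExTriple.names_alternatives σ f e he t h
      exact ⟨s, Or.inl hs, h⟩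
    · obtain ⟨s, hs, h⟩ := ShExTriple.names_alternatives σ g e he t h
      exact ⟨s, Or.inr hs, h⟩

theorem ShExBasic.names_choices (σ : M → SHACL I L V M') : ∀ a : ShExBasic I L V M,
    ∀ A ∈ a.choices σ, ∀ e ∈ A, ∀ t ∈ e.2.names, ∃ s ∈ a.names, t ∈ (σ s).names
  | .eps, A, hA, e, he, t, h => by
    obtain rfl : A = [] := by simpa [ShExBasic.choices] using hA
    cases he
  | .edge q φ, A, hA, e, he, t, h => by
    obtain rfl : A = [(q, φ.toSHACL σ)] := by simpa [ShExBasic.choices] using hA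
    obtain rfl : e = (q, φ.toSHACL σ) := by simpa using he
    exact ShEx.names_toSHACL σ φ t h
  | .alt a b, A, hA, e, he, t, h => by
    simp only [ShExBasic.choices, List.mem_append] at hA
    rcases hA with hA | hA
    · obtain ⟨s, hs, h⟩ := ShExBasic.names_choices σ a A hA e he t h
      exact ⟨s, Or.inl hs, h⟩
    · obtain ⟨s, hs, h⟩ := ShExBasic.names_choices σ b A hA e he t h
      exact ⟨s, Or.inr hs, h⟩

end

section

variable (σ : M → SHACL I L V M') (hσ : ∀ s, (σ s).consts = ∅)

include hσ

mutual

theorem ShEx.consts_toSHACL : ∀ φ : ShEx I L V M, (φ.toSHACL σ).consts = φ.consts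
  | .test _ | .testType _ => rfl
  | .name s => hσ s
  | .neigh f R Q => Set.ext fun c =>
    mem_consts_neighShape.trans (ShExTriple.consts_alternatives f c)
  | .and φ ψ | .or φ ψ => congrArg₂ _ (ShEx.consts_toSHACL φ) (ShEx.consts_toSHACL ψ)
  | .not φ => ShEx.consts_toSHACL φ

theorem ShExTriple.consts_alternatives : ∀ (f : ShExTriple I L V M) (c : Const I L),
    (∃ e ∈ altEdges (f.alternatives σ), c ∈ e.2.consts) ↔ c ∈ f.consts
  | .basic a, c => by
    simp only [ShExTriple.alternatives, mem_altEdges_basic]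
    exact ShExBasic.consts_choices a c
  | .star a, c => by
    simp only [ShExTriple.alternatives, mem_altEdges_star]
    exact ShExBasic.consts_choices a c
  | .each f g, c => by
    simp only [ShExTriple.alternatives, mem_altEdges_prod (ShExTriple.alternatives_ne_nil σ f)
      (ShExTriple.alternatives_ne_nil σ g), or_and_right, exists_or]
    exact or_congr (ShExTriple.consts_alternatives f c) (ShExTriple.consts_alternatives g c)
  | .alt f g, c => by
    simp only [ShExTriple.alternatives, mem_altEdges_append, or_and_right, exists_or]
    exact or_congr (ShExTriple.consts_alternatives f c) (ShExTriple.consts_alternatives g c)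

theorem ShExBasic.consts_choices : ∀ (a : ShExBasic I L V M) (c : Const I L),
    (∃ e, (∃ A ∈ a.choices σ, e ∈ A) ∧ c ∈ e.2.consts) ↔ c ∈ a.consts
  | .eps, c => by simp [ShExBasic.choices, ShExBasic.consts]
  | .edge q φ, c => by
    simp [ShExBasic.choices, ShExBasic.consts, ShEx.consts_toSHACL φ]
  | .alt a b, c => by
    simp only [ShExBasic.choices, List.mem_append, or_and_right, exists_or]
    exact or_congr (ShExBasic.consts_choices a c) (ShExBasic.consts_choices b c)

end

end

section

variable (σ : M → SHACL I L V M') {r : M → ℕ} {r' : M' → ℕ} {i i' : ℕ}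
  (h₁ : ∀ s, r s ≤ i → (σ s).Admissible r' i' false)
  (h₂ : ∀ s, r s < i → ∀ t ∈ (σ s).names, r' t < i')

include h₁ h₂

mutual

/-- If the shapes substituted for names are negations of names of corresponding strata, then the
translation exchanges the two kinds of admissibility. -/
theorem ShEx.admissible_toSHACL : ∀ (φ : ShEx I L V M) (b : Bool),
    φ.Admissible r i b → (φ.toSHACL σ).Admissible r' i' (!b)
  | .test _, b, h | .testType _, b, h => trivial
  | .name s, true, h => h₁ s h
  | .name s, false, h => SHACL.admissible_of_names_lt _ _ (h₂ s h)
  | .neigh f R Q, true, h => admissible_neighShape (ShExTriple.admissible_alternatives f h)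
  | .neigh f R Q, false, h => by
    refine admissible_neighShape fun e he => SHACL.admissible_of_names_lt _ _ fun t ht => ?_
    obtain ⟨s, hs, ht⟩ := ShExTriple.names_alternatives σ f e he t ht
    exact h₂ s (h s hs) t ht
  | .and φ ψ, b, h | .or φ ψ, b, h =>
    ⟨ShEx.admissible_toSHACL φ b h.1, ShEx.admissible_toSHACL ψ b h.2⟩
  | .not φ, b, h => ShEx.admissible_toSHACL φ (!b) h

theorem ShExTriple.admissible_alternatives : ∀ f : ShExTriple I L V M, f.Admissible r i →
    ∀ e ∈ altEdges (f.alternatives σ), e.2.Admissible r' i' false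
  | .basic a, h, e, he => by
    obtain ⟨A, hA, he⟩ := mem_altEdges_basic.1 he
    exact ShExBasic.admissible_choices a h A hA e he
  | .star a, h, e, he => by
    obtain ⟨A, hA, he⟩ := mem_altEdges_star.1 he
    exact ShExBasic.admissible_choices a h A hA e he
  | .each f g, h, e, he => by
    rcases (mem_altEdges_prod (ShExTriple.alternatives_ne_nil σ f) (ShExTriple.alternatives_ne_nil σ g)).1 he with he | he
    · exact ShExTriple.admissible_alternatives f h.1 e he
    · exact ShExTriple.admissible_alternatives g h.2 e he
  | .alt f g, h, e, he => by
    rcases mem_altEdges_append.1 he with he | he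
    · exact ShExTriple.admissible_alternatives f h.1 e he
    · exact ShExTriple.admissible_alternatives g h.2 e he

theorem ShExBasic.admissible_choices : ∀ a : ShExBasic I L V M, a.Admissible r i →
    ∀ A ∈ a.choices σ, ∀ e ∈ A, e.2.Admissible r' i' false
  | .eps, h, A, hA, e, he => by
    obtain rfl : A = [] := by simpa [ShExBasic.choices] using hA
    cases he
  | .edge q φ, h, A, hA, e, he => by
    obtain rfl : A = [(q, φ.toSHACL σ)] := by simpa [ShExBasic.choices] using hA
    obtain rfl : e = (q, φ.toSHACL σ) := by simpa using he
    exact ShEx.admissible_toSHACL φ true h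
  | .alt a b, h, A, hA, e, he => by
    simp only [ShExBasic.choices, List.mem_append] at hA
    rcases hA with hA | hA
    · exact ShExBasic.admissible_choices a h.1 A hA e he
    · exact ShExBasic.admissible_choices b h.2 A hA e he

end

end

theorem matching_or {X T : Type} {sat : T → X → Prop} {P P' : X → Prop} {A : List T} {F : Set X} :
    Matching sat (fun x => P x ∨ P' x) A F ↔
      ∃ F₁ F₂, Disjoint F₁ F₂ ∧ F = F₁ ∪ F₂ ∧ Matching sat P A F₁ ∧ ∀ x ∈ F₂, P' x := by
  simpa [Matching] using matching_append (sat := sat) (P := P) (P' := P') (A := A) (A' := [])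

theorem Matching.sat_or {X T : Type} {sat : T → X → Prop} {P : X → Prop} {A : List T} {F : Set X}
    (h : Matching sat P A F) {x : X} (hx : x ∈ F) : P x ∨ ∃ a ∈ A, sat a x := by
  induction A generalizing F with
  | nil => exact Or.inl (h x hx)
  | cons a A ih =>
    obtain ⟨y, hy, ha, h⟩ := h
    rcases eq_or_ne x y with rfl | hne
    · exact Or.inr ⟨a, List.mem_cons_self, ha⟩
    · exact (ih h ⟨hx, hne⟩).imp_right fun ⟨b, hb, hbx⟩ => ⟨b, List.mem_cons_of_mem _ hb, hbx⟩

section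

variable {val : V → Set (Node I L B)} {D : Set (Node I L B)} {G : Graph I L B}
  {α : M → Set (Node I L B)} {α' : M' → Set (Node I L B)} {σ : M → SHACL I L V M'}
  (hD : G.nodes ⊆ D) (hσ : ∀ s, (σ s).sem val D G α' = α s)

include hD hσ

mutual

/-- The translation preserves the meaning of shapes, if it replaces names by shapes of the same
meaning. -/
theorem ShEx.sem_toSHACL : ∀ φ : ShEx I L V M,
    (φ.toSHACL σ).sem val D G α' = φ.sem val D G α
  | .test _ | .testType _ => by simp [ShEx.toSHACL, SHACL.sem, ShEx.sem]
  | .name s => by simp [ShEx.toSHACL, hσ, ShEx.sem]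
  | .neigh f R Q => by
    ext v
    simp only [ShEx.toSHACL, ShEx.mem_sem_neigh, mem_sem_neighShape hD, matching_or]
    refine and_congr_right fun _ => ?_
    constructor
    · rintro ⟨x, hx, F₁, F₂, hd, e, h₁, h₂⟩
      have hF : F₁ ⊆ G.neigh v := Set.subset_union_left.trans e.ge
      refine ⟨F₁, (ShExTriple.mem_sem_iff f (hF.trans (G.neigh_subset v))).2 ⟨x, hx, h₁⟩, hF, ?_⟩
      exact fun t ht => h₂ t ((e.le ht.1).resolve_left ht.2)
    · rintro ⟨F, h₁, hF, h₂⟩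
      obtain ⟨x, hx, h₁⟩ := (ShExTriple.mem_sem_iff f (hF.trans (G.neigh_subset v))).1 h₁
      exact ⟨x, hx, F, _, Set.disjoint_sdiff_right, (Set.union_sdiff_cancel hF).symm, h₁, h₂⟩
  | .and φ ψ | .or φ ψ => by
    simp [ShEx.toSHACL, SHACL.sem, ShEx.sem, ShEx.sem_toSHACL φ, ShEx.sem_toSHACL ψ]
  | .not φ => by simp [ShEx.toSHACL, SHACL.sem, ShEx.sem, ShEx.sem_toSHACL φ]

/-- The sets of edges matched by a triple expression are those matched by an alternative of its
normal form. -/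
theorem ShExTriple.mem_sem_iff : ∀ (f : ShExTriple I L V M)
    {F : Set (Node I L B × Step I × Node I L B)}, F ⊆ G.allEdges →
    (F ∈ f.sem val D G α ↔ ∃ x ∈ f.alternatives σ, Matching (EdgeSat val D G α')
      (fun t => ∃ e ∈ x.2, EdgeSat val D G α' e t) x.1 F)
  | .basic a, F, hF => by
    simp only [ShExTriple.sem, ShExTriple.alternatives, List.mem_map, exists_exists_and_eq_and,
      ShExBasic.mem_sem_iff a hF, List.not_mem_nil, false_and, exists_false]
  | .star a, F, hF => by
    simp only [ShExTriple.sem, ShExTriple.alternatives, List.mem_singleton, exists_eq_left,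
      List.mem_flatten]
    constructor
    · rintro ⟨P, hP, _, rfl⟩ t ⟨E, hE, ht⟩
      obtain ⟨A, hA, h⟩ := (ShExBasic.mem_sem_iff a
        ((Set.subset_sUnion_of_mem hE).trans hF)).1 (hP hE)
      obtain ⟨e, he, h⟩ := (h.sat_or ht).resolve_left id
      exact ⟨e, ⟨A, hA, he⟩, h⟩
    · intro h
      refine ⟨(fun t => {t}) '' F, ?_, ?_, ?_⟩
      · rintro _ ⟨t, ht, rfl⟩
        obtain ⟨e, ⟨A, hA, he⟩, hs⟩ := h t ht
        refine (ShExBasic.mem_sem_iff a (Set.singleton_subset_iff.2 (hF ht))).2 ⟨A, hA, ?_⟩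
        obtain rfl | ⟨e', rfl⟩ := a.choices_length σ A hA
        · cases he
        · obtain rfl := List.mem_singleton.1 he
          exact ⟨t, rfl, hs, fun t' ht' => ht'.2 ht'.1⟩
      · rintro _ ⟨t, _, rfl⟩ _ ⟨t', _, rfl⟩ hne
        exact Set.disjoint_singleton.2 fun h => hne (by rw [h])
      · simp
  | .each f g, F, hF => by
    simp only [ShExTriple.sem, ShExTriple.alternatives]
    constructor
    · rintro ⟨F₁, h₁, F₂, h₂, hd, rfl⟩
      obtain ⟨x, hx, h₁⟩ := (ShExTriple.mem_sem_iff f (Set.subset_union_left.trans hF)).1 h₁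
      obtain ⟨y, hy, h₂⟩ := (ShExTriple.mem_sem_iff g (Set.subset_union_right.trans hF)).1 h₂
      refine ⟨_, List.mem_flatMap.2 ⟨x, hx, List.mem_map_of_mem hy⟩, ?_⟩
      simp only [List.mem_append, or_and_right, exists_or]
      exact matching_append.2 ⟨F₁, F₂, hd, rfl, h₁, h₂⟩
    · rintro ⟨_, h, hm⟩
      obtain ⟨x, hx, h⟩ := List.mem_flatMap.1 h
      obtain ⟨y, hy, rfl⟩ := List.mem_map.1 h
      simp only [List.mem_append, or_and_right, exists_or] at hm
      obtain ⟨F₁, F₂, hd, rfl, h₁, h₂⟩ := matching_append.1 hm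
      exact ⟨F₁, (ShExTriple.mem_sem_iff f (Set.subset_union_left.trans hF)).2 ⟨x, hx, h₁⟩, F₂,
        (ShExTriple.mem_sem_iff g (Set.subset_union_right.trans hF)).2 ⟨y, hy, h₂⟩, hd, rfl⟩
  | .alt f g, F, hF => by
    simp only [ShExTriple.sem, ShExTriple.alternatives, Set.mem_union, List.mem_append,
      or_and_right, exists_or, ShExTriple.mem_sem_iff f hF, ShExTriple.mem_sem_iff g hF]

theorem ShExBasic.mem_sem_iff : ∀ (a : ShExBasic I L V M)
    {F : Set (Node I L B × Step I × Node I L B)}, F ⊆ G.allEdges →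
    (F ∈ a.sem val D G α ↔ ∃ A ∈ a.choices σ, Matching (EdgeSat val D G α') (fun _ => False) A F)
  | .eps, F, hF => by
    simp [ShExBasic.sem, ShExBasic.choices, Matching, Set.eq_empty_iff_forall_notMem]
  | .edge q φ, F, hF => by
    simp only [ShExBasic.sem, ShExBasic.choices, List.mem_singleton, exists_eq_left, Matching,
      EdgeSat, ShEx.sem_toSHACL φ]
    constructor
    · rintro ⟨u, w, hw, _, rfl⟩
      exact ⟨_, rfl, ⟨rfl, hw⟩, fun t ht => ht.2 ht.1⟩
    · rintro ⟨⟨u, q', w⟩, ht, ⟨rfl, hw⟩, h⟩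
      refine ⟨u, w, hw, hF ht, Set.eq_singleton_iff_unique_mem.2 ⟨ht, fun t' ht' => ?_⟩⟩
      by_contra hne
      exact h t' ⟨ht', hne⟩
  | .alt a b, F, hF => by
    simp only [ShExBasic.sem, ShExBasic.choices, Set.mem_union, List.mem_append, or_and_right,
      exists_or, ShExBasic.mem_sem_iff a hF, ShExBasic.mem_sem_iff b hF]

end

end

end

theorem ShapeLanguage.Lawful.sem_congr {𝓛 : ShapeLanguage I L B} (h𝓛 : 𝓛.Lawful)
    {D : Set (Node I L B)} {G : Graph I L B} {α β : M → Set (Node I L B)} (φ : 𝓛.Shape M)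
    (h : ∀ t ∈ 𝓛.names φ, α t = β t) : 𝓛.sem D G α φ = 𝓛.sem D G β φ := by
  have hφ : 𝓛.Admissible (fun _ => 0) 1 φ := h𝓛.admissible_of_names_lt φ fun _ _ => Nat.one_pos
  exact (h𝓛.sem_mono φ hφ (fun t ht _ => h t ht) fun t ht _ => (h t ht).le).antisymm
    (h𝓛.sem_mono φ hφ (fun t ht _ => (h t ht).symm) fun t ht _ => (h t ht).ge)

namespace Schema

theorem subset_domain_of_fixed {G : Graph I L B} {α : N → Set (Node I L B)}
    {𝓛 : ShapeLanguage I L B} {S : Schema 𝓛 N} (h𝓛 : 𝓛.Lawful)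
    (hα : S.cat.op (S.domain G) G α = α) (s : N) : α s ⊆ S.domain G := by
  rw [← hα]
  exact Catalogue.op_subset h𝓛 (fun d hd c hc => mem_domain_of_cat hd hc) s

end Schema

/-! ### From Restricted ShEx to Restricted SHACL: schemas -/

section

variable [Denumerable N]

/-- The name whose number is twice that of `s`. In the translation of a ShEx schema it stands for
the complement of `s`. -/
def dbl (s : N) : N := Denumerable.ofNat N (2 * Encodable.encode s)

/-- The name whose number is one more than twice that of `s`. In the translation of a ShEx schema it
stands for `s`. -/
def dblSucc (s : N) : N := Denumerable.ofNat N (2 * Encodable.encode s + 1)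

theorem encode_dbl (s : N) : Encodable.encode (dbl s) = 2 * Encodable.encode s := by
  simp [dbl]

theorem encode_dblSucc (s : N) : Encodable.encode (dblSucc s) = 2 * Encodable.encode s + 1 := by
  simp [dblSucc]

theorem dbl_inj {s t : N} : dbl s = dbl t ↔ s = t := by
  rw [← Encodable.encode_inj, encode_dbl, encode_dbl, ← Encodable.encode_inj (a := s)]
  omega

theorem dblSucc_inj {s t : N} : dblSucc s = dblSucc t ↔ s = t := by
  rw [← Encodable.encode_inj, encode_dblSucc, encode_dblSucc, ← Encodable.encode_inj (a := s)]
  omega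

theorem dbl_ne_dblSucc {s t : N} : dbl s ≠ dblSucc t := by
  rw [ne_eq, ← Encodable.encode_inj, encode_dbl, encode_dblSucc]
  omega

/-- The name from which `n` is obtained by `dbl` or `dblSucc`. -/
def halve (n : N) : N := Denumerable.ofNat N (Encodable.encode n / 2)

theorem halve_dbl (s : N) : halve (dbl s) = s := by
  rw [halve, encode_dbl, Nat.mul_div_cancel_left _ two_pos, Denumerable.ofNat_encode]

theorem halve_dblSucc (s : N) : halve (dblSucc s) = s := by
  rw [halve, encode_dblSucc, show (2 * Encodable.encode s + 1) / 2 = Encodable.encode s by omega,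
    Denumerable.ofNat_encode]

theorem eq_dbl_or_dblSucc (n : N) : n = dbl (halve n) ∨ n = dblSucc (halve n) := by
  simp only [← Encodable.encode_inj (a := n), encode_dbl, encode_dblSucc, halve,
    Denumerable.encode_ofNat]
  omega

variable [Encodable I] [Encodable L] [Encodable V] {val : V → Set (Node I L B)}

/-- The translation of a declaration `s : φ`: the negation of `φ`, with `s` replaced by `¬ dbl s`,
declares `dbl s`; the name `dblSucc s`, to be used by selectors, is declared as `¬ dbl s`. -/
def shexDecl (d : N × ShEx I L V N) : List (N × SHACL I L V N) :=
  [(dbl d.1, .not (d.2.toSHACL fun s => .not (.name (dbl s)))),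
    (dblSucc d.1, .not (.name (dbl d.1)))]

/-- The translation of ShEx schemas to SHACL schemas. A selector `s : τ` becomes one for `dblSucc s`. -/
def Schema.toSHACL (S : Schema (restrictedShEx val) N) : Schema (restrictedSHACL val) N where
  cat := S.cat.flatMap shexDecl
  nodup := by
    have h := S.nodup
    rw [List.map_flatMap]
    refine List.nodup_flatMap.2 ⟨fun d _ => ?_, ?_⟩
    · simp [shexDecl, dbl_ne_dblSucc]
    · refine (List.pairwise_map.1 h).imp fun hne => ?_
      simp [shexDecl, Function.onFun, dbl_inj, dblSucc_inj, dbl_ne_dblSucc, dbl_ne_dblSucc.symm, hne.symm]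
  declared := by
    have hdom : ∀ s ∈ Catalogue.dom (𝓛 := restrictedShEx val) S.cat,
        ∃ ψ, (dbl s, ψ) ∈ S.cat.flatMap shexDecl := by
      rintro s ⟨φ, hφ⟩
      exact ⟨_, List.mem_flatMap.2 ⟨_, hφ, List.mem_cons_self⟩⟩
    intro d hd t ht
    obtain ⟨⟨s, φ⟩, hs, hd⟩ := List.mem_flatMap.1 hd
    simp only [shexDecl, List.mem_cons, List.not_mem_nil, or_false] at hd
    rcases hd with rfl | rfl
    · obtain ⟨u, hu, ht⟩ := ShEx.names_toSHACL _ φ t ht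
      obtain rfl : t = dbl u := ht
      exact hdom u (S.declared _ hs u hu)
    · obtain rfl : t = dbl s := ht
      exact hdom s ⟨φ, hs⟩
  sel := S.sel.map fun d => (dblSucc d.1, ShEx.toSHACL Empty.elim d.2)
  sel_declared := by
    intro d hd
    obtain ⟨d', hd', rfl⟩ := List.mem_map.1 hd
    obtain ⟨φ, hφ⟩ := S.sel_declared d' hd'
    exact ⟨_, List.mem_flatMap.2 ⟨_, hφ, List.mem_cons_of_mem _ List.mem_cons_self⟩⟩

namespace Schema

variable {S : Schema (restrictedShEx val) N} {G : Graph I L B} {r : N → ℕ}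

theorem mem_toSHACL_dbl {s : N} {ψ : SHACL I L V N} : (dbl s, ψ) ∈ S.toSHACL.cat ↔
    ∃ φ, (s, φ) ∈ S.cat ∧ ψ = .not (ShEx.toSHACL (fun s => .not (.name (dbl s))) φ) := by
  constructor
  · intro h
    obtain ⟨⟨t, φ⟩, ht, hd⟩ := List.mem_flatMap.1 h
    simp only [shexDecl, List.mem_cons, List.not_mem_nil, or_false, Prod.mk.injEq,
      dbl_ne_dblSucc, false_and, dbl_inj] at hd
    obtain ⟨rfl, rfl⟩ := hd
    exact ⟨φ, ht, rfl⟩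
  · rintro ⟨φ, hφ, rfl⟩
    exact List.mem_flatMap.2 ⟨_, hφ, List.mem_cons_self⟩

theorem mem_toSHACL_dblSucc {s : N} {ψ : SHACL I L V N} : (dblSucc s, ψ) ∈ S.toSHACL.cat ↔
    (∃ φ, (s, φ) ∈ S.cat) ∧ ψ = .not (.name (dbl s)) := by
  constructor
  · intro h
    obtain ⟨⟨t, φ⟩, ht, hd⟩ := List.mem_flatMap.1 h
    simp only [shexDecl, List.mem_cons, List.not_mem_nil, or_false, Prod.mk.injEq,
      dbl_ne_dblSucc.symm, false_and, false_or, dblSucc_inj] at hd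
    obtain ⟨rfl, rfl⟩ := hd
    exact ⟨⟨φ, ht⟩, rfl⟩
  · rintro ⟨⟨φ, hφ⟩, rfl⟩
    exact List.mem_flatMap.2 ⟨_, hφ, List.mem_cons_of_mem _ List.mem_cons_self⟩

theorem toSHACL_consts : S.toSHACL.consts = S.consts := by
  ext c
  refine or_congr ⟨?_, ?_⟩ ⟨?_, ?_⟩
  · rintro ⟨d, hd, hc⟩
    obtain ⟨⟨s, φ⟩, hs, hd⟩ := List.mem_flatMap.1 hd
    simp only [shexDecl, List.mem_cons, List.not_mem_nil, or_false] at hd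
    rcases hd with rfl | rfl
    · exact ⟨_, hs, (ShEx.consts_toSHACL (fun s => .not (.name (dbl s))) (fun _ => rfl) φ).le hc⟩
    · cases hc
  · rintro ⟨⟨s, φ⟩, hs, hc⟩
    exact ⟨_, mem_toSHACL_dbl.2 ⟨φ, hs, rfl⟩,
      (ShEx.consts_toSHACL (fun s => .not (.name (dbl s))) (fun _ => rfl) φ).ge hc⟩
  · rintro ⟨d, hd, hc⟩
    obtain ⟨d', hd', rfl⟩ := List.mem_map.1 hd
    exact ⟨d', hd', (ShEx.consts_toSHACL Empty.elim (fun x => x.elim) d'.2).le hc⟩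
  · rintro ⟨d, hd, hc⟩
    exact ⟨_, List.mem_map_of_mem hd, (ShEx.consts_toSHACL Empty.elim (fun x => x.elim) d.2).ge hc⟩

theorem toSHACL_domain : S.toSHACL.domain G = S.domain G := by
  rw [domain, toSHACL_consts, domain]

/-- The strata of the translation: the negation of `dbl s` is one stratum higher. -/
def toSHACLStrat (r : N → ℕ) (n : N) : ℕ := 2 * r (halve n) + Encodable.encode n % 2

theorem toSHACLStrat_dbl (s : N) : toSHACLStrat r (dbl s) = 2 * r s := by
  rw [toSHACLStrat, halve_dbl, encode_dbl]
  omega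

theorem toSHACLStrat_dblSucc (s : N) : toSHACLStrat r (dblSucc s) = 2 * r s + 1 := by
  rw [toSHACLStrat, halve_dblSucc, encode_dblSucc]
  omega

theorem toSHACL_isStratification (hr : S.cat.IsStratification r) :
    S.toSHACL.cat.IsStratification (toSHACLStrat r) := by
  intro d hd
  obtain ⟨⟨s, φ⟩, hs, hd⟩ := List.mem_flatMap.1 hd
  simp only [shexDecl, List.mem_cons, List.not_mem_nil, or_false] at hd
  rcases hd with rfl | rfl
  · refine ShEx.admissible_toSHACL (r := r) (i := r s) _ (fun t ht => ?_) (fun t ht u hu => ?_) φ true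
      (hr _ hs)
    · change toSHACLStrat r (dbl t) ≤ toSHACLStrat r (dbl s)
      rw [toSHACLStrat_dbl, toSHACLStrat_dbl]
      omega
    · obtain rfl : u = dbl t := hu
      change _ < toSHACLStrat r (dbl s)
      rw [toSHACLStrat_dbl, toSHACLStrat_dbl]
      omega
  · change toSHACLStrat r (dbl s) < toSHACLStrat r (dblSucc s)
    rw [toSHACLStrat_dbl, toSHACLStrat_dblSucc]
    omega

/-- The assignment to the names of the translation: `dbl s` is the complement of `s`, and `dblSucc s`
is equivalent to `s`. -/
def toSHACLAssign (S : Schema (restrictedShEx val) N) (G : Graph I L B) (α : N → Set (Node I L B))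
    (n : N) : Set (Node I L B) :=
  {u | halve n ∈ S.cat.dom ∧ u ∈ S.domain G ∧
    (n = dbl (halve n) ∧ u ∉ α (halve n) ∨ n = dblSucc (halve n) ∧ u ∈ α (halve n))}

variable {α : N → Set (Node I L B)}

theorem toSHACLAssign_dbl {s : N} (hs : s ∈ S.cat.dom) :
    toSHACLAssign S G α (dbl s) = S.domain G \ α s := by
  ext u
  simp [toSHACLAssign, halve_dbl, hs, dbl_ne_dblSucc]

theorem toSHACLAssign_dblSucc {s : N} (hs : s ∈ S.cat.dom) (hα : α s ⊆ S.domain G) :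
    toSHACLAssign S G α (dblSucc s) = α s := by
  ext u
  simp only [toSHACLAssign, halve_dblSucc, hs, dbl_ne_dblSucc.symm, Set.mem_ofPred_eq]
  simpa using @hα u

theorem sem_toSHACL_name_dbl (φ : ShEx I L V N) (β : N → Set (Node I L B)) :
    (φ.toSHACL fun s => .not (.name (dbl s))).sem val (S.domain G) G β =
      φ.sem val (S.domain G) G fun s => S.domain G \ β (dbl s) :=
  ShEx.sem_toSHACL (α := fun s => S.domain G \ β (dbl s)) Set.subset_union_left (fun _ => rfl) φ

theorem op_toSHACL_dbl {s : N} {φ : ShEx I L V N} (h : (s, φ) ∈ S.cat)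
    (β : N → Set (Node I L B)) :
    S.toSHACL.cat.op (S.domain G) G β (dbl s) =
      S.domain G \ φ.sem val (S.domain G) G fun s => S.domain G \ β (dbl s) := by
  rw [Catalogue.op_eq (Catalogue.functional_of_nodup S.toSHACL.nodup)
    (mem_toSHACL_dbl.2 ⟨φ, h, rfl⟩)]
  change S.domain G \ _ = _
  rw [sem_toSHACL_name_dbl]
  simp only [Set.sdiff_inter, Set.sdiff_self, Set.union_empty]

theorem op_toSHACL_dblSucc {s : N} (h : s ∈ S.cat.dom) (β : N → Set (Node I L B)) :
    S.toSHACL.cat.op (S.domain G) G β (dblSucc s) = S.domain G \ β (dbl s) := by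
  rw [Catalogue.op_eq (Catalogue.functional_of_nodup S.toSHACL.nodup)
    (mem_toSHACL_dblSucc.2 ⟨h, rfl⟩)]
  change S.domain G \ (_ ∩ _) = _
  simp only [Set.sdiff_inter, Set.sdiff_self, Set.union_empty]

theorem notMem_dom_toSHACL {n : N} (h : halve n ∉ S.cat.dom) : n ∉ S.toSHACL.cat.dom := by
  rintro ⟨ψ, hψ⟩
  rcases eq_dbl_or_dblSucc n with hn | hn <;> rw [hn] at hψ
  · obtain ⟨φ, hφ, _⟩ := mem_toSHACL_dbl.1 hψ
    exact h ⟨φ, hφ⟩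
  · exact h (mem_toSHACL_dblSucc.1 hψ).1

theorem toSHACLAssign_of_notMem {n : N} (h : halve n ∉ S.cat.dom) :
    toSHACLAssign S G α n = ∅ :=
  Set.eq_empty_of_forall_notMem fun _ hu => h hu.1

/-- Complementation turns the greatest fixed points into least ones. -/
theorem toSHACLAssign_iteratedLFP
    (hα : IteratedLFP (P := (Set (Node I L B))ᵒᵈ) (S.cat.op (S.domain G) G) r α) :
    IteratedLFP (S.toSHACL.cat.op (S.domain G) G) (toSHACLStrat r) (toSHACLAssign S G α) := by
  have hlaw := restrictedShEx_lawful val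
  have hfun : S.cat.Functional := Catalogue.functional_of_nodup S.nodup
  have hfix : S.cat.op (S.domain G) G α = α := hα.1
  have hsub : ∀ s, α s ⊆ S.domain G := subset_domain_of_fixed hlaw hfix
  have hempty : ∀ s, s ∉ S.cat.dom → α s = ∅ := fun s hs => by
    rw [← hfix]
    exact Catalogue.op_eq_empty hs
  refine ⟨funext fun n => ?_, fun i β h₁ h₂ n hn => ?_⟩
  · by_cases hd : halve n ∈ S.cat.dom
    · rcases eq_dbl_or_dblSucc n with hn | hn <;> rw [hn]
      · obtain ⟨φ, hφ⟩ := hd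
        rw [op_toSHACL_dbl hφ, toSHACLAssign_dbl ⟨φ, hφ⟩]
        congr 1
        conv_rhs => rw [← hfix, Catalogue.op_eq_of_subset hfun hφ hsub]
        refine hlaw.sem_congr φ fun t ht => ?_
        rw [toSHACLAssign_dbl (S.declared _ hφ t ht), Set.sdiff_sdiff_cancel_left (hsub t)]
      · rw [op_toSHACL_dblSucc hd, toSHACLAssign_dblSucc hd (hsub _), toSHACLAssign_dbl hd,
          Set.sdiff_sdiff_cancel_left (hsub _)]
    · rw [toSHACLAssign_of_notMem hd, Catalogue.op_eq_empty (notMem_dom_toSHACL hd)]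
  · by_cases hd : halve n ∈ S.cat.dom
    swap
    · rw [toSHACLAssign_of_notMem hd]
      exact Set.empty_subset _
    have hpre := h₂ n hn
    rcases eq_dbl_or_dblSucc n with hn' | hn' <;> generalize halve n = s at hd hn' <;> subst hn'
    · rw [toSHACLStrat_dbl] at hn
      let γ : N → Set (Node I L B) := fun t => {u | t ∈ S.cat.dom ∧ u ∈ S.domain G \ β (dbl t)}
      have hγ : ∀ t ∈ S.cat.dom, γ t = S.domain G \ β (dbl t) :=
        fun t ht => Set.ext fun u => and_iff_right ht
      have key : γ s ⊆ α s := by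
        refine hα.2 (r s) γ (fun t ht => ?_) (fun t ht => ?_) s rfl
        · by_cases htd : t ∈ S.cat.dom
          · rw [hγ t htd, h₁ (dbl t) (by rw [toSHACLStrat_dbl]; omega), toSHACLAssign_dbl htd,
              Set.sdiff_sdiff_cancel_left (hsub t)]
          · rw [hempty t htd]
            exact Set.eq_empty_of_forall_notMem fun u hu => htd hu.1
        · rintro u ⟨⟨φ, hφ⟩, hu, hu'⟩
          have hle := h₂ (dbl t) (by rw [toSHACLStrat_dbl]; omega)
          rw [op_toSHACL_dbl hφ] at hle
          rw [Catalogue.op_eq_of_subset hfun hφ fun t u hu => hu.2.1]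
          have hcongr := hlaw.sem_congr (D := S.domain G) (G := G) φ
            fun t ht => hγ t (S.declared _ hφ t ht)
          rw [hcongr]
          by_contra hcon
          exact hu' (hle ⟨hu, hcon⟩)
      rw [hγ s hd] at key
      rw [toSHACLAssign_dbl hd]
      intro u hu
      by_contra hcon
      exact hu.2 (key ⟨hu.1, hcon⟩)
    · rw [toSHACLStrat_dblSucc] at hn
      rw [op_toSHACL_dblSucc hd, h₁ (dbl s) (by rw [toSHACLStrat_dbl]; omega),
        toSHACLAssign_dbl hd, Set.sdiff_sdiff_cancel_left (hsub s)] at hpre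
      rwa [toSHACLAssign_dblSucc hd (hsub s)]

theorem selSem_toSHACL (τ : ShEx I L V Empty) :
    selSem (𝓛 := restrictedSHACL val) (S.domain G) G (τ.toSHACL Empty.elim) =
      selSem (𝓛 := restrictedShEx val) (S.domain G) G τ :=
  ShEx.sem_toSHACL Set.subset_union_left (fun x => x.elim) τ

theorem gfpConforms_iff_toSHACL (hr : S.cat.IsStratification r) :
    S.GFPConforms G ↔ S.toSHACL.LFPConforms G := by
  have hlaw := restrictedShEx_lawful val
  obtain ⟨α, hα⟩ : ∃ α : N → Set (Node I L B),
      IteratedLFP (P := (Set (Node I L B))ᵒᵈ) (S.cat.op (S.domain G) G) r α :=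
    (Catalogue.stratifiedOp_op hlaw hr).dual.exists_iteratedLFP
  have hsub : ∀ s, α s ⊆ S.domain G := subset_domain_of_fixed hlaw hα.1
  have hα' := toSHACLAssign_iteratedLFP hα
  rw [← toSHACL_domain] at hα'
  rw [gfpConforms_iff hlaw hr hα, lfpConforms_iff (restrictedSHACL_lawful val)
    (toSHACL_isStratification hr) hα']
  refine Iff.trans ?_ List.forall_mem_map.symm
  refine forall₂_congr fun d hd => ?_
  rw [toSHACL_domain, selSem_toSHACL]
  simp only [toSHACLAssign_dblSucc (S.sel_declared d hd) (hsub _)]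

end Schema

end

/-! ### Counting in Restricted ShEx -/

namespace ShEx

/-- The shape satisfied by all nodes of the domain. -/
def top : ShEx I L V M := .neigh (.basic .eps) [] (some [])

/-- `a; …; a; b` with `n` occurrences of `a`. -/
def eachPow (n : ℕ) (a b : ShExTriple I L V M) : ShExTriple I L V M := (ShExTriple.each a)^[n] b

/-- At least `n` successors along `q` satisfy `K`. The optional further edge makes the constants of
`K` occur even for `n = 0`. -/
def atLeast (n : ℕ) (q : Step I) (K : ShEx I L V M) : ShEx I L V M :=
  .neigh (eachPow n (.basic (.edge q K)) (.basic (.alt .eps (.edge q K)))) [] (some [])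

/-- The lists `R` and `Q` for which `(¬R⁻)*; (¬Q)*` admits all edges except those along `q`. -/
def allBut : Step I → List I × List I
  | .fwd p => ([], [p])
  | .bwd p => ([p], [])

/-- All successors along `q`, with at most `n` exceptions, satisfy `K`. -/
def atMost (n : ℕ) (q : Step I) (K : ShEx I L V M) : ShEx I L V M :=
  .neigh (eachPow n (.basic (.alt .eps (.edge q top))) (.star (.edge q K))) (allBut q).1
    (some (allBut q).2)

/-- The disjunction of `p.⊤` over the members `p` of a list. -/
def anyOf (Q : List I) : ShExBasic I L V M := Q.foldr (fun p a => .alt (.edge (.fwd p) top) a) .eps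

/-- All outgoing edges have a predicate in `Q`. -/
def closedShape (Q : List I) : ShEx I L V M := .neigh (.star (anyOf Q)) [] none

end ShEx

section

variable {val : V → Set (Node I L B)} {D : Set (Node I L B)} {G : Graph I L B}
  {α : M → Set (Node I L B)} {v : Node I L B}

theorem Graph.finite_neigh (G : Graph I L B) (v : Node I L B) : (G.neigh v).Finite := by
  refine ((G.finite.image fun t => (t.1, Step.fwd t.2.1, t.2.2)).union
    (G.finite.image fun t => (t.2.2, Step.bwd t.2.1, t.1))).subset ?_
  rintro ⟨u, p | p, w⟩ ⟨hu, h⟩ <;> obtain rfl : u = v := hu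
  · exact Or.inl ⟨(u, p, w), h, rfl⟩
  · exact Or.inr ⟨(w, p, u), h, rfl⟩

/-- The edges of the graph along `q` whose target satisfies `K`. -/
def Graph.edgesInto (G : Graph I L B) (q : Step I) (K : Set (Node I L B)) :
    Set (Node I L B × Step I × Node I L B) :=
  {t | t ∈ G.allEdges ∧ t.2.1 = q ∧ t.2.2 ∈ K}

theorem ShExBasic.mem_sem_edge {q : Step I} {K : ShEx I L V M}
    {F : Set (Node I L B × Step I × Node I L B)} :
    F ∈ (ShExBasic.edge q K).sem val D G α ↔ ∃ t ∈ G.edgesInto q (K.sem val D G α), F = {t} := by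
  simp only [ShExBasic.sem]
  constructor
  · rintro ⟨u, w, hw, h, rfl⟩
    exact ⟨(u, q, w), ⟨h, rfl, hw⟩, rfl⟩
  · rintro ⟨⟨u, q, w⟩, ⟨h, rfl, hw⟩, rfl⟩
    exact ⟨u, w, hw, h, rfl⟩

theorem ShEx.sem_top : (ShEx.top : ShEx I L V M).sem val D G α = D := by
  ext v
  rw [ShEx.top, ShEx.mem_sem_neigh, and_iff_left]
  refine ⟨∅, by simp [ShExTriple.sem, ShExBasic.sem], Set.empty_subset _, ?_⟩
  rintro ⟨u, p | p, w⟩ _ <;> simp [OpenStep]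

/-- A star over a basic expression that matches only single edges of a set `T` (and possibly the
empty set) matches the subsets of `T`. -/
theorem ShExTriple.mem_sem_star {a : ShExBasic I L V M}
    {T : Set (Node I L B × Step I × Node I L B)}
    (h₁ : ∀ F ∈ a.sem val D G α, F ⊆ T) (h₂ : ∀ t ∈ T, {t} ∈ a.sem val D G α)
    {F : Set (Node I L B × Step I × Node I L B)} :
    F ∈ (ShExTriple.star a).sem val D G α ↔ F ⊆ T := by
  simp only [ShExTriple.sem]
  constructor
  · rintro ⟨P, hP, _, rfl⟩
    exact Set.sUnion_subset fun E hE => h₁ E (hP hE)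
  · intro h
    refine ⟨(fun t => {t}) '' F, ?_, ?_, ?_⟩
    · rintro _ ⟨t, ht, rfl⟩
      exact h₂ t (h ht)
    · rintro _ ⟨t, _, rfl⟩ _ ⟨t', _, rfl⟩ hne
      exact Set.disjoint_singleton.2 fun h => hne (by rw [h])
    · simp

theorem ShEx.eachPow_succ (n : ℕ) (a b : ShExTriple I L V M) :
    eachPow (n + 1) a b = .each a (eachPow n a b) :=
  Function.iterate_succ_apply' _ _ _

/-- Counting edges along `q` is the same as counting their targets. -/
theorem ncard_edges_eq {q : Step I} {p : Node I L B → Prop} :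
    {t ∈ G.neigh v | t.2.1 = q ∧ p t.2.2}.ncard = {u | q.rel G v u ∧ p u}.ncard := by
  have : {t ∈ G.neigh v | t.2.1 = q ∧ p t.2.2} = (fun u => (v, q, u)) '' {u | q.rel G v u ∧ p u} := by
    ext ⟨u, q', w⟩
    constructor
    · rintro ⟨⟨rfl, h⟩, rfl, hp⟩
      exact ⟨w, ⟨h, hp⟩, rfl⟩
    · rintro ⟨w', ⟨h, hp⟩, e⟩
      cases e
      exact ⟨⟨rfl, h⟩, rfl, hp⟩
  rw [this, Set.ncard_image_of_injective _ fun u u' h => by simpa using h]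

theorem ShEx.mem_sem_atLeast {n : ℕ} {q : Step I} {K : ShEx I L V M} :
    v ∈ (atLeast n q K).sem val D G α ↔
      v ∈ D ∧ n ≤ {u | q.rel G v u ∧ u ∈ K.sem val D G α}.ncard := by
  set T := G.edgesInto q (K.sem val D G α) with hT
  have upper : ∀ (n : ℕ) F, F ∈ (eachPow n (.basic (.edge q K))
      (.basic (.alt .eps (.edge q K)))).sem val D G α → F ⊆ T ∧ F.Finite ∧ n ≤ F.ncard := by
    intro n
    induction n with
    | zero =>
      intro F hF
      simp only [eachPow, Function.iterate_zero, id_eq, ShExTriple.sem] at hF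
      rw [ShExBasic.sem, ShExBasic.sem, Set.mem_union, ShExBasic.mem_sem_edge] at hF
      rcases hF with rfl | ⟨t, ht, rfl⟩
      · simp
      · simpa using ht
    | succ n ih =>
      intro F hF
      rw [eachPow_succ, ShExTriple.sem, ShExTriple.sem] at hF
      obtain ⟨F₁, h₁, F₂, h₂, hd, rfl⟩ := hF
      obtain ⟨t, ht, rfl⟩ := ShExBasic.mem_sem_edge.1 h₁
      obtain ⟨hs, hf, hn⟩ := ih F₂ h₂
      refine ⟨Set.union_subset (Set.singleton_subset_iff.2 ht) hs, (Set.finite_singleton t).union hf,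
        ?_⟩
      rw [Set.ncard_union_eq hd (Set.finite_singleton t) hf, Set.ncard_singleton]
      omega
  have lower : ∀ (n : ℕ) F, F ⊆ T → F.Finite → F.ncard = n → F ∈ (eachPow n (.basic (.edge q K))
      (.basic (.alt .eps (.edge q K)))).sem val D G α := by
    intro n
    induction n with
    | zero =>
      intro F _ hf hn
      rw [(Set.ncard_eq_zero hf).1 hn]
      simp [eachPow, ShExTriple.sem, ShExBasic.sem]
    | succ n ih =>
      intro F hF hf hn
      obtain ⟨t, ht⟩ : F.Nonempty := (Set.ncard_pos hf).1 (by omega)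
      rw [eachPow_succ, ShExTriple.sem, ShExTriple.sem]
      refine ⟨{t}, ShExBasic.mem_sem_edge.2 ⟨t, hF ht, rfl⟩, F \ {t}, ih _
        (Set.sdiff_subset.trans hF) hf.sdiff ?_, Set.disjoint_sdiff_right, ?_⟩
      · rw [Set.ncard_sdiff_singleton_of_mem ht]
        omega
      · exact (Set.union_sdiff_cancel (Set.singleton_subset_iff.2 ht)).symm
  rw [atLeast, mem_sem_neigh, ← ncard_edges_eq]
  refine and_congr_right fun _ => ?_
  have hfin : {t ∈ G.neigh v | t.2.1 = q ∧ t.2.2 ∈ K.sem val D G α}.Finite :=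
    (G.finite_neigh v).subset (Set.sep_subset _ _)
  constructor
  · rintro ⟨F, hF, hsub, _⟩
    obtain ⟨hs, hf, hn⟩ := upper n F hF
    exact hn.trans (Set.ncard_le_ncard (fun t ht => ⟨hsub ht, (hs ht).2⟩) hfin)
  · intro h
    obtain ⟨F, hF, hn⟩ := Set.exists_subset_card_eq h
    refine ⟨F, lower n F (fun t ht => ⟨G.neigh_subset v (hF ht).1, (hF ht).2⟩) (hfin.subset hF) hn,
      fun t ht => (hF ht).1, ?_⟩
    rintro ⟨u, p | p, w⟩ _ <;> simp [OpenStep]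

theorem openStep_allBut {q q' : Step I} :
    OpenStep (ShEx.allBut q).1 (some (ShEx.allBut q).2) q' ↔ q' ≠ q := by
  cases q <;> cases q' <;> simp [OpenStep, ShEx.allBut]

theorem ShEx.mem_sem_atMost (hD : G.nodes ⊆ D) {n : ℕ} {q : Step I} {K : ShEx I L V M} :
    v ∈ (atMost n q K).sem val D G α ↔
      v ∈ D ∧ {u | q.rel G v u ∧ u ∉ K.sem val D G α}.ncard ≤ n := by
  have hedge : ∀ t ∈ G.allEdges, t.2.1 = q →
      {t} ∈ (ShExBasic.edge q (top : ShEx I L V M)).sem val D G α := by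
    intro t ht hq
    refine ShExBasic.mem_sem_edge.2 ⟨t, ⟨ht, hq, ?_⟩, rfl⟩
    rw [sem_top]
    exact hD (Step.rel_mem_nodes ht)
  have key : ∀ (n : ℕ) F, F.Finite → F ⊆ G.allEdges → (∀ t ∈ F, t.2.1 = q) →
      (F ∈ (eachPow n (.basic (.alt .eps (.edge q top))) (.star (.edge q K))).sem val D G α ↔
        {t ∈ F | t.2.2 ∉ K.sem val D G α}.ncard ≤ n) := by
    intro n
    induction n with
    | zero =>
      intro F hf hF hq
      rw [eachPow, Function.iterate_zero, id_eq, ShExTriple.mem_sem_star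
        (T := G.edgesInto q (K.sem val D G α)), Nat.le_zero,
        Set.ncard_eq_zero (hf.subset (Set.sep_subset _ _)), Set.eq_empty_iff_forall_notMem]
      · constructor
        · exact fun h t ht => ht.2 (h ht.1).2.2
        · intro h t ht
          by_contra hcon
          exact h t ⟨ht, fun hK => hcon ⟨hF ht, hq t ht, hK⟩⟩
      · intro F hF
        obtain ⟨t, ht, rfl⟩ := ShExBasic.mem_sem_edge.1 hF
        exact Set.singleton_subset_iff.2 ht
      · exact fun t ht => ShExBasic.mem_sem_edge.2 ⟨t, ht, rfl⟩
    | succ n ih =>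
      intro F hf hF hq
      rw [eachPow_succ, ShExTriple.sem, ShExTriple.sem]
      constructor
      · rintro ⟨F₁, h₁, F₂, h₂, _, rfl⟩
        have hf₂ : F₂.Finite := hf.subset Set.subset_union_right
        have := (ih F₂ hf₂ (Set.subset_union_right.trans hF) fun t ht => hq t (Or.inr ht)).1 h₂
        rw [ShExBasic.sem, ShExBasic.sem, Set.mem_union, ShExBasic.mem_sem_edge] at h₁
        rcases h₁ with rfl | ⟨t, ht, rfl⟩
        · simp only [Set.empty_union]
          omega
        · refine (Set.ncard_le_ncard (t := insert t {t ∈ F₂ | t.2.2 ∉ K.sem val D G α}) ?_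
            ((hf₂.subset (Set.sep_subset _ _)).insert t)).trans
              ((Set.ncard_insert_le _ _).trans (Nat.succ_le_succ this))
          rintro t' ⟨h | h, h'⟩
          · exact Or.inl h
          · exact Or.inr ⟨h, h'⟩
      · intro h
        rcases {t ∈ F | t.2.2 ∉ K.sem val D G α}.eq_empty_or_nonempty with he | ⟨t, ht, htK⟩
        · refine ⟨∅, by simp [ShExBasic.sem], F, (ih F hf hF hq).2 ?_, Set.empty_disjoint _,
            (Set.empty_union F).symm⟩
          rw [he]
          simp
        · refine ⟨{t}, ?_, F \ {t}, (ih _ hf.sdiff (Set.sdiff_subset.trans hF)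
            fun t ht => hq t ht.1).2 ?_, Set.disjoint_sdiff_right,
            (Set.union_sdiff_cancel (Set.singleton_subset_iff.2 ht)).symm⟩
          · rw [ShExBasic.sem]
            exact Or.inr (hedge t (hF ht) (hq t ht))
          · have : {t' ∈ F \ {t} | t'.2.2 ∉ K.sem val D G α} =
                {t' ∈ F | t'.2.2 ∉ K.sem val D G α} \ {t} := by
              ext t'
              simp only [Set.mem_sdiff, Set.mem_ofPred_eq]
              tauto
            rw [this, Set.ncard_sdiff_singleton_of_mem
              (show t ∈ {t' ∈ F | t'.2.2 ∉ K.sem val D G α} from ⟨ht, htK⟩)]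
            omega
  have hsub : ∀ (n : ℕ) F, F ∈ (eachPow n (.basic (.alt .eps (.edge q top)))
      (.star (.edge q K))).sem val D G α → ∀ t ∈ F, t.2.1 = q := by
    intro n
    induction n with
    | zero =>
      intro F hF t ht
      rw [eachPow, Function.iterate_zero, id_eq, ShExTriple.mem_sem_star
        (T := G.edgesInto q (K.sem val D G α))] at hF
      · exact (hF ht).2.1
      · intro F hF
        obtain ⟨t, ht, rfl⟩ := ShExBasic.mem_sem_edge.1 hF
        exact Set.singleton_subset_iff.2 ht
      · exact fun t ht => ShExBasic.mem_sem_edge.2 ⟨t, ht, rfl⟩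
    | succ n ih =>
      intro F hF t ht
      rw [eachPow_succ, ShExTriple.sem, ShExTriple.sem] at hF
      obtain ⟨F₁, h₁, F₂, h₂, _, rfl⟩ := hF
      rcases ht with ht | ht
      · rw [ShExBasic.sem, ShExBasic.sem, Set.mem_union, ShExBasic.mem_sem_edge] at h₁
        rcases h₁ with rfl | ⟨t', ht', rfl⟩
        · cases ht
        · obtain rfl : t = t' := ht
          exact ht'.2.1
      · exact ih F₂ h₂ t ht
  rw [atMost, mem_sem_neigh, ← ncard_edges_eq]
  refine and_congr_right fun _ => ?_
  have hset : {t ∈ {t ∈ G.neigh v | t.2.1 = q} | t.2.2 ∉ K.sem val D G α} =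
      {t ∈ G.neigh v | t.2.1 = q ∧ t.2.2 ∉ K.sem val D G α} := by
    ext t
    exact and_assoc
  have key' := key n {t ∈ G.neigh v | t.2.1 = q} ((G.finite_neigh v).subset (Set.sep_subset _ _))
    ((Set.sep_subset _ _).trans (G.neigh_subset v)) fun t ht => ht.2
  rw [hset] at key'
  rw [← key']
  constructor
  · rintro ⟨F, hF, hFv, hopen⟩
    obtain rfl : F = {t ∈ G.neigh v | t.2.1 = q} := by
      refine Set.Subset.antisymm (fun t ht => ⟨hFv ht, hsub n F hF t ht⟩) fun t ht => ?_
      by_contra hcon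
      exact openStep_allBut.1 (hopen t ⟨ht.1, hcon⟩) ht.2
    exact hF
  · exact fun h => ⟨_, h, Set.sep_subset _ _, fun t ht =>
      openStep_allBut.2 fun hq => ht.2 ⟨ht.1, hq⟩⟩

theorem ShEx.mem_sem_atMost_zero (hD : G.nodes ⊆ D) {q : Step I} {K : ShEx I L V M} :
    v ∈ (atMost 0 q K).sem val D G α ↔ v ∈ D ∧ ∀ u, q.rel G v u → u ∈ K.sem val D G α := by
  rw [mem_sem_atMost hD, Nat.le_zero,
    Set.ncard_eq_zero ((G.finite_rel q v).subset fun u hu => hu.1),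
    Set.eq_empty_iff_forall_notMem]
  simp

theorem ShEx.mem_sem_closedShape (hD : G.nodes ⊆ D) {Q : List I} :
    v ∈ (closedShape Q : ShEx I L V M).sem val D G α ↔
      v ∈ D ∧ ∀ p, p ∉ Q → ∀ u, (v, p, u) ∉ G.triples := by
  let T (Q : List I) : Set (Node I L B × Step I × Node I L B) :=
    {t | t ∈ G.allEdges ∧ ∃ p ∈ Q, t.2.1 = .fwd p}
  have h₁ : ∀ (Q : List I), ∀ F ∈ (anyOf Q : ShExBasic I L V M).sem val D G α, F ⊆ T Q := by
    intro Q
    induction Q with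
    | nil =>
      intro F hF
      obtain rfl : F = ∅ := by simpa [anyOf, ShExBasic.sem] using hF
      exact Set.empty_subset _
    | cons p Q ih =>
      intro F hF
      rw [anyOf, List.foldr_cons, ShExBasic.sem, Set.mem_union, ShExBasic.mem_sem_edge] at hF
      rcases hF with ⟨t, ht, rfl⟩ | hF
      · exact Set.singleton_subset_iff.2 ⟨ht.1, p, List.mem_cons_self, ht.2.1⟩
      · exact (ih F hF).trans fun t ⟨ht, p, hp, h⟩ => ⟨ht, p, List.mem_cons_of_mem _ hp, h⟩
  have h₂ : ∀ (Q : List I), ∀ t ∈ T Q, {t} ∈ (anyOf Q : ShExBasic I L V M).sem val D G α := by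
    rintro Q t ⟨ht, p, hp, h⟩
    induction Q with
    | nil => cases hp
    | cons p' Q ih =>
      rw [anyOf, List.foldr_cons, ShExBasic.sem, Set.mem_union, ShExBasic.mem_sem_edge, sem_top]
      rcases List.mem_cons.1 hp with rfl | hp
      · exact Or.inl ⟨t, ⟨ht, h, hD (Step.rel_mem_nodes ht)⟩, rfl⟩
      · exact Or.inr (ih hp)
  rw [closedShape, mem_sem_neigh]
  refine and_congr_right fun _ => ?_
  constructor
  · rintro ⟨F, hF, _, hopen⟩ p hp u hu
    have ht : (v, Step.fwd p, u) ∈ G.neigh v := ⟨rfl, hu⟩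
    by_cases h : (v, Step.fwd p, u) ∈ F
    · obtain ⟨_, p', hp', h⟩ := (ShExTriple.mem_sem_star (h₁ Q) (h₂ Q)).1 hF h
      cases h
      exact hp hp'
    · simpa [OpenStep] using hopen _ ⟨ht, h⟩
  · intro h
    refine ⟨G.neigh v ∩ T Q, (ShExTriple.mem_sem_star (h₁ Q) (h₂ Q)).2 Set.inter_subset_right,
      Set.inter_subset_left, ?_⟩
    rintro ⟨u, p | p, w⟩ ⟨ht, hn⟩
    · obtain ⟨rfl, ht'⟩ := ht
      refine absurd ⟨⟨rfl, ht'⟩, ht', p, ?_, rfl⟩ hn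
      by_contra hp
      exact h p hp w ht'
    · simp [OpenStep]

end

namespace ShEx

theorem names_top : (top : ShEx I L V M).names = ∅ := rfl

theorem consts_top : (top : ShEx I L V M).consts = ∅ := rfl

theorem names_eachPow (n : ℕ) (a b : ShExTriple I L V M) :
    (eachPow n a b).names ⊆ a.names ∪ b.names := by
  induction n with
  | zero => exact Set.subset_union_right
  | succ n ih =>
    rw [eachPow_succ]
    exact Set.union_subset Set.subset_union_left ih

theorem names_atLeast {n : ℕ} {q : Step I} {K : ShEx I L V M} {s : M}
    (h : s ∈ (atLeast n q K).names) : s ∈ K.names := by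
  have := names_eachPow _ _ _ h
  simpa [ShExTriple.names, ShExBasic.names] using this

theorem names_atMost {n : ℕ} {q : Step I} {K : ShEx I L V M} {s : M}
    (h : s ∈ (atMost n q K).names) : s ∈ K.names := by
  have := names_eachPow _ _ _ h
  simpa [ShExTriple.names, ShExBasic.names, names_top] using this

theorem consts_eachPow (n : ℕ) (a b : ShExTriple I L V M) (h : a.consts ⊆ b.consts) :
    (eachPow n a b).consts = b.consts := by
  induction n with
  | zero => rfl
  | succ n ih =>
    rw [eachPow_succ]
    exact (congrArg (a.consts ∪ ·) ih).trans (Set.union_eq_right.2 h)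

theorem consts_atLeast {n : ℕ} {q : Step I} {K : ShEx I L V M} :
    (atLeast n q K).consts = K.consts := by
  refine (consts_eachPow _ _ _ ?_).trans ?_ <;> simp [ShExTriple.consts, ShExBasic.consts]

theorem consts_atMost {n : ℕ} {q : Step I} {K : ShEx I L V M} :
    (atMost n q K).consts = K.consts := by
  refine (consts_eachPow _ _ _ ?_).trans ?_ <;>
    simp [ShExTriple.consts, ShExBasic.consts, consts_top]

theorem names_anyOf (Q : List I) : (anyOf Q : ShExBasic I L V M).names = ∅ := by
  induction Q with
  | nil => rfl
  | cons p Q ih => exact (congrArg (_ ∪ ·) ih).trans (Set.union_empty _)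

theorem consts_anyOf (Q : List I) : (anyOf Q : ShExBasic I L V M).consts = ∅ := by
  induction Q with
  | nil => rfl
  | cons p Q ih => exact (congrArg (_ ∪ ·) ih).trans (Set.union_empty _)

theorem names_closedShape (Q : List I) : (closedShape Q : ShEx I L V M).names = ∅ := names_anyOf Q

theorem consts_closedShape (Q : List I) : (closedShape Q : ShEx I L V M).consts = ∅ :=
  consts_anyOf Q

variable {r : M → ℕ} {i : ℕ}

theorem admissible_top (b : Bool) : (top : ShEx I L V M).Admissible r i b :=
  admissible_of_names_lt _ _ fun _ h => by cases h

theorem admissible_closedShape (Q : List I) (b : Bool) :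
    (closedShape Q : ShEx I L V M).Admissible r i b :=
  admissible_of_names_lt _ _ fun s h => by
    rw [names_closedShape] at h
    cases h

theorem admissible_eachPow {n : ℕ} {a b : ShExTriple I L V M} (ha : a.Admissible r i)
    (hb : b.Admissible r i) : (eachPow n a b).Admissible r i := by
  induction n with
  | zero => exact hb
  | succ n ih =>
    rw [eachPow_succ]
    exact ⟨ha, ih⟩

theorem admissible_atLeast {n : ℕ} {q : Step I} {K : ShEx I L V M} (h : K.Admissible r i true) :
    (atLeast n q K).Admissible r i true :=
  admissible_eachPow h ⟨trivial, h⟩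

theorem admissible_atMost {n : ℕ} {q : Step I} {K : ShEx I L V M} (h : K.Admissible r i true) :
    (atMost n q K).Admissible r i true :=
  admissible_eachPow (a := .basic (.alt .eps (.edge q top))) ⟨trivial, admissible_top true⟩ h

end ShEx

/-! ### Injectivity of codes -/

theorem codeNode_inj {t t' p p' : ℕ} : codeNode t p = codeNode t' p' ↔ t = t' ∧ p = p' := by
  simp [codeNode, Nat.pair_eq_pair]

section

variable [Encodable I] [Encodable L] [Encodable V] [Encodable M]

theorem Const.code_injective : Function.Injective (Const.code : Const I L → ℕ) := by
  rintro (i | l) (i' | l') h <;> simp [Const.code, codeNode_inj] at h ⊢ <;>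
    exact h

theorem Path.code_injective : Function.Injective (Path.code : Path I → ℕ) := by
  intro π
  induction π with
  | id => rintro (_ | _ | _ | _ | _ | _) h <;> simp [Path.code, codeNode_inj] at h ⊢
  | pred p =>
    rintro (_ | _ | _ | _ | _ | _) h <;> simp [Path.code, codeNode_inj] at h ⊢
    exact h
  | inv π ih | star π ih =>
    rintro (_ | _ | _ | _ | _ | _) h <;> simp [Path.code, codeNode_inj] at h ⊢
    exact ih h
  | comp π₁ π₂ ih₁ ih₂ | union π₁ π₂ ih₁ ih₂ =>
    rintro (_ | _ | _ | _ | _ | _) h <;>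
      simp [Path.code, codeNode_inj, Nat.pair_eq_pair] at h ⊢
    exact ⟨ih₁ h.1, ih₂ h.2⟩

theorem SHACL.code_injective : Function.Injective (SHACL.code : SHACL I L V M → ℕ) := by
  intro φ
  induction φ with
  | top | bot =>
    rintro (_ | _ | _ | _ | _ | _ | _ | _ | _ | _ | _ | _) h <;>
      simp [SHACL.code, codeNode_inj] at h ⊢
  | testType | name | closed =>
    rintro (_ | _ | _ | _ | _ | _ | _ | _ | _ | _ | _ | _) h <;>
      simp [SHACL.code, codeNode_inj] at h ⊢
    exact h
  | test c =>
    rintro (_ | _ | _ | _ | _ | _ | _ | _ | _ | _ | _ | _) h <;>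
      simp [SHACL.code, codeNode_inj] at h ⊢
    exact Const.code_injective h
  | not φ ih =>
    rintro (_ | _ | _ | _ | _ | _ | _ | _ | _ | _ | _ | _) h <;>
      simp [SHACL.code, codeNode_inj] at h ⊢
    exact ih h
  | and φ ψ ih₁ ih₂ | or φ ψ ih₁ ih₂ =>
    rintro (_ | _ | _ | _ | _ | _ | _ | _ | _ | _ | _ | _) h <;>
      simp [SHACL.code, codeNode_inj, Nat.pair_eq_pair] at h ⊢
    exact ⟨ih₁ h.1, ih₂ h.2⟩
  | ge n q φ ih | le n q φ ih =>
    rintro (_ | _ | _ | _ | _ | _ | _ | _ | _ | _ | _ | _) h <;>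
      simp [SHACL.code, codeNode_inj, Nat.pair_eq_pair, Step.code_injective] at h ⊢
    exact ⟨h.1, h.2.1, ih h.2.2⟩
  | ex π φ ih =>
    rintro (_ | _ | _ | _ | _ | _ | _ | _ | _ | _ | _ | _) h <;>
      simp [SHACL.code, codeNode_inj, Nat.pair_eq_pair] at h ⊢
    exact ⟨Path.code_injective h.1, ih h.2⟩

end

/-! ### From Restricted SHACL to Restricted ShEx: shapes -/

/-- A path expression to be followed forwards (`false`) or backwards (`true`). -/
abbrev DirPath (I : Type) : Type := Bool × Path I

namespace DirPath

/-- The binary relation defined by a directed path expression. -/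
def rel (G : Graph I L B) : DirPath I → Node I L B → Node I L B → Prop
  | (false, π), v, w => π.rel G v w
  | (true, π), v, w => π.rel G w v

/-- The composition of the relations of a list of directed path expressions. -/
def relList (G : Graph I L B) : List (DirPath I) → Node I L B → Node I L B → Prop
  | [], v, w => v = w
  | e :: l, v, w => ∃ u, e.rel G v u ∧ relList G l u w

/-- The lists `[π₁, …, πₖ]` that may remain to be followed after a step in `π`, followed in the
direction `d`. -/
def states : Bool → Path I → List (List (DirPath I))
  | d, .id => [[(d, .id)]]
  | d, .pred p => [[(d, .pred p)]]
  | d, .inv π => [(d, .inv π)] :: states (!d) π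
  | false, .comp π₁ π₂ => [(false, .comp π₁ π₂)] ::
      ((states false π₁).map (· ++ [(false, π₂)]) ++ states false π₂)
  | true, .comp π₁ π₂ => [(true, .comp π₁ π₂)] ::
      ((states true π₂).map (· ++ [(true, π₁)]) ++ states true π₁)
  | d, .union π₁ π₂ => [(d, .union π₁ π₂)] :: (states d π₁ ++ states d π₂)
  | d, .star π => [(d, .star π)] :: (states d π).map (· ++ [(d, .star π)])

/-- The lists to which a list of directed path expressions is reduced by following one edge or by
resolving the outermost operator of its first member. -/
def succs : List (DirPath I) → List (List (DirPath I))
  | [] => []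
  | (_, .id) :: l | (_, .pred _) :: l => [l]
  | (d, .inv π) :: l => [(!d, π) :: l]
  | (false, .comp π₁ π₂) :: l => [(false, π₁) :: (false, π₂) :: l]
  | (true, .comp π₁ π₂) :: l => [(true, π₂) :: (true, π₁) :: l]
  | (d, .union π₁ π₂) :: l => [(d, π₁) :: l, (d, π₂) :: l]
  | (d, .star π) :: l => [l, (d, π) :: (d, .star π) :: l]

theorem mem_states_self (d : Bool) (π : Path I) : [(d, π)] ∈ states d π := by
  cases π <;> cases d <;> simp [states]

theorem ne_nil_of_mem_states {d : Bool} {π : Path I} {l : List (DirPath I)} (h : l ∈ states d π) :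
    l ≠ [] := by
  induction π generalizing d l with
  | id | pred => simp_all [states]
  | inv π ih =>
    simp only [states, List.mem_cons] at h
    rcases h with rfl | h
    · simp
    · exact ih h
  | comp π₁ π₂ ih₁ ih₂ =>
    cases d <;> simp only [states, List.mem_cons, List.mem_append, List.mem_map] at h <;>
      rcases h with rfl | ⟨l, _, rfl⟩ | h <;> try simp
    · exact ih₂ h
    · exact ih₁ h
  | union π₁ π₂ ih₁ ih₂ =>
    simp only [states, List.mem_cons, List.mem_append] at h
    rcases h with rfl | h | h
    · simp
    · exact ih₁ h
    · exact ih₂ h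
  | star π ih =>
    simp only [states, List.mem_cons, List.mem_map] at h
    rcases h with rfl | ⟨l, _, rfl⟩ <;> simp

theorem succs_append {l : List (DirPath I)} (h : l ≠ []) (k : List (DirPath I)) :
    succs (l ++ k) = (succs l).map (· ++ k) := by
  rcases l with _ | ⟨⟨_ | _, _ | _ | _ | _ | _ | _⟩, l⟩
  · exact absurd rfl h
  all_goals simp [succs]

/-- The states of a path expression are closed under reduction. -/
theorem mem_states_of_mem_succs {d : Bool} {π : Path I} {l l' : List (DirPath I)}
    (h : l ∈ states d π) (h' : l' ∈ succs l) : l' = [] ∨ l' ∈ states d π := by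
  have app {d d' : Bool} {π π' : Path I} {l l' : List (DirPath I)}
      (ih : ∀ l', l' ∈ succs l → l' = [] ∨ l' ∈ states d π) (h : l ∈ states d π)
      (h' : l' ∈ succs (l ++ [(d', π')])) :
      l' = [(d', π')] ∨ l' ∈ (states d π).map (· ++ [(d', π')]) := by
    rw [succs_append (ne_nil_of_mem_states h), List.mem_map] at h'
    obtain ⟨k, hk, rfl⟩ := h'
    rcases ih k hk with rfl | hk
    · exact Or.inl rfl
    · exact Or.inr (List.mem_map_of_mem hk)
  induction π generalizing d l l' with
  | id => cases d <;> simp_all [states, succs]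
  | pred p => cases d <;> simp_all [states, succs]
  | inv π ih =>
    simp only [states, List.mem_cons] at h ⊢
    rcases h with rfl | h
    · obtain rfl : l' = [(!d, π)] := by cases d <;> simpa [succs] using h'
      exact Or.inr (Or.inr (mem_states_self _ _))
    · exact (ih h h').imp_right Or.inr
  | comp π₁ π₂ ih₁ ih₂ =>
    cases d <;> simp only [states, List.mem_cons, List.mem_append] at h ⊢
    · rcases h with rfl | h | h
      · obtain rfl : l' = [(false, π₁)] ++ [(false, π₂)] := by simpa [succs] using h'
        exact Or.inr (Or.inr (Or.inl (List.mem_map_of_mem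
          (f := (· ++ [(false, π₂)])) (mem_states_self false π₁))))
      · obtain ⟨l, hl, rfl⟩ := List.mem_map.1 h
        rcases app (fun _ => ih₁ hl) hl h' with rfl | h
        · exact Or.inr (Or.inr (Or.inr (mem_states_self _ _)))
        · exact Or.inr (Or.inr (Or.inl h))
      · exact (ih₂ h h').imp_right fun h => Or.inr (Or.inr h)
    · rcases h with rfl | h | h
      · obtain rfl : l' = [(true, π₂)] ++ [(true, π₁)] := by simpa [succs] using h'
        exact Or.inr (Or.inr (Or.inl (List.mem_map_of_mem
          (f := (· ++ [(true, π₁)])) (mem_states_self true π₂))))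
      · obtain ⟨l, hl, rfl⟩ := List.mem_map.1 h
        rcases app (fun _ => ih₂ hl) hl h' with rfl | h
        · exact Or.inr (Or.inr (Or.inr (mem_states_self _ _)))
        · exact Or.inr (Or.inr (Or.inl h))
      · exact (ih₁ h h').imp_right fun h => Or.inr (Or.inr h)
  | union π₁ π₂ ih₁ ih₂ =>
    simp only [states, List.mem_cons, List.mem_append] at h ⊢
    rcases h with rfl | h | h
    · have : l' = [(d, π₁)] ∨ l' = [(d, π₂)] := by cases d <;> simpa [succs] using h'
      rcases this with rfl | rfl
      · exact Or.inr (Or.inr (Or.inl (mem_states_self _ _)))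
      · exact Or.inr (Or.inr (Or.inr (mem_states_self _ _)))
    · exact (ih₁ h h').imp_right fun h => Or.inr (Or.inl h)
    · exact (ih₂ h h').imp_right fun h => Or.inr (Or.inr h)
  | star π ih =>
    simp only [states, List.mem_cons] at h ⊢
    rcases h with rfl | h
    · have : l' = [] ∨ l' = [(d, π)] ++ [(d, .star π)] := by cases d <;> simpa [succs] using h'
      rcases this with rfl | rfl
      · exact Or.inl rfl
      · exact Or.inr (Or.inr (List.mem_map_of_mem
          (f := (· ++ [(d, .star π)])) (mem_states_self d π)))
    · obtain ⟨l, hl, rfl⟩ := List.mem_map.1 h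
      rcases app (fun _ => ih hl) hl h' with rfl | h
      · exact Or.inr (Or.inl rfl)
      · exact Or.inr (Or.inr h)

section

variable [Encodable I]

/-- The code of a directed path expression. -/
def code (e : DirPath I) : ℕ := Nat.pair e.1.toNat e.2.code

theorem code_injective : Function.Injective (code : DirPath I → ℕ) := by
  rintro ⟨d, π⟩ ⟨d', π'⟩ h
  obtain ⟨h₁, h₂⟩ := Nat.pair_eq_pair.1 h
  exact Prod.ext (by cases d <;> cases d' <;> simp_all) (Path.code_injective h₂)

end

end DirPath

/-- The pairs `(π, ψ)` such that `∃ π.ψ` occurs in a shape. -/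
def SHACL.exs : SHACL I L V M → List (Path I × SHACL I L V M)
  | .top | .bot | .test _ | .testType _ | .name _ | .closed _ => []
  | .not φ | .ge _ _ φ | .le _ _ φ => φ.exs
  | .and φ ψ | .or φ ψ => φ.exs ++ ψ.exs
  | .ex π φ => (π, φ) :: φ.exs

theorem names_subset_of_mem_exs {φ : SHACL I L V M} {x : Path I × SHACL I L V M} (h : x ∈ φ.exs) :
    x.2.names ⊆ φ.names := by
  induction φ with
  | top | bot | test | testType | name | closed => cases h
  | not φ ih | ge _ _ φ ih | le _ _ φ ih => exact ih h
  | and φ ψ ih₁ ih₂ | or φ ψ ih₁ ih₂ =>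
    exact (List.mem_append.1 h).elim (fun h => (ih₁ h).trans Set.subset_union_left)
      fun h => (ih₂ h).trans Set.subset_union_right
  | ex π φ ih => exact (List.mem_cons.1 h).elim (fun h => h ▸ subset_rfl) ih

theorem exs_subset_of_mem_exs {φ : SHACL I L V M} {x : Path I × SHACL I L V M} (h : x ∈ φ.exs) :
    x.2.exs ⊆ φ.exs := by
  induction φ with
  | top | bot | test | testType | name | closed => cases h
  | not φ ih | ge _ _ φ ih | le _ _ φ ih => exact ih h
  | and φ ψ ih₁ ih₂ | or φ ψ ih₁ ih₂ =>
    exact (List.mem_append.1 h).elim (fun h => List.Subset.trans (ih₁ h) (List.subset_append_left _ _))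
      fun h => List.Subset.trans (ih₂ h) (List.subset_append_right _ _)
  | ex π φ ih =>
    exact (List.mem_cons.1 h).elim (fun h => h ▸ List.subset_cons_self _ _)
      fun h => List.Subset.trans (ih h) (List.subset_cons_self _ _)

theorem consts_subset_of_mem_exs {φ : SHACL I L V M} {x : Path I × SHACL I L V M} (h : x ∈ φ.exs) :
    x.2.consts ⊆ φ.consts := by
  induction φ with
  | top | bot | test | testType | name | closed => cases h
  | not φ ih | ge _ _ φ ih | le _ _ φ ih => exact ih h
  | and φ ψ ih₁ ih₂ | or φ ψ ih₁ ih₂ =>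
    exact (List.mem_append.1 h).elim (fun h => (ih₁ h).trans Set.subset_union_left)
      fun h => (ih₂ h).trans Set.subset_union_right
  | ex π φ ih => exact (List.mem_cons.1 h).elim (fun h => h ▸ subset_rfl) ih

section

variable [Encodable I] [Encodable L] [Encodable V] [Denumerable N]

/-- The name that stands for: no node that can be reached along the list `l` satisfies `φ`. -/
def pathName (l : List (DirPath I)) (φ : SHACL I L V N) : N :=
  Denumerable.ofNat N (2 * Nat.pair (Encodable.encode (l.map DirPath.code)) φ.code + 1)

theorem encode_pathName (l : List (DirPath I)) (φ : SHACL I L V N) :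
    Encodable.encode (pathName l φ) =
      2 * Nat.pair (Encodable.encode (l.map DirPath.code)) φ.code + 1 := by
  simp [pathName]

theorem dbl_ne_pathName {s : N} {l : List (DirPath I)} {φ : SHACL I L V N} :
    dbl s ≠ pathName l φ := by
  rw [ne_eq, ← Encodable.encode_inj, encode_dbl, encode_pathName]
  omega

theorem pathName_inj {l l' : List (DirPath I)} {φ φ' : SHACL I L V N} :
    pathName l φ = pathName l' φ' ↔ l = l' ∧ φ = φ' := by
  refine ⟨fun h => ?_, fun ⟨h, h'⟩ => by rw [h, h']⟩
  rw [← Encodable.encode_inj, encode_pathName, encode_pathName] at h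
  have h := Nat.pair_eq_pair.1 (Nat.eq_of_mul_eq_mul_left two_pos (Nat.succ_injective h))
  exact ⟨List.map_injective_iff.2 DirPath.code_injective (Encodable.encode_inj.1 h.1),
    SHACL.code_injective h.2⟩

/-- The ShEx shape for a SHACL shape (`true`) or for its complement (`false`). The name `dbl s`
stands for the complement of `s`. -/
def SHACL.toShEx : SHACL I L V N → Bool → ShEx I L V N
  | .top, true | .bot, false => .top
  | .top, false | .bot, true => .not .top
  | .test c, true => .test c
  | .test c, false => .not (.test c)
  | .testType t, true => .testType t
  | .testType t, false => .not (.testType t)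
  | .name s, true => .not (.name (dbl s))
  | .name s, false => .name (dbl s)
  | .closed Q, true => .closedShape Q
  | .closed Q, false => .not (.closedShape Q)
  | .not φ, b => φ.toShEx (!b)
  | .and φ ψ, true => .and (φ.toShEx true) (ψ.toShEx true)
  | .and φ ψ, false => .or (φ.toShEx false) (ψ.toShEx false)
  | .or φ ψ, true => .or (φ.toShEx true) (ψ.toShEx true)
  | .or φ ψ, false => .and (φ.toShEx false) (ψ.toShEx false)
  | .ge n q φ, true => .atLeast n q (φ.toShEx true)
  -- There are no nodes that have fewer than `0` successors; the constants of `φ` are kept.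
  | .ge 0 _ φ, false => .and (.not .top) (φ.toShEx false)
  | .ge (n + 1) q φ, false => .atMost n q (φ.toShEx false)
  | .le n q φ, true => .atMost n q (φ.toShEx false)
  | .le n q φ, false => .atLeast (n + 1) q (φ.toShEx true)
  | .ex π φ, true => .not (.name (pathName [(false, π)] φ))
  | .ex π φ, false => .name (pathName [(false, π)] φ)

/-- The declaration of `pathName l φ`: it resolves the outermost operator of the first member of `l`,
or follows one edge, or, for the empty list, excludes `φ`. -/
def pathDecl (φ : SHACL I L V N) : List (DirPath I) → ShEx I L V N
  | [] => φ.toShEx false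
  | (_, .id) :: l => .name (pathName l φ)
  | (false, .pred p) :: l => .atMost 0 (.fwd p) (.name (pathName l φ))
  | (true, .pred p) :: l => .atMost 0 (.bwd p) (.name (pathName l φ))
  | (d, .inv π) :: l => .name (pathName ((!d, π) :: l) φ)
  | (false, .comp π₁ π₂) :: l => .name (pathName ((false, π₁) :: (false, π₂) :: l) φ)
  | (true, .comp π₁ π₂) :: l => .name (pathName ((true, π₂) :: (true, π₁) :: l) φ)
  | (d, .union π₁ π₂) :: l =>
      .and (.name (pathName ((d, π₁) :: l) φ)) (.name (pathName ((d, π₂) :: l) φ))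
  | (d, .star π) :: l =>
      .and (.name (pathName l φ)) (.name (pathName ((d, π) :: (d, .star π) :: l) φ))

/-- The declarations of the names used in the translation of `∃ π.φ`. -/
def pathDecls (π : Path I) (φ : SHACL I L V N) : List (N × ShEx I L V N) :=
  ([] :: DirPath.states false π).map fun l => (pathName l φ, pathDecl φ l)

/-- The declarations of all names `pathName l ψ` used, directly or indirectly, in the translation of
a shape. -/
def SHACL.exDecls (φ : SHACL I L V N) : List (N × ShEx I L V N) :=
  φ.exs.flatMap fun x => pathDecls x.1 x.2

theorem names_toShEx {φ : SHACL I L V N} {b : Bool} {n : N} (h : n ∈ (φ.toShEx b).names) :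
    (∃ s ∈ φ.names, n = dbl s) ∨ ∃ x ∈ φ.exs, n = pathName [(false, x.1)] x.2 := by
  induction φ generalizing b with
  | top | bot | test c | testType t => cases b <;> cases h
  | name s => cases b <;> exact Or.inl ⟨s, rfl, h⟩
  | closed Q => cases b <;> exact absurd h (by simp [SHACL.toShEx, ShEx.names,
      ShEx.names_closedShape])
  | not φ ih => exact ih h
  | and φ ψ ih₁ ih₂ | or φ ψ ih₁ ih₂ =>
    have h : ∃ b, n ∈ (φ.toShEx b).names ∪ (ψ.toShEx b).names := by
      cases b <;> exact ⟨_, h⟩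
    obtain ⟨b, h | h⟩ := h
    · refine (ih₁ h).imp (fun ⟨s, hs, e⟩ => ⟨s, Or.inl hs, e⟩) fun ⟨x, hx, e⟩ =>
        ⟨x, List.mem_append_left _ hx, e⟩
    · refine (ih₂ h).imp (fun ⟨s, hs, e⟩ => ⟨s, Or.inr hs, e⟩) fun ⟨x, hx, e⟩ =>
        ⟨x, List.mem_append_right _ hx, e⟩
  | ge m q φ ih =>
    cases b
    · cases m with
      | zero => exact ih (h.resolve_left (by simp [ShEx.names, ShEx.names_top]))
      | succ m => exact ih (ShEx.names_atMost h)
    · exact ih (ShEx.names_atLeast h)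
  | le m q φ ih =>
    cases b
    · exact ih (ShEx.names_atLeast h)
    · exact ih (ShEx.names_atMost h)
  | ex π φ ih =>
    refine Or.inr ⟨(π, φ), List.mem_cons_self, ?_⟩
    cases b <;> exact h

theorem names_pathDecl {φ : SHACL I L V N} {l : List (DirPath I)} {n : N}
    (h : n ∈ (pathDecl φ l).names) :
    l = [] ∧ n ∈ (φ.toShEx false).names ∨ ∃ l' ∈ DirPath.succs l, n = pathName l' φ := by
  rcases l with _ | ⟨⟨_ | _, _ | _ | _ | _ | _ | _⟩, l⟩
  · exact Or.inl ⟨rfl, h⟩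
  case cons.false.pred | cons.true.pred =>
    exact Or.inr ⟨_, List.mem_cons_self, ShEx.names_atMost h⟩
  all_goals
    right
    simp only [DirPath.succs, List.mem_cons, List.not_mem_nil, or_false, exists_eq_left,
      exists_eq_or_imp]
    exact h

theorem mem_exDecls {φ : SHACL I L V N} {d : N × ShEx I L V N} : d ∈ φ.exDecls ↔
    ∃ x ∈ φ.exs, ∃ l ∈ [] :: DirPath.states false x.1, d = (pathName l x.2, pathDecl x.2 l) := by
  simp only [SHACL.exDecls, pathDecls, List.mem_flatMap, List.mem_map]
  exact exists_congr fun x => and_congr_right fun _ => exists_congr fun l =>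
    and_congr_right fun _ => eq_comm

/-- The names used in the translation of a shape, or in the declarations that belong to it, are
declared, if the names of the shape are. -/
theorem names_exDecls {φ : SHACL I L V N} {d : N × ShEx I L V N} (hd : d ∈ φ.exDecls) {n : N}
    (h : n ∈ d.2.names) : (∃ s ∈ φ.names, n = dbl s) ∨ ∃ K, (n, K) ∈ φ.exDecls := by
  obtain ⟨x, hx, l, hl, rfl⟩ := mem_exDecls.1 hd
  rcases names_pathDecl h with ⟨rfl, h⟩ | ⟨l', hl', rfl⟩
  · rcases names_toShEx h with ⟨s, hs, e⟩ | ⟨y, hy, rfl⟩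
    · exact Or.inl ⟨s, names_subset_of_mem_exs hx hs, e⟩
    · exact Or.inr ⟨_, mem_exDecls.2 ⟨y, exs_subset_of_mem_exs hx hy, _,
        List.mem_cons_of_mem _ (DirPath.mem_states_self _ _), rfl⟩⟩
  · refine Or.inr ⟨_, mem_exDecls.2 ⟨x, hx, l', ?_, rfl⟩⟩
    rcases List.mem_cons.1 hl with rfl | hl
    · cases hl'
    · exact List.mem_cons.2 (DirPath.mem_states_of_mem_succs hl hl')

theorem consts_pathDecl {φ : SHACL I L V N} {l : List (DirPath I)} {c : Const I L}
    (h : c ∈ (pathDecl φ l).consts) : l = [] ∧ c ∈ (φ.toShEx false).consts := by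
  rcases l with _ | ⟨⟨_ | _, _ | _ | _ | _ | _ | _⟩, l⟩
  · exact ⟨rfl, h⟩
  all_goals simp [pathDecl, ShEx.consts_atMost, ShEx.consts] at h

theorem consts_toShEx_subset (φ : SHACL I L V N) (b : Bool) : (φ.toShEx b).consts ⊆ φ.consts := by
  induction φ generalizing b with
  | top | bot | test c | testType t => cases b <;> exact fun _ h => h
  | name s => cases b <;> exact fun _ h => h
  | closed Q => cases b <;> exact (ShEx.consts_closedShape Q).le
  | not φ ih => exact ih _
  | and φ ψ ih₁ ih₂ | or φ ψ ih₁ ih₂ => cases b <;> exact Set.union_subset_union (ih₁ _) (ih₂ _)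
  | ge m q φ ih =>
    cases b
    · cases m with
      | zero => exact Set.union_subset (Set.empty_subset _) (ih _)
      | succ m => exact ShEx.consts_atMost.le.trans (ih _)
    · exact ShEx.consts_atLeast.le.trans (ih _)
  | le m q φ ih =>
    cases b
    · exact ShEx.consts_atLeast.le.trans (ih _)
    · exact ShEx.consts_atMost.le.trans (ih _)
  | ex π φ ih => cases b <;> exact Set.empty_subset _

/-- No constant is lost by the translation, although `∃ π.ψ` is replaced by a name: the constants of
`ψ` occur in the declarations that belong to it. -/
theorem mem_consts_toShEx (φ : SHACL I L V N) (b : Bool) {c : Const I L} (h : c ∈ φ.consts) :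
    c ∈ (φ.toShEx b).consts ∨ ∃ d ∈ φ.exDecls, c ∈ d.2.consts := by
  have mono {φ ψ : SHACL I L V N} (h : φ.exs ⊆ ψ.exs) :
      (∃ d ∈ φ.exDecls, c ∈ d.2.consts) → ∃ d ∈ ψ.exDecls, c ∈ d.2.consts := by
    rintro ⟨d, hd, hc⟩
    obtain ⟨x, hx, hd⟩ := mem_exDecls.1 hd
    exact ⟨d, mem_exDecls.2 ⟨x, h hx, hd⟩, hc⟩
  induction φ generalizing b with
  | top | bot | testType t | name s | closed Q => cases h
  | test c => cases b <;> exact Or.inl h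
  | not φ ih => exact ih _ h
  | and φ ψ ih₁ ih₂ | or φ ψ ih₁ ih₂ =>
    rcases h with h | h
    · refine (ih₁ b h).imp (fun h => ?_) (mono (List.subset_append_left _ _))
      cases b <;> exact Or.inl h
    · refine (ih₂ b h).imp (fun h => ?_) (mono (List.subset_append_right _ _))
      cases b <;> exact Or.inr h
  | ge m q φ ih =>
    refine (ih b h).imp_left fun hc => ?_
    cases b
    · cases m with
      | zero => exact Or.inr hc
      | succ m => exact ShEx.consts_atMost.ge hc
    · exact ShEx.consts_atLeast.ge hc
  | le m q φ ih =>
    refine (ih (!b) h).imp_left fun hc => ?_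
    cases b
    · exact ShEx.consts_atLeast.ge hc
    · exact ShEx.consts_atMost.ge hc
  | ex π φ ih =>
    refine Or.inr ?_
    rcases ih false h with h | h
    · exact ⟨_, mem_exDecls.2 ⟨(π, φ), List.mem_cons_self, [], List.mem_cons_self, rfl⟩, h⟩
    · exact mono (List.subset_cons_self _ _) h

end

/-- The sublist in which only the last of several pairs with the same first component is kept. First
components are compared by their codes, which makes the definition computable. -/
def dedupFst {X Y : Type} [Encodable X] : List (X × Y) → List (X × Y)
  | [] => []
  | d :: l => if Encodable.encode d.1 ∈ (dedupFst l).map fun x => Encodable.encode x.1 then dedupFst l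
      else d :: dedupFst l

theorem dedupFst_subset {X Y : Type} [Encodable X] (l : List (X × Y)) : dedupFst l ⊆ l := by
  induction l with
  | nil => exact List.Subset.refl _
  | cons d l ih =>
    rw [dedupFst]
    split_ifs
    · exact List.Subset.trans ih (List.subset_cons_self _ _)
    · exact List.cons_subset_cons _ ih

theorem nodup_dedupFst {X Y : Type} [Encodable X] (l : List (X × Y)) :
    ((dedupFst l).map Prod.fst).Nodup := by
  induction l with
  | nil => exact List.nodup_nil
  | cons d l ih =>
    rw [dedupFst]
    split_ifs with h
    · exact ih
    · rw [List.map_cons, List.nodup_cons]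
      refine ⟨fun hmem => h ?_, ih⟩
      obtain ⟨e, he, hd⟩ := List.mem_map.1 hmem
      exact List.mem_map.2 ⟨e, he, congrArg _ hd⟩

/-- No pair is removed that is not listed again, if first components determine the second ones. -/
theorem mem_dedupFst {X Y : Type} [Encodable X] {l : List (X × Y)}
    (hl : ∀ x y y', (x, y) ∈ l → (x, y') ∈ l → y = y') {d : X × Y} : d ∈ dedupFst l ↔ d ∈ l := by
  refine ⟨fun h => dedupFst_subset l h, fun h => ?_⟩
  induction l with
  | nil => exact h
  | cons e l ih =>
    have ih := ih fun x y y' h h' => hl x y y' (List.mem_cons_of_mem _ h) (List.mem_cons_of_mem _ h')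
    rw [dedupFst]
    split_ifs with hm
    · rcases List.mem_cons.1 h with rfl | h
      · obtain ⟨e, he, hd⟩ := List.mem_map.1 hm
        obtain ⟨x, y⟩ := d
        obtain ⟨x', y'⟩ := e
        obtain rfl : x' = x := Encodable.encode_inj.1 hd
        obtain rfl := hl x' y y' List.mem_cons_self (List.mem_cons_of_mem _ (dedupFst_subset l he))
        exact he
      · exact ih h
    · rcases List.mem_cons.1 h with rfl | h
      · exact List.mem_cons_self
      · exact List.mem_cons_of_mem _ (ih h)

/-! ### From Restricted SHACL to Restricted ShEx: strata -/

namespace SHACL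

/-- `φ.level ρ true` is the least stratum in which `φ` is admissible for `ρ`, except that the negation
of `∃ π.ψ` is put one stratum above `∃ π.ψ`; `φ.level ρ false` is the same for `¬ φ`. -/
def level (ρ : M → ℕ) : SHACL I L V M → Bool → ℕ
  | .top, _ | .bot, _ | .test _, _ | .testType _, _ | .closed _, _ => 0
  | .name s, true => ρ s
  | .name s, false => ρ s + 1
  | .not φ, b => φ.level ρ (!b)
  | .and φ ψ, b | .or φ ψ, b => max (φ.level ρ b) (ψ.level ρ b)
  | .ge _ _ φ, b => φ.level ρ b
  | .le _ _ φ, b => φ.level ρ (!b)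
  | .ex _ φ, true => φ.level ρ true
  | .ex _ φ, false => φ.level ρ true + 1

/-- A bound for the number of strata by which the level of a shape may exceed the strata of its
names. -/
def depth : SHACL I L V M → ℕ
  | .top | .bot | .test _ | .testType _ | .closed _ => 0
  | .name _ => 1
  | .not φ | .ge _ _ φ | .le _ _ φ => φ.depth
  | .and φ ψ | .or φ ψ => max φ.depth ψ.depth
  | .ex _ φ => φ.depth + 1

variable {ρ r : M → ℕ} {i : ℕ}

theorem level_le_add_depth {m : ℕ} (φ : SHACL I L V M) (b : Bool) (h : ∀ s ∈ φ.names, ρ s ≤ m) :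
    φ.level ρ b ≤ m + φ.depth := by
  induction φ generalizing b with
  | top | bot | test | testType | closed => exact Nat.zero_le _
  | name s =>
    have : ρ s ≤ m := h s rfl
    cases b <;> simp only [level, depth] <;> omega
  | not φ ih | ge _ _ φ ih | le _ _ φ ih => exact ih _ h
  | and φ ψ ih₁ ih₂ | or φ ψ ih₁ ih₂ =>
    have := ih₁ b fun s hs => h s (Or.inl hs)
    have := ih₂ b fun s hs => h s (Or.inr hs)
    simp only [level, depth]
    omega
  | ex π φ ih =>
    have := ih true h
    cases b <;> simp only [level, depth] <;> omega

theorem depth_lt_of_mem_exs {φ : SHACL I L V M} {x : Path I × SHACL I L V M} (h : x ∈ φ.exs) :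
    x.2.depth < φ.depth := by
  induction φ with
  | top | bot | test | testType | name | closed => cases h
  | not φ ih | ge _ _ φ ih | le _ _ φ ih => exact ih h
  | and φ ψ ih₁ ih₂ | or φ ψ ih₁ ih₂ =>
    exact (List.mem_append.1 h).elim (fun h => (ih₁ h).trans_le (le_max_left _ _))
      fun h => (ih₂ h).trans_le (le_max_right _ _)
  | ex π φ ih =>
    exact (List.mem_cons.1 h).elim (fun h => h ▸ Nat.lt_succ_self _) fun h => (ih h).trans
      (Nat.lt_succ_self _)

/-- If each stratum is replaced by at least as many strata as the depth of a shape, then the level of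
an admissible shape is not above the last of the strata that replace its own. -/
theorem level_le_of_admissible {K : ℕ} (φ : SHACL I L V M) (b : Bool) (h : φ.Admissible r i b)
    (hK : φ.depth ≤ K) : φ.level (fun s => K * (r s + 1)) b ≤ K * (i + 1) := by
  induction φ generalizing b with
  | top | bot | test | testType | closed => exact Nat.zero_le _
  | name s =>
    cases b
    · have : K * (r s + 1) ≤ K * i := Nat.mul_le_mul_left _ h
      simp only [level, depth, mul_add] at this hK ⊢
      omega
    · exact Nat.mul_le_mul_left _ (Nat.succ_le_succ h)
  | not φ ih | ge _ _ φ ih | le _ _ φ ih => exact ih _ h hK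
  | and φ ψ ih₁ ih₂ | or φ ψ ih₁ ih₂ =>
    exact max_le (ih₁ b h.1 (le_of_max_le_left hK)) (ih₂ b h.2 (le_of_max_le_right hK))
  | ex π φ ih =>
    cases b
    · have := φ.level_le_add_depth (ρ := fun s => K * (r s + 1)) (m := K * i) true
        fun s hs => Nat.mul_le_mul_left _ (h s hs)
      simp only [level, depth, mul_add] at this hK ⊢
      omega
    · exact ih true h (by simp only [depth] at hK; omega)

theorem le_level_of_mem_names (φ : SHACL I L V M) (b : Bool) {s : M} (h : s ∈ φ.names) :
    ρ s ≤ φ.level ρ b := by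
  induction φ generalizing b with
  | top | bot | test | testType | closed => cases h
  | name t =>
    obtain rfl : s = t := h
    cases b <;> simp [level]
  | not φ ih | ge _ _ φ ih | le _ _ φ ih => exact ih _ h
  | and φ ψ ih₁ ih₂ | or φ ψ ih₁ ih₂ =>
    exact h.elim (fun h => (ih₁ b h).trans (le_max_left _ _))
      fun h => (ih₂ b h).trans (le_max_right _ _)
  | ex π φ ih =>
    have := ih true h
    cases b <;> simp only [level] <;> omega

theorem admissible_of_level_le (φ : SHACL I L V M) (b : Bool) (h : φ.level ρ b ≤ i) :
    φ.Admissible ρ i b := by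
  induction φ generalizing b with
  | top | bot | test | testType | closed => trivial
  | name s => cases b <;> exact h
  | not φ ih | ge _ _ φ ih | le _ _ φ ih => exact ih _ h
  | and φ ψ ih₁ ih₂ | or φ ψ ih₁ ih₂ =>
    exact ⟨ih₁ b (le_of_max_le_left h), ih₂ b (le_of_max_le_right h)⟩
  | ex π φ ih =>
    cases b
    · exact fun s hs => (φ.le_level_of_mem_names true hs).trans_lt h
    · exact ih true h

end SHACL

section

variable [Encodable I] [Encodable L] [Encodable V] [Denumerable N]

/-- Since all names of the translation stand for complements, the translation with sign `b` is as
admissible as the shape with the opposite sign. -/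
theorem SHACL.admissible_toShEx {ρ r' : N → ℕ} {i : ℕ} (hdbl : ∀ s, r' (dbl s) = ρ s)
    (hpath : ∀ l (φ : SHACL I L V N), r' (pathName l φ) = φ.level ρ true) (φ : SHACL I L V N)
    (b : Bool) (h : φ.level ρ (!b) ≤ i) : (φ.toShEx b).Admissible r' i true := by
  induction φ generalizing b with
  | top | bot => cases b <;> exact ShEx.admissible_top _
  | test c | testType t => cases b <;> trivial
  | name s =>
    cases b
    · exact (hdbl s).le.trans h
    · exact (hdbl s).trans_lt h
  | closed Q => cases b <;> exact ShEx.admissible_closedShape _ _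
  | not φ ih => exact ih _ h
  | and φ ψ ih₁ ih₂ | or φ ψ ih₁ ih₂ =>
    cases b <;> exact ⟨ih₁ _ (le_of_max_le_left h), ih₂ _ (le_of_max_le_right h)⟩
  | ge n q φ ih =>
    cases b
    · cases n with
      | zero => exact ⟨ShEx.admissible_top _, ih _ h⟩
      | succ n => exact ShEx.admissible_atMost (ih _ h)
    · exact ShEx.admissible_atLeast (ih _ h)
  | le n q φ ih =>
    cases b
    · exact ShEx.admissible_atLeast (ih _ h)
    · exact ShEx.admissible_atMost (ih _ h)
  | ex π φ ih =>
    cases b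
    · exact (hpath _ φ).le.trans h
    · exact (hpath _ φ).trans_lt h

theorem admissible_pathDecl {ρ r' : N → ℕ} (hdbl : ∀ s, r' (dbl s) = ρ s)
    (hpath : ∀ l (φ : SHACL I L V N), r' (pathName l φ) = φ.level ρ true) (φ : SHACL I L V N)
    (l : List (DirPath I)) : (pathDecl φ l).Admissible r' (φ.level ρ true) true := by
  have h l : (ShEx.name (pathName l φ) : ShEx I L V N).Admissible r' (φ.level ρ true) true :=
    (hpath l φ).le
  rcases l with _ | ⟨⟨_ | _, _ | _ | _ | _ | _ | _⟩, l⟩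
  · exact φ.admissible_toShEx hdbl hpath false le_rfl
  case cons.false.pred | cons.true.pred => exact ShEx.admissible_atMost (h _)
  case cons.false.union | cons.true.union | cons.false.star | cons.true.star =>
    exact ⟨h _, h _⟩
  all_goals exact h _

/-- The shape that a selector forbids. -/
def selShape (d : N × SHACL I L V Empty) : SHACL I L V N :=
  .and (d.2.rename Empty.elim) (.not (.name d.1))

/-- The translation of a declaration. -/
def shaclDecl (d : N × SHACL I L V N) : List (N × ShEx I L V N) :=
  (dbl d.1, d.2.toShEx false) :: d.2.exDecls

/-- The declarations for a selector. -/
def shaclSelDecl (d : N × SHACL I L V Empty) : List (N × ShEx I L V N) :=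
  (SHACL.ex .id (selShape d)).exDecls

variable {val : V → Set (Node I L B)}

namespace Schema

variable {S : Schema (restrictedSHACL val) N} {G : Graph I L B} {r : N → ℕ}

/-- The declarations of the translation of a SHACL schema, possibly with repetitions. -/
def shexDecls (S : Schema (restrictedSHACL val) N) : List (N × ShEx I L V N) :=
  S.cat.flatMap shaclDecl ++ S.sel.flatMap shaclSelDecl

theorem names_selShape {d : N × SHACL I L V Empty} : (selShape d).names = {d.1} := by
  simp [selShape, SHACL.names, SHACL.names_rename, Set.eq_empty_of_isEmpty]

theorem mem_shexDecls {d : N × ShEx I L V N} (h : d ∈ S.shexDecls) :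
    (∃ s φ, (s, φ) ∈ S.cat ∧ d = (dbl s, φ.toShEx false)) ∨
      ∃ l φ, φ.names ⊆ S.cat.dom ∧ d = (pathName l φ, pathDecl φ l) := by
  rcases List.mem_append.1 h with h | h
  · obtain ⟨⟨s, φ⟩, hs, h⟩ := List.mem_flatMap.1 h
    rcases List.mem_cons.1 h with rfl | h
    · exact Or.inl ⟨s, φ, hs, rfl⟩
    · obtain ⟨x, hx, l, _, rfl⟩ := mem_exDecls.1 h
      exact Or.inr ⟨l, x.2, (names_subset_of_mem_exs hx).trans (S.declared _ hs), rfl⟩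
  · obtain ⟨e, he, h⟩ := List.mem_flatMap.1 h
    obtain ⟨x, hx, l, _, rfl⟩ := mem_exDecls.1 h
    refine Or.inr ⟨l, x.2, (names_subset_of_mem_exs hx).trans ?_, rfl⟩
    rw [SHACL.names, names_selShape]
    exact Set.singleton_subset_iff.2 (S.sel_declared e he)

theorem functional_shexDecls {n : N} {K K' : ShEx I L V N} (h : (n, K) ∈ S.shexDecls)
    (h' : (n, K') ∈ S.shexDecls) : K = K' := by
  rcases mem_shexDecls h with ⟨s, φ, hs, e⟩ | ⟨l, φ, -, e⟩ <;>
    rcases mem_shexDecls h' with ⟨s', φ', hs', e'⟩ | ⟨l', φ', -, e'⟩ <;>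
    obtain ⟨rfl, rfl⟩ := Prod.mk.inj e <;> obtain ⟨hn, rfl⟩ := Prod.mk.inj e'
  · obtain rfl := dbl_inj.1 hn
    rw [Catalogue.functional_of_nodup S.nodup _ _ _ hs hs']
  · exact absurd hn dbl_ne_pathName
  · exact absurd hn.symm dbl_ne_pathName
  · obtain ⟨rfl, rfl⟩ := pathName_inj.1 hn
    rfl

theorem mem_dedupFst_shexDecls {d : N × ShEx I L V N} :
    d ∈ dedupFst S.shexDecls ↔ d ∈ S.shexDecls :=
  mem_dedupFst fun _ _ _ h h' => functional_shexDecls h h'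

theorem exists_mem_shexDecls {s : N} (hs : s ∈ S.cat.dom) : ∃ K, (dbl s, K) ∈ S.shexDecls := by
  obtain ⟨φ, hφ⟩ := hs
  exact ⟨_, List.mem_append_left _ (List.mem_flatMap.2 ⟨_, hφ, List.mem_cons_self⟩)⟩

/-- The translation of SHACL schemas to ShEx schemas. A selector `s : τ` is replaced by one that asks
all nodes of the domain to satisfy the name `pathName [] (τ ∧ ¬ s)`, which excludes `τ ∧ ¬ s`. -/
def toShEx (S : Schema (restrictedSHACL val) N) : Schema (restrictedShEx val) N where
  cat := dedupFst S.shexDecls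
  nodup := nodup_dedupFst _
  declared := by
    intro d hd n hn
    suffices ∃ K, (n, K) ∈ S.shexDecls from
      this.imp fun K h => mem_dedupFst_shexDecls.2 h
    rcases List.mem_append.1 (mem_dedupFst_shexDecls.1 hd) with h | h
    · obtain ⟨⟨s, φ⟩, hs, h⟩ := List.mem_flatMap.1 h
      have hex {K : ShEx I L V N} (h : (n, K) ∈ φ.exDecls) : (n, K) ∈ S.shexDecls :=
        List.mem_append_left _ (List.mem_flatMap.2 ⟨_, hs, List.mem_cons_of_mem _ h⟩)
      rcases List.mem_cons.1 h with rfl | h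
      · rcases names_toShEx hn with ⟨t, ht, rfl⟩ | ⟨x, hx, rfl⟩
        · exact exists_mem_shexDecls (S.declared _ hs t ht)
        · exact ⟨_, hex (mem_exDecls.2 ⟨x, hx, _,
            List.mem_cons_of_mem _ (DirPath.mem_states_self _ _), rfl⟩)⟩
      · rcases names_exDecls h hn with ⟨t, ht, rfl⟩ | ⟨K, hK⟩
        · exact exists_mem_shexDecls (S.declared _ hs t ht)
        · exact ⟨K, hex hK⟩
    · obtain ⟨e, he, h⟩ := List.mem_flatMap.1 h
      rcases names_exDecls h hn with ⟨t, ht, rfl⟩ | ⟨K, hK⟩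
      · rw [SHACL.names, names_selShape] at ht
        obtain rfl : t = e.1 := ht
        exact exists_mem_shexDecls (S.sel_declared e he)
      · exact ⟨K, List.mem_append_right _ (List.mem_flatMap.2 ⟨e, he, hK⟩)⟩
  sel := S.sel.map fun d => (pathName [] (selShape d), .top)
  sel_declared := by
    intro d hd
    obtain ⟨e, he, rfl⟩ := List.mem_map.1 hd
    exact ⟨_, mem_dedupFst_shexDecls.2 (List.mem_append_right _ (List.mem_flatMap.2 ⟨e, he,
      mem_exDecls.2 ⟨_, List.mem_cons_self, _, List.mem_cons_self, rfl⟩⟩))⟩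

theorem toShEx_consts : S.toShEx.consts = S.consts := by
  ext c
  constructor
  · rintro (⟨d, hd, hc⟩ | ⟨d, hd, hc⟩)
    · have ex {φ : SHACL I L V N} (hd : d ∈ φ.exDecls) : c ∈ φ.consts := by
        obtain ⟨x, hx, l, _, rfl⟩ := mem_exDecls.1 hd
        exact consts_subset_of_mem_exs hx (consts_toShEx_subset _ _ (consts_pathDecl hc).2)
      rcases List.mem_append.1 (mem_dedupFst_shexDecls.1 hd) with h | h
      · obtain ⟨⟨s, φ⟩, hs, h⟩ := List.mem_flatMap.1 h
        refine Or.inl ⟨_, hs, ?_⟩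
        rcases List.mem_cons.1 h with rfl | h
        · exact consts_toShEx_subset _ _ hc
        · exact ex h
      · obtain ⟨e, he, h⟩ := List.mem_flatMap.1 h
        refine Or.inr ⟨e, he, ?_⟩
        have := ex h
        simpa [SHACL.consts, selShape, SHACL.consts_rename] using this
    · obtain ⟨e, he, rfl⟩ := List.mem_map.1 hd
      exact absurd hc (by simp [ShEx.consts_top])
  · rintro (⟨⟨s, φ⟩, hs, hc⟩ | ⟨d, hd, hc⟩)
    · rcases mem_consts_toShEx φ false hc with h | ⟨e, he, h⟩
      · exact Or.inl ⟨_, mem_dedupFst_shexDecls.2 (List.mem_append_left _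
          (List.mem_flatMap.2 ⟨_, hs, List.mem_cons_self⟩)), h⟩
      · exact Or.inl ⟨e, mem_dedupFst_shexDecls.2 (List.mem_append_left _
          (List.mem_flatMap.2 ⟨_, hs, List.mem_cons_of_mem _ he⟩)), h⟩
    · have hc : c ∈ (SHACL.ex .id (selShape d)).consts := by
        simpa [SHACL.consts, selShape, SHACL.consts_rename] using hc
      obtain ⟨e, he, h⟩ := (mem_consts_toShEx _ false hc).resolve_left id
      exact Or.inl ⟨e, mem_dedupFst_shexDecls.2 (List.mem_append_right _
          (List.mem_flatMap.2 ⟨_, hd, he⟩)), h⟩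

theorem toShEx_domain : S.toShEx.domain G = S.domain G := by
  rw [domain, toShEx_consts, domain]

/-- The strata of the translation. The strata of `ρ` should be far enough apart to leave room for
the levels of shapes. -/
noncomputable def toShExStrat (I L V : Type) [Encodable I] [Encodable L] [Encodable V] (ρ : N → ℕ) :
    N → ℕ :=
  Function.extend (fun x : List (DirPath I) × SHACL I L V N => pathName x.1 x.2)
    (fun x => x.2.level ρ true) fun n => ρ (halve n)

theorem toShExStrat_dbl {ρ : N → ℕ} (s : N) : toShExStrat I L V ρ (dbl s) = ρ s := by
  rw [toShExStrat, Function.extend_apply', halve_dbl]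
  rintro ⟨x, h⟩
  exact dbl_ne_pathName h.symm

theorem toShExStrat_pathName {ρ : N → ℕ} (l : List (DirPath I)) (φ : SHACL I L V N) :
    toShExStrat I L V ρ (pathName l φ) = φ.level ρ true := by
  have hinj : Function.Injective fun x : List (DirPath I) × SHACL I L V N => pathName (N := N) x.1 x.2 :=
    fun x y h => Prod.ext (pathName_inj.1 h).1 (pathName_inj.1 h).2
  exact hinj.extend_apply (fun x => x.2.level ρ true) _ (l, φ)

theorem toShEx_isStratification {ρ : N → ℕ}
    (hρ : ∀ d ∈ S.cat, SHACL.level ρ d.2 true ≤ ρ d.1) :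
    S.toShEx.cat.IsStratification (toShExStrat I L V ρ) := by
  intro d hd
  rcases mem_shexDecls (mem_dedupFst_shexDecls.1 hd) with ⟨s, φ, hs, rfl⟩ | ⟨l, φ, -, rfl⟩
  · refine φ.admissible_toShEx toShExStrat_dbl toShExStrat_pathName false ?_
    rw [toShExStrat_dbl]
    exact hρ _ hs
  · have := admissible_pathDecl (ρ := ρ) toShExStrat_dbl toShExStrat_pathName φ l
    rwa [← toShExStrat_pathName l φ] at this

/-- A stratification can be spread so as to leave room for the levels of the shapes. -/
theorem exists_level_le (hr : S.cat.IsStratification r) :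
    ∃ K, 0 < K ∧ ∀ d ∈ S.cat, SHACL.level (fun s => K * (r s + 1)) d.2 true ≤ K * (r d.1 + 1) := by
  obtain ⟨K, hK⟩ : ∃ K, ∀ d ∈ S.cat, SHACL.depth d.2 ≤ K := by
    induction S.cat with
    | nil => exact ⟨0, fun d hd => by cases hd⟩
    | cons e l ih =>
      obtain ⟨K, hK⟩ := ih
      refine ⟨max (SHACL.depth e.2) K, fun d hd => ?_⟩
      rcases List.mem_cons.1 hd with rfl | hd
      · exact le_max_left _ _
      · exact (hK d hd).trans (le_max_right _ _)
  exact ⟨K + 1, K.succ_pos, fun d hd => SHACL.level_le_of_admissible _ _ (hr d hd)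
    ((hK d hd).trans K.le_succ)⟩

end Schema

end

/-! ### From Restricted SHACL to Restricted ShEx: semantics -/

theorem DirPath.rel_star {G : Graph I L B} {d : Bool} {π : Path I} {v w : Node I L B} :
    DirPath.rel G (d, .star π) v w ↔ Relation.ReflTransGen (DirPath.rel G (d, π)) v w := by
  cases d
  · rfl
  · exact Relation.reflTransGen_swap.symm

section

variable [Encodable I] [Encodable L] [Encodable V] [Denumerable N]
  {val : V → Set (Node I L B)} {D : Set (Node I L B)} {G : Graph I L B}
  {γ : N → Set (Node I L B)}

/-- The intended meaning of the names of the translation, for a given assignment to the names of the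
SHACL schema. The condition on a name depends on its form, and at most one of them is relevant. -/
def intended (val : V → Set (Node I L B)) (D : Set (Node I L B)) (G : Graph I L B)
    (γ : N → Set (Node I L B)) (n : N) : Set (Node I L B) :=
  {v ∈ D | (∀ s, n = dbl s → v ∉ γ s) ∧ ∀ l (φ : SHACL I L V N), n = pathName l φ →
    ∀ w, DirPath.relList G l v w → w ∉ φ.sem val D G γ}

theorem intended_dbl (s : N) : intended val D G γ (dbl s) = D \ γ s := by
  ext v
  refine and_congr_right fun _ => ⟨fun h => h.1 s rfl, fun h => ⟨fun t e => ?_, fun l φ e => ?_⟩⟩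
  · rwa [← dbl_inj.1 e]
  · exact absurd e dbl_ne_pathName

theorem mem_intended_pathName {l : List (DirPath I)} {φ : SHACL I L V N} {v : Node I L B} :
    v ∈ intended val D G γ (pathName l φ) ↔
      v ∈ D ∧ ∀ w, DirPath.relList G l v w → w ∉ φ.sem val D G γ := by
  refine and_congr_right fun _ => ⟨fun h => h.2 l φ rfl, fun h => ⟨fun t e => ?_, fun l φ e => ?_⟩⟩
  · exact absurd e.symm dbl_ne_pathName
  · obtain ⟨rfl, rfl⟩ := pathName_inj.1 e
    exact h

/-- A consistent assignment to the names of the translation propagates along path expressions. -/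
theorem mem_pathName_of_rel (hD : G.nodes ⊆ D) {β : N → Set (Node I L B)}
    {φ : SHACL I L V N}
    (hβ : ∀ l, β (pathName l φ) ⊆ (pathDecl φ l).sem val D G β) (π : Path I) {d : Bool}
    {l : List (DirPath I)} {v w : Node I L B} (h : DirPath.rel G (d, π) v w)
    (hv : v ∈ β (pathName ((d, π) :: l) φ)) : w ∈ β (pathName l φ) := by
  induction π generalizing d l v w with
  | id =>
    have hv := hβ _ hv
    cases d <;> simp only [DirPath.rel, Path.rel] at h <;> subst h <;>
      simpa [pathDecl, ShEx.sem] using hv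
  | pred p =>
    have hv := hβ _ hv
    cases d <;> rw [pathDecl, ShEx.mem_sem_atMost_zero hD] at hv <;>
      simpa [ShEx.sem] using hv.2 w h
  | inv π ih =>
    have hv := hβ _ hv
    rw [pathDecl, ShEx.sem] at hv
    refine ih (d := !d) ?_ hv
    cases d <;> exact h
  | comp π₁ π₂ ih₁ ih₂ =>
    have hv := hβ _ hv
    cases d <;> rw [pathDecl, ShEx.sem] at hv <;> obtain ⟨u, h₁, h₂⟩ := h
    · exact ih₂ (d := false) h₂ (ih₁ (d := false) h₁ hv)
    · exact ih₁ (d := true) h₁ (ih₂ (d := true) h₂ hv)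
  | union π₁ π₂ ih₁ ih₂ =>
    have hv := hβ _ hv
    rw [pathDecl, ShEx.sem, ShEx.sem, ShEx.sem] at hv
    cases d
    · exact h.elim (fun h => ih₁ (d := false) h hv.1) fun h => ih₂ (d := false) h hv.2
    · exact h.elim (fun h => ih₁ (d := true) h hv.1) fun h => ih₂ (d := true) h hv.2
  | star π ih =>
    have hstep {v : Node I L B} (hv : v ∈ β (pathName ((d, .star π) :: l) φ)) :
        v ∈ β (pathName l φ) ∩ β (pathName ((d, π) :: (d, .star π) :: l) φ) := by
      have hv := hβ _ hv
      rwa [pathDecl, ShEx.sem, ShEx.sem, ShEx.sem] at hv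
    rw [DirPath.rel_star] at h
    induction h using Relation.ReflTransGen.head_induction_on with
    | refl => exact (hstep hv).1
    | head hx _ ih' => exact ih' (ih hx (hstep hv).2)

theorem mem_pathName_nil_of_relList (hD : G.nodes ⊆ D) {β : N → Set (Node I L B)}
    {φ : SHACL I L V N}
    (hβ : ∀ l, β (pathName l φ) ⊆ (pathDecl φ l).sem val D G β) {l : List (DirPath I)}
    {v w : Node I L B} (h : DirPath.relList G l v w) (hv : v ∈ β (pathName l φ)) :
    w ∈ β (pathName [] φ) := by
  induction l generalizing v with
  | nil => rwa [← show v = w from h]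
  | cons e l ih =>
    obtain ⟨u, hu, h⟩ := h
    exact ih h (mem_pathName_of_rel hD hβ e.2 hu hv)

variable (hD : G.nodes ⊆ D) (hγ : ∀ s, γ s ⊆ D)

include hD hγ

/-- Under the intended assignment, the translation of a shape has the intended meaning. -/
theorem SHACL.sem_toShEx (φ : SHACL I L V N) (b : Bool) (hφ : ∀ c ∈ φ.consts, c.toNode B ∈ D) :
    (φ.toShEx b).sem val D G (intended val D G γ) =
      if b then φ.sem val D G γ else D \ φ.sem val D G γ := by
  have hsub {φ : SHACL I L V N} (hφ : ∀ c ∈ φ.consts, c.toNode B ∈ D) : φ.sem val D G γ ⊆ D :=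
    SHACL.sem_subset hφ hγ
  induction φ generalizing b with
  | top => cases b <;> simp [toShEx, sem, ShEx.sem, ShEx.sem_top]
  | bot => cases b <;> simp [toShEx, sem, ShEx.sem, ShEx.sem_top]
  | test c => cases b <;> simp [toShEx, sem, ShEx.sem]
  | testType t => cases b <;> simp [toShEx, sem, ShEx.sem]
  | name s =>
    cases b <;> simp [toShEx, sem, ShEx.sem, intended_dbl, Set.inter_eq_right.2 (hγ s)]
  | closed Q =>
    have : (ShEx.closedShape Q : ShEx I L V N).sem val D G (intended val D G γ) =
        (closed Q : SHACL I L V N).sem val D G γ := Set.ext fun v => ShEx.mem_sem_closedShape hD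
    cases b <;> simp [toShEx, ShEx.sem, this]
  | not φ ih =>
    have := hsub (φ := φ) hφ
    cases b <;> simp [toShEx, sem, ih _ hφ, Set.inter_eq_right.2 this]
  | and φ ψ ih₁ ih₂ =>
    have h₁ : ∀ c ∈ φ.consts, c.toNode B ∈ D := fun c hc => hφ c (Or.inl hc)
    have h₂ : ∀ c ∈ ψ.consts, c.toNode B ∈ D := fun c hc => hφ c (Or.inr hc)
    cases b <;> simp [toShEx, sem, ShEx.sem, ih₁ _ h₁, ih₂ _ h₂, Set.sdiff_inter]
  | or φ ψ ih₁ ih₂ =>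
    have h₁ : ∀ c ∈ φ.consts, c.toNode B ∈ D := fun c hc => hφ c (Or.inl hc)
    have h₂ : ∀ c ∈ ψ.consts, c.toNode B ∈ D := fun c hc => hφ c (Or.inr hc)
    cases b
    · simp only [toShEx, sem, ShEx.sem, ih₁ _ h₁, ih₂ _ h₂, Bool.false_eq_true, if_false]
      exact sdiff_sup.symm
    · simp [toShEx, sem, ShEx.sem, ih₁ _ h₁, ih₂ _ h₂]
  | ge n q φ ih =>
    cases b
    · cases n with
      | zero =>
        simp [toShEx, sem, ShEx.sem, ShEx.sem_top]
      | succ n =>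
        ext v
        rw [toShEx, ShEx.mem_sem_atMost hD, ih _ hφ]
        have : {u | q.rel G v u ∧ u ∉ D \ φ.sem val D G γ} =
            {u | q.rel G v u ∧ u ∈ φ.sem val D G γ} :=
          Set.ext fun u => and_congr_right fun h => by simp [hD (Step.rel_mem_nodes h)]
        rw [if_neg Bool.false_ne_true, if_neg Bool.false_ne_true, this]
        refine and_congr_right fun h => ?_
        simp [sem, h]
    · ext v
      rw [toShEx, ShEx.mem_sem_atLeast, ih _ hφ]
      rfl
  | le n q φ ih =>
    cases b
    · ext v
      rw [toShEx, ShEx.mem_sem_atLeast, ih _ hφ]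
      simp only [Bool.false_eq_true, if_false, if_true, sem, Set.mem_sdiff, Set.mem_ofPred_eq,
        not_and, not_le, Nat.succ_le_iff]
      tauto
    · ext v
      rw [toShEx, ShEx.mem_sem_atMost hD, ih _ hφ]
      have : {u | q.rel G v u ∧ u ∉ D \ φ.sem val D G γ} =
          {u | q.rel G v u ∧ u ∈ φ.sem val D G γ} :=
        Set.ext fun u => and_congr_right fun h => by simp [hD (Step.rel_mem_nodes h)]
      simp only [Bool.false_eq_true, if_false, if_true, this, sem, Set.mem_ofPred_eq]
  | ex π φ ih =>
    have key : intended val D G γ (pathName [(false, π)] φ) = D \ (ex π φ).sem val D G γ := by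
      ext v
      rw [mem_intended_pathName]
      simp only [DirPath.relList, DirPath.rel, sem, Set.mem_sdiff, Set.mem_ofPred_eq, not_and,
        not_exists, exists_eq_right]
      tauto
    have hs : (ex π φ).sem val D G γ ⊆ D := Set.sep_subset _ _
    cases b
    · simp [toShEx, ShEx.sem, key]
    · simp [toShEx, ShEx.sem, key, Set.inter_eq_right.2 hs]

/-- Under the intended assignment, the declarations of the names of the translation are correct. -/
theorem sem_pathDecl (φ : SHACL I L V N) (hφ : ∀ c ∈ φ.consts, c.toNode B ∈ D)
    (l : List (DirPath I)) : (pathDecl φ l).sem val D G (intended val D G γ) =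
      intended val D G γ (pathName l φ) := by
  ext v
  rw [mem_intended_pathName]
  rcases l with _ | ⟨⟨d, _ | p | π | ⟨π₁, π₂⟩ | ⟨π₁, π₂⟩ | π⟩, l⟩
  · rw [pathDecl, φ.sem_toShEx hD hγ false hφ]
    simp [DirPath.relList]
  · cases d <;>
      simp [pathDecl, ShEx.sem, mem_intended_pathName, DirPath.relList, DirPath.rel, Path.rel]
  · cases d <;> rw [pathDecl, ShEx.mem_sem_atMost_zero hD] <;> refine and_congr_right fun _ => ?_ <;>
      simp only [ShEx.sem, mem_intended_pathName, DirPath.relList, DirPath.rel, Path.rel] <;>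
      exact ⟨fun h w ⟨u, hu, hw⟩ => (h u hu).2 w hw, fun h u hu =>
        ⟨hD (Step.rel_mem_nodes hu), fun w hw => h w ⟨u, hu, hw⟩⟩⟩
  · cases d <;>
      simp [pathDecl, ShEx.sem, mem_intended_pathName, DirPath.relList, DirPath.rel, Path.rel]
  · cases d <;>
      simp only [pathDecl, ShEx.sem, mem_intended_pathName, DirPath.relList, DirPath.rel, Path.rel] <;>
      refine and_congr_right fun _ => ⟨?_, ?_⟩
    · exact fun h w ⟨u, ⟨x, hx, hu⟩, hw⟩ => h w ⟨x, hx, u, hu, hw⟩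
    · exact fun h w ⟨x, hx, u, hu, hw⟩ => h w ⟨u, ⟨x, hx, hu⟩, hw⟩
    · exact fun h w ⟨u, ⟨x, hx, hu⟩, hw⟩ => h w ⟨x, hu, u, hx, hw⟩
    · exact fun h w ⟨x, hu, u, hx, hw⟩ => h w ⟨u, ⟨x, hx, hu⟩, hw⟩
  · cases d <;>
      simp only [pathDecl, ShEx.sem, Set.mem_inter_iff, mem_intended_pathName, DirPath.relList,
        DirPath.rel, Path.rel, ← and_and_left] <;>
      refine and_congr_right fun _ => ⟨fun h w ⟨u, hu, hw⟩ => ?_, fun h =>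
        ⟨fun w ⟨u, hu, hw⟩ => h w ⟨u, Or.inl hu, hw⟩, fun w ⟨u, hu, hw⟩ => h w ⟨u, Or.inr hu, hw⟩⟩⟩ <;>
      exact hu.elim (fun hu => h.1 w ⟨u, hu, hw⟩) fun hu => h.2 w ⟨u, hu, hw⟩
  · rw [pathDecl]
    simp only [ShEx.sem, Set.mem_inter_iff, mem_intended_pathName, ← and_and_left]
    simp only [DirPath.relList, DirPath.rel_star]
    refine and_congr_right fun _ => ⟨fun h w ⟨u, hu, hw⟩ => ?_, fun h =>
      ⟨fun w hw => h w ⟨v, .refl, hw⟩, fun w ⟨x, hx, u, hu, hw⟩ => h w ⟨u, .head hx hu, hw⟩⟩⟩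
    rcases hu.cases_head with rfl | ⟨x, hx, hu⟩
    · exact h.1 w hw
    · exact h.2 w ⟨x, hx, u, hu, hw⟩

end

section

variable [Encodable I] [Encodable L] [Encodable V] [Denumerable N]

namespace Schema

variable {val : V → Set (Node I L B)} {S : Schema (restrictedSHACL val) N} {G : Graph I L B}
  {r ρ : N → ℕ} {α : N → Set (Node I L B)}

theorem mem_dom_toShEx_dbl {s : N} : dbl s ∈ S.toShEx.cat.dom ↔ s ∈ S.cat.dom := by
  constructor
  · rintro ⟨K, hK⟩
    rcases mem_shexDecls (mem_dedupFst_shexDecls.1 hK) with ⟨t, φ, ht, e⟩ | ⟨l, φ, -, e⟩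
    · rw [dbl_inj.1 (Prod.mk.inj e).1]
      exact ⟨φ, ht⟩
    · exact absurd (Prod.mk.inj e).1 dbl_ne_pathName
  · intro hs
    obtain ⟨K, hK⟩ := exists_mem_shexDecls hs
    exact ⟨K, mem_dedupFst_shexDecls.2 hK⟩

theorem mem_toShEx_pathName {l : List (DirPath I)} {φ : SHACL I L V N} {K : ShEx I L V N}
    (h : (pathName l φ, K) ∈ S.toShEx.cat) : φ.names ⊆ S.cat.dom ∧ K = pathDecl φ l := by
  rcases mem_shexDecls (mem_dedupFst_shexDecls.1 h) with ⟨t, φ, ht, e⟩ | ⟨l, φ, hφ, e⟩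
  · exact absurd (Prod.mk.inj e).1.symm dbl_ne_pathName
  · obtain ⟨hn, rfl⟩ := Prod.mk.inj e
    obtain ⟨rfl, rfl⟩ := pathName_inj.1 hn
    exact ⟨hφ, rfl⟩

theorem mem_toShEx_dbl {s : N} {φ : SHACL I L V N} (h : (s, φ) ∈ S.cat) :
    (dbl s, φ.toShEx false) ∈ S.toShEx.cat :=
  mem_dedupFst_shexDecls.2
    (List.mem_append_left _ (List.mem_flatMap.2 ⟨_, h, List.mem_cons_self⟩))

theorem consts_subset_of_mem_shexDecls {l : List (DirPath I)} {φ : SHACL I L V N}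
    {K : ShEx I L V N} (h : (pathName l φ, K) ∈ S.shexDecls) : φ.consts ⊆ S.consts := by
  have ex {ψ : SHACL I L V N} (h : (pathName l φ, K) ∈ ψ.exDecls) : φ.consts ⊆ ψ.consts := by
    obtain ⟨x, hx, l', _, e⟩ := mem_exDecls.1 h
    rw [(pathName_inj.1 (Prod.mk.inj e).1).2]
    exact consts_subset_of_mem_exs hx
  rcases List.mem_append.1 h with h | h
  · obtain ⟨⟨s, ψ⟩, hs, h⟩ := List.mem_flatMap.1 h
    rcases List.mem_cons.1 h with e | h
    · exact absurd (Prod.mk.inj e).1.symm dbl_ne_pathName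
    · exact fun c hc => Or.inl ⟨_, hs, ex h hc⟩
  · obtain ⟨e, he, h⟩ := List.mem_flatMap.1 h
    refine fun c hc => Or.inr ⟨e, he, ?_⟩
    have := ex h hc
    simpa [SHACL.consts, selShape, SHACL.consts_rename] using this

/-- The assignment to the names of the translation: the intended one, restricted to declared names. -/
def toShExAssign (S : Schema (restrictedSHACL val) N) (G : Graph I L B) (α : N → Set (Node I L B))
    (n : N) : Set (Node I L B) :=
  {v ∈ intended val (S.domain G) G α n | n ∈ S.toShEx.cat.dom}

theorem toShExAssign_of_mem {n : N} (h : n ∈ S.toShEx.cat.dom) :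
    toShExAssign S G α n = intended val (S.domain G) G α n :=
  Set.ext fun _ => and_iff_left h

theorem toShExAssign_of_notMem {n : N} (h : n ∉ S.toShEx.cat.dom) : toShExAssign S G α n = ∅ :=
  Set.eq_empty_of_forall_notMem fun _ hv => h hv.2

theorem op_toShEx_toShExAssign (hα : S.cat.op (S.domain G) G α = α) :
    S.toShEx.cat.op (S.domain G) G (toShExAssign S G α) = toShExAssign S G α := by
  have hsub : ∀ s, α s ⊆ S.domain G := subset_domain_of_fixed (restrictedSHACL_lawful val) hα
  have hlaw := restrictedShEx_lawful val
  have hfun : S.toShEx.cat.Functional := Catalogue.functional_of_nodup S.toShEx.nodup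
  have hD : G.nodes ⊆ S.domain G := Set.subset_union_left
  funext n
  by_cases hn : n ∈ S.toShEx.cat.dom
  swap
  · rw [Catalogue.op_eq_empty hn, toShExAssign_of_notMem hn]
  obtain ⟨K, hK⟩ := hn
  rw [Catalogue.op_eq_of_subset hfun hK fun t v hv => hv.1.1, toShExAssign_of_mem ⟨K, hK⟩,
    hlaw.sem_congr (β := intended val (S.domain G) G α) K fun t ht =>
      toShExAssign_of_mem (S.toShEx.declared _ hK t ht)]
  have hK := mem_dedupFst_shexDecls.1 hK
  rcases mem_shexDecls hK with ⟨s, φ, hs, e⟩ | ⟨l, φ, -, e⟩ <;>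
    obtain ⟨rfl, rfl⟩ := Prod.mk.inj e
  · refine (φ.sem_toShEx hD hsub false fun c hc => mem_domain_of_cat hs hc).trans ?_
    rw [if_neg Bool.false_ne_true, intended_dbl]
    conv_rhs => rw [← hα,
      Catalogue.op_eq_of_subset (Catalogue.functional_of_nodup S.nodup) hs hsub]
  · exact sem_pathDecl hD hsub φ
      (fun c hc => Or.inr ⟨c, consts_subset_of_mem_shexDecls hK hc, rfl⟩) l

/-- The intended assignment is the iterated greatest fixed point. Any post-fixed point `β` of a stratum
gives, by complementation on the names `dbl s`, a pre-fixed point of the SHACL catalogue, and is bounded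
on the names `pathName l φ` by propagation along the path expressions in `l`. -/
theorem toShExAssign_iteratedLFP {K : ℕ} (hK : 0 < K)
    (hρ : ∀ d ∈ S.cat, SHACL.level (fun s => K * (r s + 1)) d.2 true ≤ K * (r d.1 + 1))
    (hα : IteratedLFP (S.cat.op (S.domain G) G) r α) :
    IteratedLFP (P := (Set (Node I L B))ᵒᵈ) (S.toShEx.cat.op (S.domain G) G)
      (toShExStrat I L V fun s => K * (r s + 1)) (toShExAssign S G α) := by
  have hsub : ∀ s, α s ⊆ S.domain G := subset_domain_of_fixed (restrictedSHACL_lawful val) hα.1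
  have hlaw := restrictedShEx_lawful val
  have hfun : S.toShEx.cat.Functional := Catalogue.functional_of_nodup S.toShEx.nodup
  have hfun' : S.cat.Functional := Catalogue.functional_of_nodup S.nodup
  have hD : G.nodes ⊆ S.domain G := Set.subset_union_left
  set D := S.domain G with hDdef
  set ρ : N → ℕ := fun s => K * (r s + 1) with hρdef
  have hempty : ∀ s, s ∉ S.cat.dom → α s = ∅ := fun s hs => by
    rw [← hα.1]
    exact Catalogue.op_eq_empty hs
  refine ⟨op_toShEx_toShExAssign hα.1, fun i (β : N → Set (Node I L B)) h₁ h₂ => ?_⟩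
  replace h₂ : ∀ n, toShExStrat I L V ρ n = i → β n ⊆ S.toShEx.cat.op D G β n := h₂
  have hβdom : ∀ n, toShExStrat I L V ρ n ≤ i → ∀ v ∈ β n, v ∈ D ∧ n ∈ S.toShEx.cat.dom := by
    intro n hn v hv
    rcases hn.lt_or_eq with hn | hn
    · rw [h₁ n hn] at hv
      exact ⟨hv.1.1, hv.2⟩
    · have hv := h₂ n hn hv
      refine ⟨?_, ?_⟩
      · rw [hDdef, ← toShEx_domain] at hv ⊢
        exact Catalogue.op_subset hlaw (fun d hd c hc => mem_domain_of_cat hd hc) n hv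
      · obtain ⟨K, hK, _⟩ := hv
        exact ⟨K, hK⟩
  -- The assignment to the names of the SHACL schema that corresponds to `β`.
  let γ : N → Set (Node I L B) := fun s => {v | s ∈ S.cat.dom ∧ v ∈ D \ β (dbl s)}
  have hγsub : ∀ s, γ s ⊆ D := fun s v hv => hv.2.1
  have hγ : ∀ s ∈ S.cat.dom, γ s = D \ β (dbl s) := fun s hs => Set.ext fun v => and_iff_right hs
  have hγlow : ∀ s, ρ s < i → γ s = α s := by
    intro s hs
    by_cases hsd : s ∈ S.cat.dom
    · rw [hγ s hsd, h₁ (dbl s) (by rwa [toShExStrat_dbl]),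
        toShExAssign_of_mem (mem_dom_toShEx_dbl.2 hsd), intended_dbl, Set.sdiff_sdiff_cancel_left
          (hsub s)]
    · rw [hempty s hsd]
      exact Set.eq_empty_of_forall_notMem fun v hv => hsd hv.1
  have hstep : ∀ n K, toShExStrat I L V ρ n = i → (n, K) ∈ S.toShEx.cat →
      β n ⊆ K.sem val D G β := by
    intro n K hn hK v hv
    obtain ⟨K', hK', hv⟩ := h₂ n hn hv
    obtain rfl := hfun n K K' hK hK'
    have hstrat := toShEx_isStratification (S := S) hρ _ hK
    rw [hn] at hstrat
    exact hlaw.sem_mono K hstrat (fun t _ ht => Set.inter_eq_left.2 fun v hv =>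
      (hβdom t ht.le v hv).1) (fun t _ _ => Set.inter_subset_left) hv
  -- A translated shape holds under `β` only where it holds under the intended assignment.
  have hsem : ∀ (φ : SHACL I L V N) (n : N), (n, φ.toShEx false) ∈ S.toShEx.cat →
      φ.level ρ true ≤ i → φ.names ⊆ S.cat.dom → φ.consts ⊆ S.consts →
      (∀ x ∈ φ.exs, x.2.level ρ true = i → β (pathName [(false, x.1)] x.2) ⊆
        intended val D G γ (pathName [(false, x.1)] x.2)) →
      (φ.toShEx false).sem val D G β ⊆ D \ φ.sem val D G γ := by
    intro φ n₀ hn₀ hφ hdom hc hx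
    have h := φ.sem_toShEx (val := val) hD hγsub false fun c h => Or.inr ⟨c, hc h, rfl⟩
    rw [if_neg Bool.false_ne_true] at h
    rw [← h]
    refine hlaw.sem_mono (φ.toShEx false) (φ.admissible_toShEx (ρ := ρ)
      (r' := toShExStrat I L V ρ) toShExStrat_dbl toShExStrat_pathName false hφ)
      (fun n hn hni => ?_) (fun n hn hni => ?_)
    · rcases names_toShEx hn with ⟨s, hs, rfl⟩ | ⟨x, hx', rfl⟩
      · rw [intended_dbl, hγ s (hdom hs), Set.sdiff_sdiff_cancel_left
          fun v hv => (hβdom _ hni.le v hv).1]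
      · rw [h₁ _ hni, toShExAssign_of_mem (S.toShEx.declared _ hn₀ _ hn)]
        rw [toShExStrat_pathName] at hni
        have hcongr : x.2.sem val D G γ = x.2.sem val D G α :=
          (restrictedSHACL_lawful val).sem_congr x.2 fun s hs =>
            hγlow s ((x.2.le_level_of_mem_names true hs).trans_lt hni)
        ext v
        rw [mem_intended_pathName, mem_intended_pathName, hcongr]
    · rcases names_toShEx hn with ⟨s, hs, rfl⟩ | ⟨x, hx', rfl⟩
      · rw [intended_dbl, hγ s (hdom hs), Set.sdiff_sdiff_cancel_left
          fun v hv => (hβdom _ hni.le v hv).1]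
      · rw [toShExStrat_pathName] at hni
        exact hx x hx' hni
  have hpath : ∀ (φ : SHACL I L V N), φ.level ρ true = i → ∀ l,
      β (pathName l φ) ⊆ intended val D G γ (pathName l φ) := by
    intro φ hφ
    induction hd : φ.depth using Nat.strong_induction_on generalizing φ with
    | _ k ih =>
      subst hd
      intro l v hv
      have hstrat : ∀ l, toShExStrat I L V ρ (pathName l φ) = i := fun l => by
        rw [toShExStrat_pathName, hφ]
      have hdecl : ∀ l v, v ∈ β (pathName l φ) → (pathName l φ, pathDecl φ l) ∈ S.toShEx.cat := by
        intro l v hv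
        obtain ⟨K, hK⟩ := (hβdom _ (hstrat l).le v hv).2
        rwa [(mem_toShEx_pathName hK).2] at hK
      rw [mem_intended_pathName]
      refine ⟨(hβdom _ (hstrat l).le v hv).1, fun w hw => ?_⟩
      have hw := mem_pathName_nil_of_relList hD
        (fun l v hv => hstep _ _ (hstrat l) (hdecl l v hv) hv) hw hv
      have hcat := hdecl _ _ hw
      exact (hsem φ _ hcat hφ.le (mem_toShEx_pathName hcat).1
        (consts_subset_of_mem_shexDecls (mem_dedupFst_shexDecls.1 hcat))
        (fun x hx hxi => ih _ (SHACL.depth_lt_of_mem_exs hx) x.2 hxi rfl _)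
        (hstep _ _ (hstrat []) hcat hw)).2
  have hle : ∀ s, ρ s = i → α s ⊆ γ s := by
    intro s hs
    refine hα.2 (r s) γ (fun t ht => hγlow t ?_) (fun t ht => ?_) s rfl
    · rw [← hs]
      exact Nat.mul_lt_mul_of_pos_left (Nat.succ_lt_succ ht) hK
    · rintro v ⟨φ, hφ, hv⟩
      have hti : ρ t = i := by rw [← hs, hρdef]; simp only [ht]
      have hv : v ∈ φ.sem val D G γ := by
        rwa [show (fun t => γ t ∩ D) = γ from funext fun t => Set.inter_eq_left.2 (hγsub t)] at hv
      refine ⟨⟨φ, hφ⟩, SHACL.sem_subset (fun c hc => mem_domain_of_cat hφ hc) hγsub hv, fun hvβ => ?_⟩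
      exact (hsem φ _ (mem_toShEx_dbl hφ) ((hρ _ hφ).trans hti.le) (S.declared _ hφ)
        (fun c hc => Or.inl ⟨_, hφ, hc⟩) (fun x _ hxi => hpath x.2 hxi _)
        (hstep _ _ (by rw [toShExStrat_dbl, hti]) (mem_toShEx_dbl hφ) hvβ)).2 hv
  intro n hn v hv
  obtain ⟨hvD, hnd⟩ := hβdom n hn.le v hv
  refine ⟨?_, hnd⟩
  obtain ⟨K', hK'⟩ := hnd
  rcases mem_shexDecls (mem_dedupFst_shexDecls.1 hK') with ⟨s, φ, hs, e⟩ | ⟨l, φ, -, e⟩ <;>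
    obtain ⟨rfl, rfl⟩ := Prod.mk.inj e
  · rw [toShExStrat_dbl] at hn
    rw [intended_dbl]
    exact ⟨hvD, fun h => (hle s hn h).2.2 hv⟩
  · rw [toShExStrat_pathName] at hn
    have hv := hpath φ hn l hv
    rw [mem_intended_pathName] at hv ⊢
    exact ⟨hvD, fun w hw hφ => hv.2 w hw (SHACL.sem_mono (φ.admissible_of_level_le true hn.le)
      (fun t _ ht => (hγlow t ht).symm) (fun t _ ht => hle t ht) hφ)⟩

theorem toShEx_stratified (h : S.Stratified) : S.toShEx.Stratified := by
  obtain ⟨r, hr⟩ := h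
  obtain ⟨K, _, hρ⟩ := exists_level_le hr
  exact ⟨_, toShEx_isStratification hρ⟩

theorem lfpConforms_iff_toShEx (hr : S.cat.IsStratification r) :
    S.LFPConforms G ↔ S.toShEx.GFPConforms G := by
  have hlaw := restrictedSHACL_lawful val
  obtain ⟨α, hα⟩ : ∃ α : N → Set (Node I L B), IteratedLFP (S.cat.op (S.domain G) G) r α :=
    (Catalogue.stratifiedOp_op hlaw hr).exists_iteratedLFP
  obtain ⟨K, hK, hρ⟩ := exists_level_le hr
  have hsub : ∀ s, α s ⊆ S.domain G := subset_domain_of_fixed hlaw hα.1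
  have hα' := toShExAssign_iteratedLFP hK hρ hα
  rw [← toShEx_domain] at hα'
  rw [lfpConforms_iff hlaw hr hα, gfpConforms_iff (restrictedShEx_lawful val)
    (toShEx_isStratification hρ) hα']
  refine Iff.trans ?_ List.forall_mem_map.symm
  refine forall₂_congr fun d hd => ?_
  have hmem : pathName [] (selShape d) ∈ S.toShEx.cat.dom :=
    S.toShEx.sel_declared _ (List.mem_map_of_mem hd)
  have hsel : (selShape d).sem val (S.domain G) G α =
      selSem (𝓛 := restrictedSHACL val) (S.domain G) G d.2 ∩ (S.domain G \ α d.1) := by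
    rw [selShape, SHACL.sem, SHACL.sem_rename]
    exact congrArg (· ∩ _) (congrArg (fun γ => d.2.sem val (S.domain G) G γ)
      (funext fun x : Empty => x.elim))
  have hsel' : selSem (𝓛 := restrictedSHACL val) (S.domain G) G d.2 ⊆ S.domain G :=
    hlaw.sem_subset _ (fun c hc => mem_domain_of_sel hd hc) fun x => x.elim
  rw [toShExAssign_of_mem hmem, toShEx_domain,
    show selSem (𝓛 := restrictedShEx val) (S.domain G) G (ShEx.top : ShEx I L V Empty) =
      S.domain G from ShEx.sem_top]
  constructor
  · intro h v hv
    rw [mem_intended_pathName]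
    refine ⟨hv, ?_⟩
    rintro w rfl
    rw [hsel]
    exact fun hw => hw.2.2 (h hw.1)
  · intro h v hv
    have := (mem_intended_pathName.1 (h (hsel' hv))).2 v rfl
    rw [hsel] at this
    by_contra hcon
    exact this ⟨hv, hsel' hv, hcon⟩

end Schema

end

/-! ### Primitive recursive functions on codes -/

attribute [fun_prop] Primrec Primrec.id Primrec.const Primrec.comp Primrec.pair Primrec.fst Primrec.snd

section

variable {α β γ σ : Type} [Primcodable α] [Primcodable β] [Primcodable γ] [Primcodable σ]

@[fun_prop]
theorem primrec_natPair {f g : α → ℕ} (hf : Primrec f) (hg : Primrec g) :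
    Primrec fun x => Nat.pair (f x) (g x) := Primrec₂.natPair.comp hf hg

@[fun_prop]
theorem primrec_unpair {f : α → ℕ} (hf : Primrec f) : Primrec fun x => Nat.unpair (f x) :=
  Primrec.unpair.comp hf

@[fun_prop]
theorem primrec_codeNode (t : ℕ) {f : α → ℕ} (hf : Primrec f) :
    Primrec fun x => codeNode t (f x) :=
  Primrec.succ.comp (primrec_natPair (Primrec.const t) hf)

@[fun_prop]
theorem primrec_encode {f : α → β} (hf : Primrec f) : Primrec fun x => Encodable.encode (f x) :=
  Primrec.encode.comp hf

@[fun_prop]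
theorem primrec_decode_getD {f : α → ℕ} (hf : Primrec f) (b : β) :
    Primrec fun x => (Encodable.decode (α := β) (f x)).getD b :=
  Primrec.option_getD.comp (Primrec.decode.comp hf) (Primrec.const b)

@[fun_prop]
theorem primrec_ite_natEq {f : α → ℕ} {g h : α → β} (k : ℕ) (hf : Primrec f) (hg : Primrec g)
    (hh : Primrec h) : Primrec fun x => if f x = k then g x else h x :=
  Primrec.ite (Primrec.eq.comp hf (Primrec.const k)) hg hh

/-- Recursion along the codes of syntax trees. The step may use the values at the payload and at
those of its components where there may be codes of subtrees. -/
def treeRec (d : σ) (st : ℕ × ℕ × σ × σ × σ × σ → σ) : ℕ → σ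
  | 0 => d
  | n + 1 => st (n.unpair.1, n.unpair.2, treeRec d st n.unpair.2, treeRec d st n.unpair.2.unpair.1,
      treeRec d st n.unpair.2.unpair.2, treeRec d st n.unpair.2.unpair.2.unpair.2)
termination_by n => n
decreasing_by
  all_goals
    have h₁ := Nat.unpair_right_le n
    have h₂ := Nat.unpair_left_le n.unpair.2
    have h₃ := Nat.unpair_right_le n.unpair.2
    have h₄ := Nat.unpair_right_le n.unpair.2.unpair.2
    omega

theorem treeRec_codeNode (d : σ) (st : ℕ × ℕ × σ × σ × σ × σ → σ) (t p : ℕ) :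
    treeRec d st (codeNode t p) = st (t, p, treeRec d st p, treeRec d st p.unpair.1,
      treeRec d st p.unpair.2, treeRec d st p.unpair.2.unpair.2) := by
  rw [codeNode, treeRec]
  simp

theorem primrec_treeRec (d : σ) {st : ℕ × ℕ × σ × σ × σ × σ → σ} (hst : Primrec st) :
    Primrec (treeRec d st) := by
  have get {f : ℕ × List σ → ℕ} (hf : Primrec f) : Primrec fun x : ℕ × List σ => x.2.getD (f x) d :=
    (Primrec.list_getD d).comp Primrec.snd hf
  -- The number whose value is to be computed is the length of the list of the earlier values.
  have hpred : Primrec fun x : ℕ × List σ => x.2.length - 1 :=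
    Primrec.pred.comp (Primrec.list_length.comp Primrec.snd)
  have h := Primrec.nat_strong_rec (α := ℕ) (fun _ n => treeRec d st n)
    (g := fun _ l => some (if l.length = 0 then d else st ((l.length - 1).unpair.1,
      (l.length - 1).unpair.2, l.getD (l.length - 1).unpair.2 d,
      l.getD (l.length - 1).unpair.2.unpair.1 d, l.getD (l.length - 1).unpair.2.unpair.2 d,
      l.getD (l.length - 1).unpair.2.unpair.2.unpair.2 d))) ?_ ?_
  · exact h.comp (Primrec.const 0) Primrec.id
  · refine Primrec.option_some.comp ?_
    refine primrec_ite_natEq 0 (Primrec.list_length.comp Primrec.snd) (Primrec.const d)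
      (hst.comp ?_)
    exact (by fun_prop : Primrec _).pair ((by fun_prop : Primrec _).pair
      ((get (by fun_prop)).pair ((get (by fun_prop)).pair ((get (by fun_prop)).pair
        (get (by fun_prop))))))
  · intro _ n
    cases n with
    | zero => simp [treeRec]
    | succ n =>
      have h₁ := Nat.unpair_right_le n
      have h₂ := Nat.unpair_left_le n.unpair.2
      have h₃ := Nat.unpair_right_le n.unpair.2
      have h₄ := Nat.unpair_right_le n.unpair.2.unpair.2
      have get (m : ℕ) (hm : m ≤ n) :
          ((List.range (n + 1)).map (treeRec d st)).getD m d = treeRec d st m := by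
        rw [List.getD_eq_getElem _ _ (by simpa using Nat.lt_succ_of_le hm)]
        simp
      simp only [List.length_map, List.length_range, Nat.succ_ne_zero, if_false,
        Nat.add_sub_cancel]
      rw [get _ h₁, get _ (h₂.trans h₁), get _ (h₃.trans h₁), get _ (h₄.trans (h₃.trans h₁)),
        treeRec]

end

/-- A representation of the elements of a type by elements of a type on which primitive recursion is
defined. -/
class Coded (X : Type) where
  /-- The type of codes. -/
  Code : Type
  [primcodable : Primcodable Code]
  /-- The code of an element. -/
  toCode : X → Code

attribute [reducible] Coded.primcodable

attribute [instance] Coded.primcodable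

open Coded (Code toCode)

/-- Codes that are numbers. The instances below come later, so that they are preferred for the types to
which they apply. -/
instance codedOfEncodable {X : Type} [Encodable X] : Coded X := ⟨ℕ, Encodable.encode⟩

instance : Coded ℕ := ⟨ℕ, id⟩

instance : Coded Bool := ⟨Bool, id⟩

instance {X Y : Type} [Coded X] [Coded Y] : Coded (X × Y) :=
  ⟨Code X × Code Y, Prod.map toCode toCode⟩

instance {X : Type} [Coded X] : Coded (List X) := ⟨List (Code X), List.map toCode⟩

instance {X : Type} [Coded X] : Coded (Option X) := ⟨Option (Code X), Option.map toCode⟩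

/-- A function is represented on codes by a primitive recursive function. In the rules for this
predicate, functions of several arguments are considered as functions of tuples. -/
@[fun_prop]
def CodedPrimrec {X Y : Type} [Coded X] [Coded Y] (f : X → Y) : Prop :=
  ∃ F : Code X → Code Y, Primrec F ∧ ∀ x, F (toCode x) = toCode (f x)

namespace CodedPrimrec

variable {X Y Z W : Type} [Coded X] [Coded Y] [Coded Z] [Coded W]

@[fun_prop]
theorem id : CodedPrimrec (fun x : X => x) := ⟨_, Primrec.id, fun _ => rfl⟩

@[fun_prop]
theorem const (y : Y) : CodedPrimrec (fun _ : X => y) := ⟨_, Primrec.const _, fun _ => rfl⟩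

@[fun_prop]
theorem comp {g : Y → Z} {f : X → Y} (hg : CodedPrimrec g) (hf : CodedPrimrec f) :
    CodedPrimrec fun x => g (f x) := by
  obtain ⟨G, hG, eG⟩ := hg
  obtain ⟨F, hF, eF⟩ := hf
  exact ⟨_, hG.comp hF, fun x => by rw [eF, eG]⟩

@[fun_prop]
theorem pair {f : X → Y} {g : X → Z} (hf : CodedPrimrec f) (hg : CodedPrimrec g) :
    CodedPrimrec fun x => (f x, g x) := by
  obtain ⟨F, hF, eF⟩ := hf
  obtain ⟨G, hG, eG⟩ := hg
  exact ⟨_, hF.pair hG, fun x => by rw [eF, eG]; rfl⟩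

@[fun_prop]
theorem fst : CodedPrimrec (Prod.fst : X × Y → X) := ⟨_, Primrec.fst, fun _ => rfl⟩

@[fun_prop]
theorem snd : CodedPrimrec (Prod.snd : X × Y → Y) := ⟨_, Primrec.snd, fun _ => rfl⟩

@[fun_prop]
theorem list_cons {f : X → Y} {g : X → List Y} (hf : CodedPrimrec f) (hg : CodedPrimrec g) :
    CodedPrimrec fun x => f x :: g x := by
  obtain ⟨F, hF, eF⟩ := hf
  obtain ⟨G, hG, eG⟩ := hg
  exact ⟨_, Primrec.list_cons.comp hF hG, fun x => by rw [eF, eG]; rfl⟩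

@[fun_prop]
theorem list_append {f g : X → List Y} (hf : CodedPrimrec f) (hg : CodedPrimrec g) :
    CodedPrimrec fun x => f x ++ g x := by
  obtain ⟨F, hF, eF⟩ := hf
  obtain ⟨G, hG, eG⟩ := hg
  exact ⟨_, Primrec.list_append.comp hF hG, fun x => by rw [eF, eG]; exact List.map_append.symm⟩

@[fun_prop]
theorem list_length {f : X → List Y} (hf : CodedPrimrec f) : CodedPrimrec fun x => (f x).length := by
  obtain ⟨F, hF, eF⟩ := hf
  exact ⟨_, Primrec.list_length.comp hF, fun x => by rw [eF]; exact List.length_map _⟩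

@[fun_prop]
theorem list_map {f : X → List Y} {g : X → Y → Z} (hf : CodedPrimrec f)
    (hg : CodedPrimrec fun p : X × Y => g p.1 p.2) : CodedPrimrec fun x => (f x).map (g x) := by
  obtain ⟨F, hF, eF⟩ := hf
  obtain ⟨G, hG, eG⟩ := hg
  refine ⟨_, Primrec.list_map (β := Code Y) hF
    (show Primrec₂ fun (x : Code X) (y : Code Y) => G (x, y) from hG), fun x => ?_⟩
  rw [eF]
  exact List.map_map.trans ((List.map_congr_left fun y _ => eG (x, y)).trans List.map_map.symm)

@[fun_prop]
theorem list_flatten {f : X → List (List Y)} (hf : CodedPrimrec f) :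
    CodedPrimrec fun x => (f x).flatten := by
  obtain ⟨F, hF, eF⟩ := hf
  exact ⟨_, Primrec.list_flatten.comp hF, fun x => by rw [eF]; exact List.map_flatten.symm⟩

@[fun_prop]
theorem list_flatMap {f : X → List Y} {g : X → Y → List Z} (hf : CodedPrimrec f)
    (hg : CodedPrimrec fun p : X × Y => g p.1 p.2) : CodedPrimrec fun x => (f x).flatMap (g x) :=
  (hf.list_map hg).list_flatten

@[fun_prop]
theorem list_foldr {f : X → List Y} {g : X → Z} {h : X → Y → Z → Z} (hf : CodedPrimrec f)
    (hg : CodedPrimrec g) (hh : CodedPrimrec fun p : X × Y × Z => h p.1 p.2.1 p.2.2) :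
    CodedPrimrec fun x => (f x).foldr (h x) (g x) := by
  obtain ⟨F, hF, eF⟩ := hf
  obtain ⟨G, hG, eG⟩ := hg
  obtain ⟨H, hH, eH⟩ := hh
  refine ⟨_, Primrec.list_foldr (β := Code Y) hF hG
    (show Primrec₂ fun (x : Code X) (p : Code Y × Code Z) => H (x, p) from hH), fun x => ?_⟩
  rw [eF, eG]
  change List.foldr _ _ (List.map _ _) = toCode (List.foldr (h x) (g x) (f x))
  induction f x with
  | nil => rfl
  | cons y l ih =>
    rw [List.map_cons, List.foldr_cons, ih]
    exact eH (x, y, _)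

theorem list_cases {f : X → List Y → Z} (hnil : CodedPrimrec fun x => f x [])
    (hcons : CodedPrimrec fun p : X × Y × List Y => f p.1 (p.2.1 :: p.2.2)) :
    CodedPrimrec fun p : X × List Y => f p.1 p.2 := by
  obtain ⟨F, hF, eF⟩ := hnil
  obtain ⟨G, hG, eG⟩ := hcons
  refine ⟨_, Primrec.list_casesOn (α := Code X × List (Code Y)) Primrec.snd (hF.comp Primrec.fst)
    (h := fun x p => G (x.1, p)) ?_, ?_⟩
  · exact (hG : Primrec fun p : Code X × Code Y × List (Code Y) => G p).comp
      ((Primrec.fst.comp Primrec.fst).pair Primrec.snd)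
  · rintro ⟨x, _ | ⟨y, l⟩⟩
    · exact eF x
    · exact eG (x, y, l)

@[fun_prop]
theorem option_some {f : X → Y} (hf : CodedPrimrec f) : CodedPrimrec fun x => some (f x) := by
  obtain ⟨F, hF, eF⟩ := hf
  exact ⟨_, Primrec.option_some.comp hF, fun x => by rw [eF]; rfl⟩

@[fun_prop]
theorem option_getD {f : X → Option Y} {g : X → Y} (hf : CodedPrimrec f) (hg : CodedPrimrec g) :
    CodedPrimrec fun x => (f x).getD (g x) := by
  obtain ⟨F, hF, eF⟩ := hf
  obtain ⟨G, hG, eG⟩ := hg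
  refine ⟨_, Primrec.option_getD.comp hF hG, fun x => ?_⟩
  rw [eF, eG]
  change Option.getD (Option.map _ _) _ = toCode ((f x).getD (g x))
  cases f x <;> rfl

@[fun_prop]
theorem option_isSome {f : X → Option Y} (hf : CodedPrimrec f) :
    CodedPrimrec fun x => (f x).isSome := by
  obtain ⟨F, hF, eF⟩ := hf
  refine ⟨_, Primrec.option_isSome.comp hF, fun x => ?_⟩
  rw [eF]
  exact Option.isSome_map

@[fun_prop]
theorem cond {c : X → Bool} {f g : X → Y} (hc : CodedPrimrec c) (hf : CodedPrimrec f)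
    (hg : CodedPrimrec g) : CodedPrimrec fun x => if c x then f x else g x := by
  obtain ⟨C, hC, eC⟩ := hc
  obtain ⟨F, hF, eF⟩ := hf
  obtain ⟨G, hG, eG⟩ := hg
  refine ⟨_, Primrec.cond (c := fun x => C x) hC hF hG, fun x => ?_⟩
  rw [eC, eF, eG]
  change (bif c x then toCode (f x) else toCode (g x)) = toCode (if c x then f x else g x)
  cases c x <;> rfl

@[fun_prop]
theorem ite {c : X → Prop} [DecidablePred c] {f g : X → Y} (hc : CodedPrimrec fun x => decide (c x))
    (hf : CodedPrimrec f) (hg : CodedPrimrec g) : CodedPrimrec fun x => if c x then f x else g x := by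
  simpa using hc.cond hf hg

theorem bool_cases {f : Bool → X → Y} (h₁ : CodedPrimrec (f true)) (h₂ : CodedPrimrec (f false)) :
    CodedPrimrec fun p : Bool × X => f p.1 p.2 := by
  have : CodedPrimrec fun p : Bool × X => if p.1 then f true p.2 else f false p.2 := by fun_prop
  refine (congrArg CodedPrimrec (funext ?_)).mp this
  rintro ⟨_ | _, x⟩ <;> rfl

@[fun_prop]
theorem decide_natEq {f g : X → ℕ} (hf : CodedPrimrec f) (hg : CodedPrimrec g) :
    CodedPrimrec fun x => decide (f x = g x) := by
  obtain ⟨F, hF, eF⟩ := hf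
  obtain ⟨G, hG, eG⟩ := hg
  refine ⟨_, (Primrec.eq (α := ℕ)).decide.comp hF hG, fun x => ?_⟩
  rw [eF, eG]
  rfl

@[fun_prop]
theorem decide_mem {f : X → ℕ} {g : X → List ℕ} (hf : CodedPrimrec f) (hg : CodedPrimrec g) :
    CodedPrimrec fun x => decide (f x ∈ g x) := by
  have : CodedPrimrec fun x => (g x).foldr (fun n b => if f x = n then true else b) false := by
    fun_prop
  refine (congrArg CodedPrimrec (funext fun x => ?_)).mp this
  induction g x with
  | nil => simp
  | cons n l ih =>
    rw [List.foldr_cons, ih]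
    by_cases h : f x = n <;> simp [h]

/-- Primitive recursion, with the recursion equation as a hypothesis. -/
theorem nat_rec {f : X → ℕ → Y} {h : X × ℕ × Y → Y} (h₀ : CodedPrimrec fun x => f x 0)
    (hh : CodedPrimrec h) (e : ∀ x n, f x (n + 1) = h (x, n, f x n)) :
    CodedPrimrec fun p : X × ℕ => f p.1 p.2 := by
  obtain ⟨F, hF, eF⟩ := h₀
  obtain ⟨H, hH, eH⟩ := hh
  refine ⟨fun p : Code X × ℕ => Nat.rec (F p.1) (fun n y => H (p.1, n, y)) p.2,
    Primrec.nat_rec' Primrec.snd (hF.comp Primrec.fst) (h := fun x p => H (x.1, p)) ?_, ?_⟩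
  · exact (hH : Primrec fun p : Code X × ℕ × Code Y => H p).comp
      ((Primrec.fst.comp Primrec.fst).pair Primrec.snd)
  · rintro ⟨x, n⟩
    change Nat.rec (F (toCode x)) _ n = toCode (f x n)
    induction n with
    | zero => exact eF x
    | succ n ih =>
      rw [e]
      refine Eq.trans ?_ (eH (x, n, f x n))
      exact congrArg (fun y => H (toCode x, n, y)) ih

@[fun_prop]
theorem succ {f : X → ℕ} (hf : CodedPrimrec f) : CodedPrimrec fun x => f x + 1 := by
  obtain ⟨F, hF, eF⟩ := hf
  exact ⟨_, Primrec.succ.comp hF, fun x => by rw [eF]; rfl⟩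

@[fun_prop]
theorem pred {f : X → ℕ} (hf : CodedPrimrec f) : CodedPrimrec fun x => f x - 1 := by
  obtain ⟨F, hF, eF⟩ := hf
  exact ⟨_, Primrec.pred.comp hF, fun x => by rw [eF]; rfl⟩

end CodedPrimrec

/-! ### Primitive recursive functions on codes of syntax trees -/

section

variable [Encodable I] [Encodable L] [Encodable V] [Encodable M]

instance : Coded (Const I L) := ⟨ℕ, Const.code⟩

instance : Coded (Step I) := ⟨ℕ, Step.code⟩

instance : Coded (Path I) := ⟨ℕ, Path.code⟩

instance : Coded (SHACL I L V M) := ⟨ℕ, SHACL.code⟩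

instance : Coded (ShEx I L V M) := ⟨ℕ, ShEx.code⟩

instance : Coded (ShExTriple I L V M) := ⟨ℕ, ShExTriple.code⟩

instance : Coded (ShExBasic I L V M) := ⟨ℕ, ShExBasic.code⟩

theorem encode_map_encode (l : List I) :
    Encodable.encode (l.map Encodable.encode) = Encodable.encode l := by
  induction l with
  | nil => rfl
  | cons a l ih => simp [ih]

theorem decode_encode_list (l : List I) :
    (Encodable.decode (α := List ℕ) (Encodable.encode l)).getD [] = toCode l := by
  rw [← encode_map_encode, Encodable.encodek]
  rfl

theorem decode_encode_option (o : Option (List I)) :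
    (Encodable.decode (α := Option (List ℕ)) (Encodable.encode o)).getD none = toCode o := by
  have : Encodable.encode o = Encodable.encode (o.map (List.map Encodable.encode)) := by
    cases o with
    | none => rfl
    | some l => simp only [Option.map_some, Encodable.encode_some, encode_map_encode]
  rw [this, Encodable.encodek]
  rfl

namespace CodedPrimrec

variable {X Y Z W : Type} [Coded X] [Coded Y] [Coded Z] [Coded W]

@[fun_prop]
theorem encode {f : X → M} (hf : CodedPrimrec f) : CodedPrimrec fun x => Encodable.encode (f x) :=
  hf

@[fun_prop]
theorem encode_list {f : X → List M} (hf : CodedPrimrec f) :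
    CodedPrimrec fun x => Encodable.encode (f x) := by
  obtain ⟨F, hF, eF⟩ := hf
  refine ⟨fun x => Encodable.encode (α := List ℕ) (F x), primrec_encode hF, fun x => ?_⟩
  exact (congrArg (fun l => Encodable.encode (α := List ℕ) l) (eF x)).trans (encode_map_encode _)

@[fun_prop]
theorem encode_option {f : X → Option (List M)} (hf : CodedPrimrec f) :
    CodedPrimrec fun x => Encodable.encode (f x) := by
  obtain ⟨F, hF, eF⟩ := hf
  refine ⟨fun x => Encodable.encode (α := Option (List ℕ)) (F x), primrec_encode hF, fun x => ?_⟩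
  refine (congrArg (fun o => Encodable.encode (α := Option (List ℕ)) o) (eF x)).trans ?_
  change Encodable.encode (Option.map _ (f x)) = Encodable.encode (f x)
  cases f x with
  | none => rfl
  | some l => exact congrArg Nat.succ (encode_map_encode l)

@[fun_prop]
theorem natPair {f g : X → ℕ} (hf : CodedPrimrec f) (hg : CodedPrimrec g) :
    CodedPrimrec fun x => Nat.pair (f x) (g x) := by
  obtain ⟨F, hF, eF⟩ := hf
  obtain ⟨G, hG, eG⟩ := hg
  exact ⟨_, primrec_natPair hF hG, fun x => by rw [eF, eG]; rfl⟩

@[fun_prop]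
theorem node (t : ℕ) {f : X → ℕ} (hf : CodedPrimrec f) : CodedPrimrec fun x => codeNode t (f x) := by
  obtain ⟨F, hF, eF⟩ := hf
  exact ⟨_, primrec_codeNode t hF, fun x => by rw [eF]; rfl⟩

@[fun_prop]
theorem const_code {f : X → Const I L} (hf : CodedPrimrec f) : CodedPrimrec fun x => (f x).code := hf

@[fun_prop]
theorem step_code {f : X → Step I} (hf : CodedPrimrec f) : CodedPrimrec fun x => (f x).code := hf

@[fun_prop]
theorem path_code {f : X → Path I} (hf : CodedPrimrec f) : CodedPrimrec fun x => (f x).code := hf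

@[fun_prop]
theorem shacl_code {f : X → SHACL I L V M} (hf : CodedPrimrec f) :
    CodedPrimrec fun x => (f x).code := hf

@[fun_prop]
theorem shex_code {f : X → ShEx I L V M} (hf : CodedPrimrec f) :
    CodedPrimrec fun x => (f x).code := hf

@[fun_prop]
theorem triple_code {f : X → ShExTriple I L V M} (hf : CodedPrimrec f) :
    CodedPrimrec fun x => (f x).code := hf

@[fun_prop]
theorem basic_code {f : X → ShExBasic I L V M} (hf : CodedPrimrec f) :
    CodedPrimrec fun x => (f x).code := hf

section Constructors

variable {Q : X → List I} {p : X → I} {π : X → Path I} {q : X → Step I}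
  {c : X → Const I L} {v : X → V} {s : X → M} {n : X → ℕ}

@[fun_prop]
theorem step_fwd (hp : CodedPrimrec p) : CodedPrimrec fun x => Step.fwd (p x) :=
  (by fun_prop : CodedPrimrec fun x => codeNode 0 (Encodable.encode (p x)))

@[fun_prop]
theorem step_bwd (hp : CodedPrimrec p) : CodedPrimrec fun x => Step.bwd (p x) :=
  (by fun_prop : CodedPrimrec fun x => codeNode 1 (Encodable.encode (p x)))

@[fun_prop]
theorem path_star (hπ : CodedPrimrec π) : CodedPrimrec fun x => Path.star (π x) :=
  (by fun_prop : CodedPrimrec fun x => codeNode 5 (π x).code)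

@[fun_prop]
theorem path_inv (hπ : CodedPrimrec π) : CodedPrimrec fun x => Path.inv (π x) :=
  (by fun_prop : CodedPrimrec fun x => codeNode 2 (π x).code)

@[fun_prop]
theorem path_comp {π' : X → Path I} (hπ : CodedPrimrec π) (hπ' : CodedPrimrec π') :
    CodedPrimrec fun x => Path.comp (π x) (π' x) :=
  (by fun_prop : CodedPrimrec fun x => codeNode 3 (Nat.pair (π x).code (π' x).code))

@[fun_prop]
theorem path_union {π' : X → Path I} (hπ : CodedPrimrec π) (hπ' : CodedPrimrec π') :
    CodedPrimrec fun x => Path.union (π x) (π' x) :=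
  (by fun_prop : CodedPrimrec fun x => codeNode 4 (Nat.pair (π x).code (π' x).code))

@[fun_prop]
theorem path_pred (hp : CodedPrimrec p) : CodedPrimrec fun x => Path.pred (p x) :=
  (by fun_prop : CodedPrimrec fun x => codeNode 1 (Encodable.encode (p x)))

section

variable {φ ψ : X → SHACL I L V M}

@[fun_prop]
theorem shacl_test (hc : CodedPrimrec c) : CodedPrimrec fun x => (.test (c x) : SHACL I L V M) :=
  (by fun_prop : CodedPrimrec fun x => codeNode 2 (c x).code)

@[fun_prop]
theorem shacl_testType (hv : CodedPrimrec v) :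
    CodedPrimrec fun x => (.testType (v x) : SHACL I L V M) :=
  (by fun_prop : CodedPrimrec fun x => codeNode 3 (Encodable.encode (v x)))

@[fun_prop]
theorem shacl_name (hs : CodedPrimrec s) : CodedPrimrec fun x => (.name (s x) : SHACL I L V M) :=
  (by fun_prop : CodedPrimrec fun x => codeNode 4 (Encodable.encode (s x)))

@[fun_prop]
theorem shacl_closed (hQ : CodedPrimrec Q) :
    CodedPrimrec fun x => (.closed (Q x) : SHACL I L V M) :=
  (by fun_prop : CodedPrimrec fun x => codeNode 5 (Encodable.encode (Q x)))

@[fun_prop]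
theorem shacl_not (hφ : CodedPrimrec φ) : CodedPrimrec fun x => SHACL.not (φ x) :=
  (by fun_prop : CodedPrimrec fun x => codeNode 6 (φ x).code)

@[fun_prop]
theorem shacl_and (hφ : CodedPrimrec φ) (hψ : CodedPrimrec ψ) :
    CodedPrimrec fun x => SHACL.and (φ x) (ψ x) :=
  (by fun_prop : CodedPrimrec fun x => codeNode 7 (Nat.pair (φ x).code (ψ x).code))

@[fun_prop]
theorem shacl_or (hφ : CodedPrimrec φ) (hψ : CodedPrimrec ψ) :
    CodedPrimrec fun x => SHACL.or (φ x) (ψ x) :=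
  (by fun_prop : CodedPrimrec fun x => codeNode 8 (Nat.pair (φ x).code (ψ x).code))

@[fun_prop]
theorem shacl_ge (hn : CodedPrimrec n) (hq : CodedPrimrec q) (hφ : CodedPrimrec φ) :
    CodedPrimrec fun x => SHACL.ge (n x) (q x) (φ x) :=
  (by fun_prop :
    CodedPrimrec fun x => codeNode 9 (Nat.pair (n x) (Nat.pair (q x).code (φ x).code)))

@[fun_prop]
theorem shacl_le (hn : CodedPrimrec n) (hq : CodedPrimrec q) (hφ : CodedPrimrec φ) :
    CodedPrimrec fun x => SHACL.le (n x) (q x) (φ x) :=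
  (by fun_prop :
    CodedPrimrec fun x => codeNode 10 (Nat.pair (n x) (Nat.pair (q x).code (φ x).code)))

@[fun_prop]
theorem shacl_ex (hπ : CodedPrimrec π) (hφ : CodedPrimrec φ) :
    CodedPrimrec fun x => SHACL.ex (π x) (φ x) :=
  (by fun_prop : CodedPrimrec fun x => codeNode 11 (Nat.pair (π x).code (φ x).code))

end

variable {φ ψ : X → ShEx I L V M} {f g : X → ShExTriple I L V M} {a b : X → ShExBasic I L V M}
  {O : X → Option (List I)}

@[fun_prop]
theorem shex_test (hc : CodedPrimrec c) : CodedPrimrec fun x => (.test (c x) : ShEx I L V M) :=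
  (by simp only [ShEx.code]; fun_prop : CodedPrimrec fun x => (ShEx.test (c x) : ShEx I L V M).code)

@[fun_prop]
theorem shex_testType (hv : CodedPrimrec v) :
    CodedPrimrec fun x => (.testType (v x) : ShEx I L V M) :=
  (by simp only [ShEx.code]; fun_prop :
    CodedPrimrec fun x => (ShEx.testType (v x) : ShEx I L V M).code)

@[fun_prop]
theorem shex_name (hs : CodedPrimrec s) : CodedPrimrec fun x => (.name (s x) : ShEx I L V M) :=
  (by simp only [ShEx.code]; fun_prop : CodedPrimrec fun x => (ShEx.name (s x) : ShEx I L V M).code)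

@[fun_prop]
theorem shex_neigh (hf : CodedPrimrec f) (hQ : CodedPrimrec Q) (hO : CodedPrimrec O) :
    CodedPrimrec fun x => ShEx.neigh (f x) (Q x) (O x) :=
  (by simp only [ShEx.code]; fun_prop : CodedPrimrec fun x => (ShEx.neigh (f x) (Q x) (O x)).code)

@[fun_prop]
theorem shex_and (hφ : CodedPrimrec φ) (hψ : CodedPrimrec ψ) :
    CodedPrimrec fun x => ShEx.and (φ x) (ψ x) :=
  (by simp only [ShEx.code]; fun_prop : CodedPrimrec fun x => (ShEx.and (φ x) (ψ x)).code)

@[fun_prop]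
theorem shex_or (hφ : CodedPrimrec φ) (hψ : CodedPrimrec ψ) :
    CodedPrimrec fun x => ShEx.or (φ x) (ψ x) :=
  (by simp only [ShEx.code]; fun_prop : CodedPrimrec fun x => (ShEx.or (φ x) (ψ x)).code)

@[fun_prop]
theorem shex_not (hφ : CodedPrimrec φ) : CodedPrimrec fun x => ShEx.not (φ x) :=
  (by simp only [ShEx.code]; fun_prop : CodedPrimrec fun x => (ShEx.not (φ x)).code)

@[fun_prop]
theorem triple_basic (ha : CodedPrimrec a) : CodedPrimrec fun x => ShExTriple.basic (a x) :=
  (by simp only [ShExTriple.code]; fun_prop : CodedPrimrec fun x => (ShExTriple.basic (a x)).code)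

@[fun_prop]
theorem triple_star (ha : CodedPrimrec a) : CodedPrimrec fun x => ShExTriple.star (a x) :=
  (by simp only [ShExTriple.code]; fun_prop : CodedPrimrec fun x => (ShExTriple.star (a x)).code)

@[fun_prop]
theorem triple_each (hf : CodedPrimrec f) (hg : CodedPrimrec g) :
    CodedPrimrec fun x => ShExTriple.each (f x) (g x) :=
  (by simp only [ShExTriple.code]; fun_prop :
    CodedPrimrec fun x => (ShExTriple.each (f x) (g x)).code)

@[fun_prop]
theorem basic_edge (hq : CodedPrimrec q) (hφ : CodedPrimrec φ) :
    CodedPrimrec fun x => ShExBasic.edge (q x) (φ x) :=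
  (by simp only [ShExBasic.code]; fun_prop :
    CodedPrimrec fun x => (ShExBasic.edge (q x) (φ x)).code)

@[fun_prop]
theorem basic_alt (ha : CodedPrimrec a) (hb : CodedPrimrec b) :
    CodedPrimrec fun x => ShExBasic.alt (a x) (b x) :=
  (by simp only [ShExBasic.code]; fun_prop :
    CodedPrimrec fun x => (ShExBasic.alt (a x) (b x)).code)

end Constructors

section Recursors

/-- Case distinction on the direction of a step. -/
theorem step_cases {f : X → Step I → Y} (hfwd : CodedPrimrec fun p : X × I => f p.1 (.fwd p.2))
    (hbwd : CodedPrimrec fun p : X × I => f p.1 (.bwd p.2)) :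
    CodedPrimrec fun p : X × Step I => f p.1 p.2 := by
  obtain ⟨F, hF : @Primrec (Code X × ℕ) _ _ _ F, eF⟩ := hfwd
  obtain ⟨G, hG : @Primrec (Code X × ℕ) _ _ _ G, eG⟩ := hbwd
  refine ⟨fun p : Code X × ℕ => if p.2.pred.unpair.1 = 0 then F (p.1, p.2.pred.unpair.2)
    else G (p.1, p.2.pred.unpair.2), ?_, ?_⟩
  · have hpred : Primrec fun p : Code X × ℕ => p.2.pred := Primrec.pred.comp Primrec.snd
    fun_prop
  · rintro ⟨x, q | q⟩
    · refine Eq.trans ?_ (eF (x, q))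
      simp [toCode, Step.code, codeNode]
    · refine Eq.trans ?_ (eG (x, q))
      simp [toCode, Step.code, codeNode]

/-- Case distinction on the form of a path expression. -/
theorem path_cases {f : X → Path I → Y} (hid : CodedPrimrec fun x => f x .id)
    (hpred : CodedPrimrec fun p : X × I => f p.1 (.pred p.2))
    (hinv : CodedPrimrec fun p : X × Path I => f p.1 (.inv p.2))
    (hcomp : CodedPrimrec fun p : X × Path I × Path I => f p.1 (.comp p.2.1 p.2.2))
    (hunion : CodedPrimrec fun p : X × Path I × Path I => f p.1 (.union p.2.1 p.2.2))
    (hstar : CodedPrimrec fun p : X × Path I => f p.1 (.star p.2)) :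
    CodedPrimrec fun p : X × Path I => f p.1 p.2 := by
  obtain ⟨F₀, h₀, e₀⟩ := hid
  obtain ⟨F₁, h₁ : @Primrec (Code X × ℕ) _ _ _ F₁, e₁⟩ := hpred
  obtain ⟨F₂, h₂ : @Primrec (Code X × ℕ) _ _ _ F₂, e₂⟩ := hinv
  obtain ⟨F₃, h₃ : @Primrec (Code X × ℕ × ℕ) _ _ _ F₃, e₃⟩ := hcomp
  obtain ⟨F₄, h₄ : @Primrec (Code X × ℕ × ℕ) _ _ _ F₄, e₄⟩ := hunion
  obtain ⟨F₅, h₅ : @Primrec (Code X × ℕ) _ _ _ F₅, e₅⟩ := hstar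
  refine ⟨fun p : Code X × ℕ =>
    if p.2.pred.unpair.1 = 0 then F₀ p.1
    else if p.2.pred.unpair.1 = 1 then F₁ (p.1, p.2.pred.unpair.2)
    else if p.2.pred.unpair.1 = 2 then F₂ (p.1, p.2.pred.unpair.2)
    else if p.2.pred.unpair.1 = 3 then
      F₃ (p.1, p.2.pred.unpair.2.unpair.1, p.2.pred.unpair.2.unpair.2)
    else if p.2.pred.unpair.1 = 4 then
      F₄ (p.1, p.2.pred.unpair.2.unpair.1, p.2.pred.unpair.2.unpair.2)
    else F₅ (p.1, p.2.pred.unpair.2), ?_, ?_⟩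
  · have hpred : Primrec fun p : Code X × ℕ => p.2.pred := Primrec.pred.comp Primrec.snd
    fun_prop
  · rintro ⟨x, _ | p | π | ⟨π₁, π₂⟩ | ⟨π₁, π₂⟩ | π⟩
    · refine Eq.trans ?_ (e₀ x)
      simp [toCode, Path.code, codeNode]
    · refine Eq.trans ?_ (e₁ (x, p))
      simp [toCode, Path.code, codeNode]
    · refine Eq.trans ?_ (e₂ (x, π))
      simp [toCode, Path.code, codeNode]
    · refine Eq.trans ?_ (e₃ (x, π₁, π₂))
      simp [toCode, Path.code, codeNode]
    · refine Eq.trans ?_ (e₄ (x, π₁, π₂))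
      simp [toCode, Path.code, codeNode]
    · refine Eq.trans ?_ (e₅ (x, π))
      simp [toCode, Path.code, codeNode]

/-- Structural recursion on path expressions. -/
theorem path_rec {f : Path I → Y} {ginv gstar : Path I × Y → Y}
    {gcomp gunion : Path I × Path I × Y × Y → Y}
    (hpred : CodedPrimrec fun p => f (.pred p)) (hinv : CodedPrimrec ginv)
    (einv : ∀ π, f (.inv π) = ginv (π, f π)) (hcomp : CodedPrimrec gcomp)
    (ecomp : ∀ π₁ π₂, f (.comp π₁ π₂) = gcomp (π₁, π₂, f π₁, f π₂)) (hunion : CodedPrimrec gunion)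
    (eunion : ∀ π₁ π₂, f (.union π₁ π₂) = gunion (π₁, π₂, f π₁, f π₂)) (hstar : CodedPrimrec gstar)
    (estar : ∀ π, f (.star π) = gstar (π, f π)) : CodedPrimrec f := by
  obtain ⟨F₁, h₁ : @Primrec ℕ _ _ _ F₁, e₁⟩ := hpred
  obtain ⟨F₂, h₂ : @Primrec (ℕ × Code Y) _ _ _ F₂, e₂⟩ := hinv
  obtain ⟨F₃, h₃ : @Primrec (ℕ × ℕ × Code Y × Code Y) _ _ _ F₃, e₃⟩ := hcomp
  obtain ⟨F₄, h₄ : @Primrec (ℕ × ℕ × Code Y × Code Y) _ _ _ F₄, e₄⟩ := hunion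
  obtain ⟨F₅, h₅ : @Primrec (ℕ × Code Y) _ _ _ F₅, e₅⟩ := hstar
  let st : ℕ × ℕ × Code Y × Code Y × Code Y × Code Y → Code Y := fun x =>
    if x.1 = 0 then toCode (f .id)
    else if x.1 = 1 then F₁ x.2.1
    else if x.1 = 2 then F₂ (x.2.1, x.2.2.1)
    else if x.1 = 3 then F₃ (x.2.1.unpair.1, x.2.1.unpair.2, x.2.2.2.1, x.2.2.2.2.1)
    else if x.1 = 4 then F₄ (x.2.1.unpair.1, x.2.1.unpair.2, x.2.2.2.1, x.2.2.2.2.1)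
    else F₅ (x.2.1, x.2.2.1)
  refine ⟨treeRec (toCode (f .id)) st, primrec_treeRec _ (by fun_prop), fun π => ?_⟩
  change treeRec _ st π.code = _
  induction π with
  | id => rw [Path.code, treeRec_codeNode]; rfl
  | pred p =>
    rw [Path.code, treeRec_codeNode]
    exact e₁ p
  | inv π ih =>
    rw [Path.code, treeRec_codeNode, ih, einv]
    exact e₂ (π, f π)
  | comp π₁ π₂ ih₁ ih₂ =>
    rw [Path.code, treeRec_codeNode, Nat.unpair_pair, ih₁, ih₂, ecomp]
    refine Eq.trans ?_ (e₃ (π₁, π₂, f π₁, f π₂))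
    simp [st, toCode]
  | union π₁ π₂ ih₁ ih₂ =>
    rw [Path.code, treeRec_codeNode, Nat.unpair_pair, ih₁, ih₂, eunion]
    refine Eq.trans ?_ (e₄ (π₁, π₂, f π₁, f π₂))
    simp [st, toCode]
  | star π ih =>
    rw [Path.code, treeRec_codeNode, ih, estar]
    exact e₅ (π, f π)

/-- Structural recursion on SHACL shapes. -/
theorem shacl_rec {f : SHACL I L V M → Y} {gnot : SHACL I L V M × Y → Y}
    {gand gor : SHACL I L V M × SHACL I L V M × Y × Y → Y}
    {gge gle : ℕ × Step I × SHACL I L V M × Y → Y} {gex : Path I × SHACL I L V M × Y → Y}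
    (htest : CodedPrimrec fun c => f (.test c)) (htype : CodedPrimrec fun v => f (.testType v))
    (hname : CodedPrimrec fun s => f (.name s)) (hclosed : CodedPrimrec fun Q => f (.closed Q))
    (hnot : CodedPrimrec gnot) (enot : ∀ φ, f (.not φ) = gnot (φ, f φ))
    (hand : CodedPrimrec gand) (eand : ∀ φ ψ, f (.and φ ψ) = gand (φ, ψ, f φ, f ψ))
    (hor : CodedPrimrec gor) (eor : ∀ φ ψ, f (.or φ ψ) = gor (φ, ψ, f φ, f ψ))
    (hge : CodedPrimrec gge) (ege : ∀ n q φ, f (.ge n q φ) = gge (n, q, φ, f φ))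
    (hle : CodedPrimrec gle) (ele : ∀ n q φ, f (.le n q φ) = gle (n, q, φ, f φ))
    (hex : CodedPrimrec gex) (eex : ∀ π φ, f (.ex π φ) = gex (π, φ, f φ)) : CodedPrimrec f := by
  obtain ⟨F₂, h₂ : @Primrec ℕ _ _ _ F₂, e₂⟩ := htest
  obtain ⟨F₃, h₃ : @Primrec ℕ _ _ _ F₃, e₃⟩ := htype
  obtain ⟨F₄, h₄ : @Primrec ℕ _ _ _ F₄, e₄⟩ := hname
  obtain ⟨F₅, h₅ : @Primrec (List ℕ) _ _ _ F₅, e₅⟩ := hclosed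
  obtain ⟨F₆, h₆ : @Primrec (ℕ × Code Y) _ _ _ F₆, e₆⟩ := hnot
  obtain ⟨F₇, h₇ : @Primrec (ℕ × ℕ × Code Y × Code Y) _ _ _ F₇, e₇⟩ := hand
  obtain ⟨F₈, h₈ : @Primrec (ℕ × ℕ × Code Y × Code Y) _ _ _ F₈, e₈⟩ := hor
  obtain ⟨F₉, h₉ : @Primrec (ℕ × ℕ × ℕ × Code Y) _ _ _ F₉, e₉⟩ := hge
  obtain ⟨F₁₀, h₁₀ : @Primrec (ℕ × ℕ × ℕ × Code Y) _ _ _ F₁₀, e₁₀⟩ := hle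
  obtain ⟨F₁₁, h₁₁ : @Primrec (ℕ × ℕ × Code Y) _ _ _ F₁₁, e₁₁⟩ := hex
  let st : ℕ × ℕ × Code Y × Code Y × Code Y × Code Y → Code Y := fun x =>
    if x.1 = 0 then toCode (f .top)
    else if x.1 = 1 then toCode (f .bot)
    else if x.1 = 2 then F₂ x.2.1
    else if x.1 = 3 then F₃ x.2.1
    else if x.1 = 4 then F₄ x.2.1
    else if x.1 = 5 then F₅ ((Encodable.decode (α := List ℕ) x.2.1).getD [])
    else if x.1 = 6 then F₆ (x.2.1, x.2.2.1)
    else if x.1 = 7 then F₇ (x.2.1.unpair.1, x.2.1.unpair.2, x.2.2.2.1, x.2.2.2.2.1)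
    else if x.1 = 8 then F₈ (x.2.1.unpair.1, x.2.1.unpair.2, x.2.2.2.1, x.2.2.2.2.1)
    else if x.1 = 9 then F₉ (x.2.1.unpair.1, x.2.1.unpair.2.unpair.1, x.2.1.unpair.2.unpair.2,
      x.2.2.2.2.2)
    else if x.1 = 10 then F₁₀ (x.2.1.unpair.1, x.2.1.unpair.2.unpair.1,
      x.2.1.unpair.2.unpair.2, x.2.2.2.2.2)
    else F₁₁ (x.2.1.unpair.1, x.2.1.unpair.2, x.2.2.2.2.1)
  refine ⟨treeRec (toCode (f .top)) st, primrec_treeRec _ (by fun_prop), fun φ => ?_⟩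
  change treeRec _ st φ.code = _
  induction φ with
  | top | bot =>
    rw [SHACL.code, treeRec_codeNode]
    rfl
  | test c =>
    rw [SHACL.code, treeRec_codeNode]
    exact e₂ c
  | testType v =>
    rw [SHACL.code, treeRec_codeNode]
    exact e₃ v
  | name s =>
    rw [SHACL.code, treeRec_codeNode]
    exact e₄ s
  | closed Q =>
    rw [SHACL.code, treeRec_codeNode]
    exact (congrArg F₅ (decode_encode_list Q)).trans (e₅ Q)
  | not φ ih =>
    rw [SHACL.code, treeRec_codeNode, ih, enot]
    exact e₆ (φ, f φ)
  | and φ ψ ih₁ ih₂ =>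
    rw [SHACL.code, treeRec_codeNode, Nat.unpair_pair, ih₁, ih₂, eand]
    refine Eq.trans ?_ (e₇ (φ, ψ, f φ, f ψ))
    simp [st, toCode]
  | or φ ψ ih₁ ih₂ =>
    rw [SHACL.code, treeRec_codeNode, Nat.unpair_pair, ih₁, ih₂, eor]
    refine Eq.trans ?_ (e₈ (φ, ψ, f φ, f ψ))
    simp [st, toCode]
  | ge n q φ ih =>
    rw [SHACL.code, treeRec_codeNode, Nat.unpair_pair, Nat.unpair_pair, ih, ege]
    refine Eq.trans ?_ (e₉ (n, q, φ, f φ))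
    simp [st, toCode]
  | le n q φ ih =>
    rw [SHACL.code, treeRec_codeNode, Nat.unpair_pair, Nat.unpair_pair, ih, ele]
    refine Eq.trans ?_ (e₁₀ (n, q, φ, f φ))
    simp [st, toCode]
  | ex π φ ih =>
    rw [SHACL.code, treeRec_codeNode, Nat.unpair_pair, ih, eex]
    refine Eq.trans ?_ (e₁₁ (π, φ, f φ))
    simp [st, toCode]

end Recursors

end CodedPrimrec

end

variable [Encodable I] [Encodable L] [Encodable V] [Encodable M] [Encodable M'] in
/-- Structural recursion on ShEx shapes and triple expressions. -/
theorem CodedPrimrec.shex_rec {X Y Z : Type} [Coded X] [Coded Y] [Coded Z] {f : ShEx I L V M → X}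
    {f' : ShExTriple I L V M → Y} {f'' : ShExBasic I L V M → Z}
    {gneigh : Y × List I × Option (List I) → X} {gand gor : X × X → X} {gnot : X → X}
    {gbasic gstar : Z → Y} {geach galt : Y × Y → Y} {gedge : Step I × X → Z} {galt' : Z × Z → Z}
    (htest : CodedPrimrec fun c => f (.test c)) (htype : CodedPrimrec fun v => f (.testType v))
    (hname : CodedPrimrec fun s => f (.name s))
    (hneigh : CodedPrimrec gneigh) (eneigh : ∀ a R Q, f (.neigh a R Q) = gneigh (f' a, R, Q))
    (hand : CodedPrimrec gand) (eand : ∀ φ ψ, f (.and φ ψ) = gand (f φ, f ψ))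
    (hor : CodedPrimrec gor) (eor : ∀ φ ψ, f (.or φ ψ) = gor (f φ, f ψ))
    (hnot : CodedPrimrec gnot) (enot : ∀ φ, f (.not φ) = gnot (f φ))
    (hbasic : CodedPrimrec gbasic) (ebasic : ∀ a, f' (.basic a) = gbasic (f'' a))
    (hstar : CodedPrimrec gstar) (estar : ∀ a, f' (.star a) = gstar (f'' a))
    (heach : CodedPrimrec geach) (eeach : ∀ a b, f' (.each a b) = geach (f' a, f' b))
    (halt : CodedPrimrec galt) (ealt : ∀ a b, f' (.alt a b) = galt (f' a, f' b))
    (hedge : CodedPrimrec gedge) (eedge : ∀ q φ, f'' (.edge q φ) = gedge (q, f φ))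
    (halt' : CodedPrimrec galt') (ealt' : ∀ a b, f'' (.alt a b) = galt' (f'' a, f'' b)) :
    CodedPrimrec f := by
  obtain ⟨F₀, h₀ : @Primrec ℕ _ _ _ F₀, e₀⟩ := htest
  obtain ⟨F₁, h₁ : @Primrec ℕ _ _ _ F₁, e₁⟩ := htype
  obtain ⟨F₂, h₂ : @Primrec ℕ _ _ _ F₂, e₂⟩ := hname
  obtain ⟨F₃, h₃ : @Primrec (Code Y × List ℕ × Option (List ℕ)) _ _ _ F₃, e₃⟩ := hneigh
  obtain ⟨F₄, h₄ : @Primrec (Code X × Code X) _ _ _ F₄, e₄⟩ := hand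
  obtain ⟨F₅, h₅ : @Primrec (Code X × Code X) _ _ _ F₅, e₅⟩ := hor
  obtain ⟨F₆, h₆ : @Primrec (Code X) _ _ _ F₆, e₆⟩ := hnot
  obtain ⟨A₀, a₀ : @Primrec (Code Z) _ _ _ A₀, i₀⟩ := hbasic
  obtain ⟨A₁, a₁ : @Primrec (Code Z) _ _ _ A₁, i₁⟩ := hstar
  obtain ⟨A₂, a₂ : @Primrec (Code Y × Code Y) _ _ _ A₂, i₂⟩ := heach
  obtain ⟨A₃, a₃ : @Primrec (Code Y × Code Y) _ _ _ A₃, i₃⟩ := halt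
  obtain ⟨B₁, b₁ : @Primrec (ℕ × Code X) _ _ _ B₁, j₁⟩ := hedge
  obtain ⟨B₂, b₂ : @Primrec (Code Z × Code Z) _ _ _ B₂, j₂⟩ := halt'
  -- A code does not tell which of the three sorts of syntax trees it belongs to, so that values of
  -- all three functions are computed.
  let st₁ : ℕ × ℕ × (Code X × Code Y × Code Z) × (Code X × Code Y × Code Z) ×
      (Code X × Code Y × Code Z) × (Code X × Code Y × Code Z) → Code X := fun x =>
    if x.1 = 0 then F₀ x.2.1
    else if x.1 = 1 then F₁ x.2.1
    else if x.1 = 2 then F₂ x.2.1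
    else if x.1 = 3 then F₃ (x.2.2.2.1.2.1,
      (Encodable.decode (α := List ℕ) x.2.1.unpair.2.unpair.1).getD [],
      (Encodable.decode (α := Option (List ℕ)) x.2.1.unpair.2.unpair.2).getD none)
    else if x.1 = 4 then F₄ (x.2.2.2.1.1, x.2.2.2.2.1.1)
    else if x.1 = 5 then F₅ (x.2.2.2.1.1, x.2.2.2.2.1.1)
    else F₆ x.2.2.1.1
  let st₂ : ℕ × ℕ × (Code X × Code Y × Code Z) × (Code X × Code Y × Code Z) ×
      (Code X × Code Y × Code Z) × (Code X × Code Y × Code Z) → Code Y := fun x =>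
    if x.1 = 0 then A₀ x.2.2.1.2.2
    else if x.1 = 1 then A₁ x.2.2.1.2.2
    else if x.1 = 2 then A₂ (x.2.2.2.1.2.1, x.2.2.2.2.1.2.1)
    else A₃ (x.2.2.2.1.2.1, x.2.2.2.2.1.2.1)
  let st₃ : ℕ × ℕ × (Code X × Code Y × Code Z) × (Code X × Code Y × Code Z) ×
      (Code X × Code Y × Code Z) × (Code X × Code Y × Code Z) → Code Z := fun x =>
    if x.1 = 0 then toCode (f'' .eps)
    else if x.1 = 1 then B₁ (x.2.1.unpair.1, x.2.2.2.2.1.1)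
    else B₂ (x.2.2.2.1.2.2, x.2.2.2.2.1.2.2)
  let d : Code X × Code Y × Code Z := (toCode (f (.neigh (.basic .eps) [] none)), toCode (f' (.basic .eps)),
    toCode (f'' .eps))
  have hst₁ : Primrec st₁ := by fun_prop
  have hst₂ : Primrec st₂ := by fun_prop
  have hst₃ : Primrec st₃ := by fun_prop
  let st := fun x => (st₁ x, st₂ x, st₃ x)
  refine ⟨fun n => (treeRec d st n).1,
    Primrec.fst.comp (primrec_treeRec d (hst₁.pair (hst₂.pair hst₃))), fun φ => ?_⟩
  change (treeRec d st φ.code).1 = _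
  induction φ using ShEx.rec (motive_2 := fun a => (treeRec d st a.code).2.1 = toCode (f' a))
    (motive_3 := fun a => (treeRec d st a.code).2.2 = toCode (f'' a))
  case test c =>
    rw [ShEx.code, treeRec_codeNode]
    exact e₀ c
  case testType v =>
    rw [ShEx.code, treeRec_codeNode]
    exact e₁ v
  case name s =>
    rw [ShEx.code, treeRec_codeNode]
    exact e₂ s
  case neigh a R Q ih =>
    rw [ShEx.code, treeRec_codeNode, eneigh]
    refine Eq.trans ?_ (e₃ (f' a, R, Q))
    simp only [st, st₁, Nat.unpair_pair, ih]
    exact congrArg F₃ (congrArg (Prod.mk _)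
      (congrArg₂ Prod.mk (decode_encode_list R) (decode_encode_option Q)))
  case and φ ψ ih₁ ih₂ =>
    rw [ShEx.code, treeRec_codeNode, Nat.unpair_pair, eand]
    exact (congrArg₂ (fun a b => F₄ (a, b)) ih₁ ih₂).trans (e₄ (f φ, f ψ))
  case or φ ψ ih₁ ih₂ =>
    rw [ShEx.code, treeRec_codeNode, Nat.unpair_pair, eor]
    exact (congrArg₂ (fun a b => F₅ (a, b)) ih₁ ih₂).trans (e₅ (f φ, f ψ))
  case not φ ih =>
    rw [ShEx.code, treeRec_codeNode, enot]
    exact (congrArg F₆ ih).trans (e₆ (f φ))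
  case basic a ih =>
    rw [ShExTriple.code, treeRec_codeNode, ebasic]
    exact (congrArg A₀ ih).trans (i₀ (f'' a))
  case star a ih =>
    rw [ShExTriple.code, treeRec_codeNode, estar]
    exact (congrArg A₁ ih).trans (i₁ (f'' a))
  case each a b ih₁ ih₂ =>
    rw [ShExTriple.code, treeRec_codeNode, Nat.unpair_pair, eeach]
    exact (congrArg₂ (fun a b => A₂ (a, b)) ih₁ ih₂).trans (i₂ (f' a, f' b))
  case alt a b ih₁ ih₂ =>
    rw [ShExTriple.code, treeRec_codeNode, Nat.unpair_pair, ealt]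
    exact (congrArg₂ (fun a b => A₃ (a, b)) ih₁ ih₂).trans (i₃ (f' a, f' b))
  case eps =>
    rw [ShExBasic.code, treeRec_codeNode]
    rfl
  case edge q φ ih =>
    rw [ShExBasic.code, treeRec_codeNode, Nat.unpair_pair, eedge]
    exact (congrArg₂ (fun a b => B₁ (a, b)) (congrArg Prod.fst (Nat.unpair_pair q.code φ.code))
      ih).trans (j₁ (q, f φ))
  case alt a b ih₁ ih₂ =>
    rw [ShExBasic.code, treeRec_codeNode, Nat.unpair_pair, ealt']
    exact (congrArg₂ (fun a b => B₂ (a, b)) ih₁ ih₂).trans (j₂ (f'' a, f'' b))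

/-! ### Primitive recursive descriptions of the translations -/

namespace CodedPrimrec

variable [Encodable I] [Encodable L] [Encodable V] [Encodable M] [Encodable M'] {X Y T : Type}
  [Coded X] [Coded Y] [Coded T]

@[fun_prop]
theorem bigOr {f : X → List (SHACL I L V M)} (hf : CodedPrimrec f) :
    CodedPrimrec fun x => SHACL.bigOr (f x) := by
  unfold SHACL.bigOr
  fun_prop

@[fun_prop]
theorem bigAnd {f : X → List (SHACL I L V M)} (hf : CodedPrimrec f) :
    CodedPrimrec fun x => SHACL.bigAnd (f x) := by
  unfold SHACL.bigAnd
  fun_prop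

@[fun_prop]
theorem splits {f : X → List T} (hf : CodedPrimrec f) : CodedPrimrec fun x => splits (f x) := by
  have : CodedPrimrec fun x => (f x).foldr
      (fun a l => l.flatMap fun s : List T × List T => [(a :: s.1, s.2), (s.1, a :: s.2)])
      [([], [])] := by
    fun_prop
  refine (congrArg CodedPrimrec (funext fun x => ?_)).mp this
  induction f x with
  | nil => rfl
  | cons a l ih => rw [List.foldr_cons, ih, RDFShapes.splits]

@[fun_prop]
theorem hallShape {q : X → Step I} {f g : X → List (SHACL I L V M)} (hq : CodedPrimrec q)
    (hf : CodedPrimrec f) (hg : CodedPrimrec g) :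
    CodedPrimrec fun x => SHACL.hallShape (q x) (f x) (g x) := by
  unfold SHACL.hallShape
  fun_prop

@[fun_prop]
theorem fwdPreds {f : X → List (Step I)} (hf : CodedPrimrec f) :
    CodedPrimrec fun x => fwdPreds (f x) := by
  let g : Step I → List I := fun | .fwd p => [p] | .bwd _ => []
  have h : CodedPrimrec fun p : X × Step I => g p.2 :=
    step_cases (f := fun _ => g) (by simp only [g]; fun_prop) (by simp only [g]; fun_prop)
  refine (congrArg CodedPrimrec (funext fun x => ?_)).mp (hf.list_flatMap (g := fun _ => g) h)
  induction f x with
  | nil => rfl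
  | cons q l ih => cases q <;> simpa [RDFShapes.fwdPreds, g] using ih

@[fun_prop]
theorem altEdges {f : X → List (List T × List T)} (hf : CodedPrimrec f) :
    CodedPrimrec fun x => altEdges (f x) := by
  unfold RDFShapes.altEdges
  fun_prop

@[fun_prop]
theorem closedSteps {f : X → List (Step I × T)} {R : X → List I} {Q : X → Option (List I)}
    (hf : CodedPrimrec f) (hR : CodedPrimrec R) (hQ : CodedPrimrec Q) :
    CodedPrimrec fun x => closedSteps (f x) (R x) (Q x) := by
  unfold RDFShapes.closedSteps
  fun_prop

@[fun_prop]
theorem atStep {q : X → Step I} {f : X → List (Step I × T)} (hq : CodedPrimrec q)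
    (hf : CodedPrimrec f) : CodedPrimrec fun x => atStep (q x) (f x) := by
  have : CodedPrimrec fun x => (f x).flatMap fun e => if e.1.code = (q x).code then [e.2] else [] :=
    by fun_prop
  refine (congrArg CodedPrimrec (funext fun x => ?_)).mp this
  induction f x with
  | nil => rfl
  | cons e l ih =>
    rw [List.flatMap_cons, ih, RDFShapes.atStep, RDFShapes.atStep, List.filterMap_cons]
    split_ifs <;> rfl

@[fun_prop]
theorem neighShape {f : X → List (List (Step I × SHACL I L V M) × List (Step I × SHACL I L V M))}
    {R : X → List I} {Q : X → Option (List I)} (hf : CodedPrimrec f) (hR : CodedPrimrec R)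
    (hQ : CodedPrimrec Q) : CodedPrimrec fun x => neighShape (f x) (R x) (Q x) := by
  unfold RDFShapes.neighShape
  fun_prop

/-- The translation of ShEx shapes, for a primitive recursive translation of the names. -/
theorem shex_toSHACL {σ : M → SHACL I L V M'} (hσ : CodedPrimrec σ) :
    CodedPrimrec (ShEx.toSHACL σ : ShEx I L V M → SHACL I L V M') := by
  refine shex_rec (f' := ShExTriple.alternatives σ) (f'' := ShExBasic.choices σ)
    (gneigh := fun x => RDFShapes.neighShape x.1 x.2.1 x.2.2) (gand := fun x => .and x.1 x.2)
    (gor := fun x => .or x.1 x.2) (gnot := .not) (gbasic := fun C => C.map fun A => (A, []))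
    (gstar := fun C => [([], C.flatten)])
    (geach := fun x => x.1.flatMap fun a => x.2.map fun b => (a.1 ++ b.1, a.2 ++ b.2))
    (galt := fun x => x.1 ++ x.2) (gedge := fun x => [[(x.1, x.2)]]) (galt' := fun x => x.1 ++ x.2)
    ?_ ?_ ?_ ?_ ?_ ?_ ?_ ?_ ?_ ?_ ?_ ?_ ?_ ?_ ?_ ?_ ?_ ?_ ?_ ?_ ?_ ?_ ?_
  all_goals first | (simp only [ShEx.toSHACL]; fun_prop) | fun_prop | intros
  all_goals simp only [ShEx.toSHACL, ShExTriple.alternatives, ShExBasic.choices]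

end CodedPrimrec

namespace CodedPrimrec

variable [Encodable I] [Encodable L] [Encodable V] [Encodable M] [Denumerable N] {X Y : Type}
  [Coded X] [Coded Y]

@[fun_prop]
theorem two_mul {f : X → ℕ} (hf : CodedPrimrec f) : CodedPrimrec fun x => 2 * f x := by
  obtain ⟨F, hF, eF⟩ := hf
  exact ⟨_, Primrec.nat_mul.comp (Primrec.const 2) hF, fun x => congrArg (2 * ·) (eF x)⟩

@[fun_prop]
theorem dbl {f : X → N} (hf : CodedPrimrec f) : CodedPrimrec fun x => dbl (f x) := by
  have : CodedPrimrec fun x => Encodable.encode (RDFShapes.dbl (f x)) := by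
    simp only [encode_dbl]
    fun_prop
  exact this

@[fun_prop]
theorem dblSucc {f : X → N} (hf : CodedPrimrec f) : CodedPrimrec fun x => dblSucc (f x) := by
  have : CodedPrimrec fun x => Encodable.encode (RDFShapes.dblSucc (f x)) := by
    simp only [encode_dblSucc]
    fun_prop
  exact this

@[fun_prop]
theorem shexDecl {f : X → N × ShEx I L V N} (hf : CodedPrimrec f) :
    CodedPrimrec fun x => shexDecl (f x) := by
  have h : CodedPrimrec (ShEx.toSHACL fun s => .not (.name (RDFShapes.dbl s)) :
      ShEx I L V N → SHACL I L V N) := shex_toSHACL (by fun_prop)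
  unfold RDFShapes.shexDecl
  fun_prop

/-- A function on an empty type is represented by any function on codes. -/
theorem of_isEmpty [IsEmpty X] [Nonempty Y] (f : X → Y) : CodedPrimrec f := by
  obtain ⟨y⟩ := ‹Nonempty Y›
  exact ⟨fun _ => toCode y, Primrec.const _, fun x => isEmptyElim x⟩

@[fun_prop]
theorem bool_toNat {f : X → Bool} (hf : CodedPrimrec f) : CodedPrimrec fun x => (f x).toNat := by
  have : CodedPrimrec fun x => if f x then 1 else 0 := by fun_prop
  refine (congrArg CodedPrimrec (funext fun x => ?_)).mp this
  cases f x <;> rfl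

/-- A function of a Boolean and a further argument, if its two values together are primitive
recursive in the further argument. -/
theorem of_bool_pair {f : Bool → X → Y} (h : CodedPrimrec fun x => (f true x, f false x)) :
    CodedPrimrec fun p : Bool × X => f p.1 p.2 :=
  bool_cases (fst.comp h) (snd.comp h)

@[fun_prop]
theorem states : CodedPrimrec fun p : DirPath I => DirPath.states p.1 p.2 := by
  refine of_bool_pair (f := DirPath.states) ?_
  refine path_rec
    (ginv := fun x => ([(true, .inv x.1)] :: x.2.2, [(false, .inv x.1)] :: x.2.1))
    (gcomp := fun x => ([(true, .comp x.1 x.2.1)] ::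
        (x.2.2.2.1.map (· ++ [(true, x.1)]) ++ x.2.2.1.1),
      [(false, .comp x.1 x.2.1)] :: (x.2.2.1.2.map (· ++ [(false, x.2.1)]) ++ x.2.2.2.2)))
    (gunion := fun x => ([(true, .union x.1 x.2.1)] :: (x.2.2.1.1 ++ x.2.2.2.1),
      [(false, .union x.1 x.2.1)] :: (x.2.2.1.2 ++ x.2.2.2.2)))
    (gstar := fun x => ([(true, .star x.1)] :: x.2.1.map (· ++ [(true, .star x.1)]),
      [(false, .star x.1)] :: x.2.2.map (· ++ [(false, .star x.1)])))
    ?_ ?_ ?_ ?_ ?_ ?_ ?_ ?_ ?_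
  all_goals first | (simp only [DirPath.states]; fun_prop) | fun_prop | intros
  all_goals simp only [DirPath.states, Bool.not_true, Bool.not_false]

@[fun_prop]
theorem encode_list_nat {f : X → List ℕ} (hf : CodedPrimrec f) :
    CodedPrimrec fun x => Encodable.encode (f x) := by
  obtain ⟨F, hF, eF⟩ := hf
  refine ⟨_, Primrec.encode.comp hF, fun x => ?_⟩
  rw [eF]
  exact congrArg Encodable.encode (List.map_id (f x))

@[fun_prop]
theorem dirPath_code {f : X → DirPath I} (hf : CodedPrimrec f) :
    CodedPrimrec fun x => (f x).code := by
  unfold DirPath.code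
  fun_prop

@[fun_prop]
theorem pathName {f : X → List (DirPath I)} {g : X → SHACL I L V N} (hf : CodedPrimrec f)
    (hg : CodedPrimrec g) : CodedPrimrec fun x => pathName (f x) (g x) := by
  have : CodedPrimrec fun x => Encodable.encode (RDFShapes.pathName (f x) (g x)) := by
    simp only [encode_pathName]
    fun_prop
  exact this

section

variable {n : X → ℕ} {q : X → Step I} {K : X → ShEx I L V M} {a b : X → ShExTriple I L V M}

@[fun_prop]
theorem eachPow (hn : CodedPrimrec n) (ha : CodedPrimrec a) (hb : CodedPrimrec b) :
    CodedPrimrec fun x => ShEx.eachPow (n x) (a x) (b x) := by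
  have h : CodedPrimrec fun p : (ShExTriple I L V M × ShExTriple I L V M) × ℕ =>
      ShEx.eachPow p.2 p.1.1 p.1.2 :=
    nat_rec (f := fun (p : ShExTriple I L V M × ShExTriple I L V M) n => ShEx.eachPow n p.1 p.2)
      (h := fun p => .each p.1.1 p.2.2) (by simp only [ShEx.eachPow, Function.iterate_zero]; exact snd)
      (by fun_prop) fun p n => Function.iterate_succ_apply' _ _ _
  exact h.comp (f := fun x => ((a x, b x), n x)) (by fun_prop)

@[fun_prop]
theorem atLeast (hn : CodedPrimrec n) (hq : CodedPrimrec q) (hK : CodedPrimrec K) :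
    CodedPrimrec fun x => ShEx.atLeast (n x) (q x) (K x) := by
  unfold ShEx.atLeast
  fun_prop

@[fun_prop]
theorem allBut : CodedPrimrec (ShEx.allBut : Step I → List I × List I) :=
  (step_cases (f := fun (_ : Unit) => ShEx.allBut) (by simp only [ShEx.allBut]; fun_prop)
    (by simp only [ShEx.allBut]; fun_prop)).comp (f := fun q => ((), q)) (by fun_prop)

@[fun_prop]
theorem atMost (hn : CodedPrimrec n) (hq : CodedPrimrec q) (hK : CodedPrimrec K) :
    CodedPrimrec fun x => ShEx.atMost (n x) (q x) (K x) := by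
  unfold ShEx.atMost
  fun_prop

@[fun_prop]
theorem closedShape {Q : X → List I} (hQ : CodedPrimrec Q) :
    CodedPrimrec fun x => (ShEx.closedShape (Q x) : ShEx I L V M) := by
  unfold ShEx.closedShape ShEx.anyOf
  fun_prop

end

/-- The translation of SHACL shapes. -/
@[fun_prop]
theorem shacl_toShEx_pair : CodedPrimrec fun φ : SHACL I L V N => (φ.toShEx true, φ.toShEx false) := by
  refine shacl_rec (gnot := fun x => (x.2.2, x.2.1))
    (gand := fun x => (.and x.2.2.1.1 x.2.2.2.1, .or x.2.2.1.2 x.2.2.2.2))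
    (gor := fun x => (.or x.2.2.1.1 x.2.2.2.1, .and x.2.2.1.2 x.2.2.2.2))
    (gge := fun x => (.atLeast x.1 x.2.1 x.2.2.2.1, if x.1 = 0 then .and (.not .top) x.2.2.2.2
      else .atMost (x.1 - 1) x.2.1 x.2.2.2.2))
    (gle := fun x => (.atMost x.1 x.2.1 x.2.2.2.2, .atLeast (x.1 + 1) x.2.1 x.2.2.2.1))
    (gex := fun x => (.not (.name (RDFShapes.pathName [(false, x.1)] x.2.1)),
      .name (RDFShapes.pathName [(false, x.1)] x.2.1)))
    ?_ ?_ ?_ ?_ ?_ ?_ ?_ ?_ ?_ ?_ ?_ ?_ ?_ ?_ ?_ ?_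
  all_goals first | (simp only [SHACL.toShEx]; fun_prop) | fun_prop | intros
  all_goals simp only [SHACL.toShEx, Bool.not_true, Bool.not_false]
  rename_i n q φ
  cases n <;> rfl

theorem pathDecl : CodedPrimrec fun p : SHACL I L V N × List (DirPath I) =>
    pathDecl p.1 p.2 := by
  have h : CodedPrimrec fun φ : SHACL I L V N => φ.toShEx false := snd.comp shacl_toShEx_pair
  refine list_cases (f := RDFShapes.pathDecl) (by simp only [RDFShapes.pathDecl]; fun_prop) ?_
  suffices CodedPrimrec fun p : Bool × (SHACL I L V N × List (DirPath I)) × Path I =>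
      RDFShapes.pathDecl p.2.1.1 ((p.1, p.2.2) :: p.2.1.2) from
    this.comp (f := fun p : SHACL I L V N × DirPath I × List (DirPath I) =>
      (p.2.1.1, (p.1, p.2.2), p.2.1.2)) (by fun_prop)
  refine bool_cases (f := fun (d : Bool) (p : (SHACL I L V N × List (DirPath I)) × Path I) =>
    RDFShapes.pathDecl p.1.1 ((d, p.2) :: p.1.2)) ?_ ?_
  all_goals
    refine path_cases (f := fun (p : SHACL I L V N × List (DirPath I)) π =>
      RDFShapes.pathDecl p.1 ((_, π) :: p.2)) ?_ ?_ ?_ ?_ ?_ ?_ <;>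
    simp only [RDFShapes.pathDecl] <;> fun_prop

@[fun_prop]
theorem exs : CodedPrimrec (SHACL.exs : SHACL I L V M → List (Path I × SHACL I L V M)) := by
  refine shacl_rec (gnot := fun x => x.2) (gand := fun x => x.2.2.1 ++ x.2.2.2)
    (gor := fun x => x.2.2.1 ++ x.2.2.2) (gge := fun x => x.2.2.2) (gle := fun x => x.2.2.2)
    (gex := fun x => (x.1, x.2.1) :: x.2.2) ?_ ?_ ?_ ?_ ?_ ?_ ?_ ?_ ?_ ?_ ?_ ?_ ?_ ?_ ?_ ?_
  all_goals first | (simp only [SHACL.exs]; fun_prop) | fun_prop | intros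
  all_goals simp only [SHACL.exs]

@[fun_prop]
theorem exDecls {f : X → SHACL I L V N} (hf : CodedPrimrec f) :
    CodedPrimrec fun x => (f x).exDecls := by
  have h : CodedPrimrec fun x : Path I × SHACL I L V N => DirPath.states false x.1 :=
    states.comp (f := fun x : Path I × SHACL I L V N => ((false, x.1) : DirPath I)) (by fun_prop)
  have h' : CodedPrimrec fun x : Path I × SHACL I L V N => pathDecls x.1 x.2 := by
    unfold pathDecls
    refine list_map (by fun_prop) ?_
    refine pair (by fun_prop) ?_
    exact pathDecl.comp (f := fun p : (Path I × SHACL I L V N) × List (DirPath I) => (p.1.2, p.2))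
      (by fun_prop)
  unfold SHACL.exDecls
  fun_prop

@[fun_prop]
theorem dedupFst {f : X → List (M × Y)} (hf : CodedPrimrec f) :
    CodedPrimrec fun x => dedupFst (f x) := by
  have : CodedPrimrec fun x => (f x).foldr
      (fun d l => if Encodable.encode d.1 ∈ l.map fun x => Encodable.encode x.1 then l else d :: l)
      [] := by
    fun_prop
  refine (congrArg CodedPrimrec (funext fun x => ?_)).mp this
  induction f x with
  | nil => rfl
  | cons d l ih => rw [List.foldr_cons, ih, RDFShapes.dedupFst]

theorem code_rename (φ : SHACL I L V Empty) : (φ.rename Empty.elim : SHACL I L V M).code = φ.code := by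
  induction φ with
  | name s => exact s.elim
  | _ => simp_all [SHACL.rename, SHACL.code]

@[fun_prop]
theorem shacl_rename {f : X → SHACL I L V Empty} (hf : CodedPrimrec f) :
    CodedPrimrec fun x => ((f x).rename Empty.elim : SHACL I L V M) := by
  have : CodedPrimrec fun x => ((f x).rename Empty.elim : SHACL I L V M).code := by
    simp only [code_rename]
    fun_prop
  exact this

@[fun_prop]
theorem selShape {f : X → N × SHACL I L V Empty} (hf : CodedPrimrec f) :
    CodedPrimrec fun x => selShape (f x) := by
  unfold RDFShapes.selShape
  fun_prop

@[fun_prop]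
theorem shaclDecl {f : X → N × SHACL I L V N} (hf : CodedPrimrec f) :
    CodedPrimrec fun x => shaclDecl (f x) := by
  have h : CodedPrimrec fun φ : SHACL I L V N => φ.toShEx false := snd.comp shacl_toShEx_pair
  unfold RDFShapes.shaclDecl
  fun_prop

@[fun_prop]
theorem shaclSelDecl {f : X → N × SHACL I L V Empty} (hf : CodedPrimrec f) :
    CodedPrimrec fun x => shaclSelDecl (f x) := by
  unfold RDFShapes.shaclSelDecl
  fun_prop

end CodedPrimrec

/-! ### Effectivity of the translations of schemas -/

/-- Functions that are primitive recursive on codes are effective for numberings that are obtained from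
these codes by encoding them as numbers. -/
theorem Effective.of_codedPrimrec {X Y A C : Type} [Coded A] [Coded C] {codeX : X → ℕ}
    {codeY : Y → ℕ} {T : X → Y} {a : X → A} {c : Y → C} {g : A → C}
    (ha : ∀ x, codeX x = Encodable.encode (toCode (a x)))
    (hc : ∀ y, codeY y = Encodable.encode (toCode (c y))) (hg : CodedPrimrec g)
    (e : ∀ x, c (T x) = g (a x)) : Effective codeX codeY T := by
  obtain ⟨F, hF, eF⟩ := hg
  refine ⟨fun n => ((Encodable.decode (α := Code A) n).map fun y => Encodable.encode (F y)).getD 0,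
    (Primrec.option_getD.comp (Primrec.option_map Primrec.decode
      ((Primrec.encode.comp hF).comp₂ Primrec₂.right)) (Primrec.const 0)).to_comp, fun x => ?_⟩
  rw [ha, hc, e, ← eF]
  simp

theorem encode_map_natPair {X : Type} (f g : X → ℕ) (l : List X) :
    Encodable.encode (l.map fun x => Nat.pair (f x) (g x)) =
      Encodable.encode (l.map fun x => (f x, g x)) := by
  induction l with
  | nil => rfl
  | cons x l ih => simp only [List.map_cons, Encodable.encode_list_cons, ih]; rfl

namespace Schema

variable [Encodable I] [Encodable L] [Encodable V] [Denumerable N] {val : V → Set (Node I L B)}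

theorem shEx_code_eq (S : Schema (restrictedShEx val) N) :
    S.code = Encodable.encode
      (toCode ((S.cat, S.sel) : List (N × ShEx I L V N) × List (N × ShEx I L V Empty))) := by
  rw [Schema.code, encode_map_natPair, encode_map_natPair]
  rfl

theorem shacl_code_eq (S : Schema (restrictedSHACL val) N) :
    S.code = Encodable.encode
      (toCode ((S.cat, S.sel) : List (N × SHACL I L V N) × List (N × SHACL I L V Empty))) := by
  rw [Schema.code, encode_map_natPair, encode_map_natPair]
  rfl

theorem effective_toSHACL :
    Effective Schema.code Schema.code
      (toSHACL : Schema (restrictedShEx val) N → Schema (restrictedSHACL val) N) := by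
  have h : CodedPrimrec (ShEx.toSHACL Empty.elim : ShEx I L V Empty → SHACL I L V Empty) :=
    
    have : Nonempty (SHACL I L V Empty) := ⟨.top⟩
    CodedPrimrec.shex_toSHACL (CodedPrimrec.of_isEmpty _)
  refine Effective.of_codedPrimrec
    (g := fun x : List (N × ShEx I L V N) × List (N × ShEx I L V Empty) =>
      (x.1.flatMap shexDecl, x.2.map fun d => (dblSucc d.1, ShEx.toSHACL Empty.elim d.2)))
    shEx_code_eq shacl_code_eq (by fun_prop) fun S => rfl

theorem effective_toShEx :
    Effective Schema.code Schema.code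
      (toShEx : Schema (restrictedSHACL val) N → Schema (restrictedShEx val) N) := by
  refine Effective.of_codedPrimrec
    (g := fun x : List (N × SHACL I L V N) × List (N × SHACL I L V Empty) =>
      (dedupFst (x.1.flatMap shaclDecl ++ x.2.flatMap shaclSelDecl),
        x.2.map fun d => (pathName [] (selShape d), (ShEx.top : ShEx I L V Empty))))
    shacl_code_eq shEx_code_eq (by fun_prop) fun S => rfl

end Schema

end RDFShapes

theorem mainTheorem1 {I L B V N : Type} [Encodable I] [Encodable L] [Encodable V] [Denumerable N]
    (val : V → Set (RDFShapes.Node I L B)) :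
    (∃ T : RDFShapes.Schema (RDFShapes.restrictedShEx val) N →
        RDFShapes.Schema (RDFShapes.restrictedSHACL val) N,
      RDFShapes.Effective RDFShapes.Schema.code RDFShapes.Schema.code T ∧
      ∀ S, S.Stratified → (T S).Stratified ∧
        ∀ G : RDFShapes.Graph I L B, S.GFPConforms G ↔ (T S).LFPConforms G) ∧
    (∃ T : RDFShapes.Schema (RDFShapes.restrictedSHACL val) N →
        RDFShapes.Schema (RDFShapes.restrictedShEx val) N,
      RDFShapes.Effective RDFShapes.Schema.code RDFShapes.Schema.code T ∧
      ∀ S, S.Stratified → (T S).Stratified ∧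
        ∀ G : RDFShapes.Graph I L B, S.LFPConforms G ↔ (T S).GFPConforms G) :=
  ⟨⟨RDFShapes.Schema.toSHACL, RDFShapes.Schema.effective_toSHACL, fun _ ⟨_, hr⟩ =>
      ⟨⟨_, RDFShapes.Schema.toSHACL_isStratification hr⟩, fun _ =>
        RDFShapes.Schema.gfpConforms_iff_toSHACL hr⟩⟩,
    ⟨RDFShapes.Schema.toShEx, RDFShapes.Schema.effective_toShEx, fun _ h =>
      ⟨RDFShapes.Schema.toShEx_stratified h, fun _ =>
        RDFShapes.Schema.lfpConforms_iff_toShEx h.choose_spec⟩⟩⟩
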